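/- Let $\mathcal N=\omega^\omega$ be Baire space. An \emph{ordinal} is a well-ordering of a subset of $\mathbb N$; $\alpha\le\beta$ means that $\alpha$ is an initial segment of $\beta$. An oracle $z\in\mathcal N$ computes $\alpha$ if it computes its field, its order relation, its successor function, its set of limit points, and its least and greatest elements, including whether these exist (for families: uniformly). \textbf{True stages.} Fix a universal machine with an oracle tape for a finite or infinite string $\rho\in\omega^{\le\omega}$ and an additional oracle tape holding $z$. Let $\rho'$ be the set of inputs on which it halts in fewer than $|\rho|$ steps, arranged so that extending $\rho$ by one entry adds at most one element; let $p(\rho)$ be the last element enumerated into $\rho'$ ($-1$ if $\rho'=\emptyset$, $\infty$ if $\rho$ is infinite). For an ordinal $\delta$ computed by $z$ and $\alpha<\delta$, let $n_\alpha\in\mathbb N$ be the element of the field of $\delta$ that bounds $\alpha$. Define relations $\preceq_\alpha=\preceq^z_\alpha$ on $\omega^{\le\omega}$ for $\alpha\le\delta$ by recursion: $\preceq_0$ is the initial segment relation; for limit $\alpha$, $\sigma\preceq_\alpha\tau$ iff $\sigma\preceq_\beta\tau$ for all $\beta<\alpha$; and $\sigma\preceq_{\alpha+1}\tau$ iff $\sigma\preceq_\alpha\tau$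 and there is no $e<p(\sigma^{(\alpha)})$ in $(\tau^{(\alpha)})'\setminus(\sigma^{(\alpha)})'$, where $\tau^{(\alpha)}$ is the increasing enumeration of (codes of) the strings $\sigma\prec_\alpha\tau$, omitting the first $n_\alpha$ of them. A \emph{$(z,\alpha)$-forest} is a set $S\subseteq\omega^{<\omega}$ that is convex for $\preceq^z_\alpha$; $[S]$ is the set of $x\in\mathcal N$ with infinitely many $\sigma\prec^z_\alpha x$ in $S$. \textbf{Class descriptions.} A \emph{class description} $\Gamma$ consists of an oracle $y^\Gamma$; a nonempty well-founded tree $T_\Gamma\subseteq\omega^{<\omega}$; a label in $\{0,1\}$ for each leaf; and ordinals $\xi_s$ and $\eta_s\neq0$ for each non-leaf $s$, such that $\xi_s\le\xi_t$ whenever $s\preceq t$ are non-leaves; $y^\Gamma$ must compute $T_\Gamma$, its set of leaves, the labels, and uniformly all the $\xi_s$ and $\eta_s$. \textbf{Names.} A \emph{$\Gamma$-name} $N$ consists of an oracle $z\ge_T y^\Gamma$; a $z$-computable $(z,\xi_{\langle\rangle})$-forest $S$ (if the root is a leaf: a $z$-computable $(z,\alpha)$-forest for some $z$-computable ordinal $\alpha$);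 and, for each non-leaf $s$, uniformly $z$-computable functions $f_s$ from $S$ to the children of $s$ and $\beta_s\colon S\to\eta_s+1$ such that: for every $x\in[S]$, $f_s(\sigma)$ is constant, with value denoted $f_s(x)$, for all but finitely many $\sigma\prec^z_{\xi_s}x$; if $\sigma\preceq^z_{\xi_s}\tau$ are in $S$ then $\beta_s(\tau)\le\beta_s(\sigma)$, and $\beta_s(\tau)<\beta_s(\sigma)$ if $f_s(\sigma)\ne f_s(\tau)$; and if $\beta_s(\sigma)=\eta_s$ then $f_s(\sigma)$ is the leftmost child of $s$. The name $N$ defines $F^N\colon[S]\to\{0,1\}$: $F^N(x)$ is the label of the leaf reached from the root by moving repeatedly from a non-leaf $s$ to $f_s(x)$. The name is \emph{total} if $S=\omega^{<\omega}$. Let $\Gamma(z)$ be the set of all $F^N$ for $\Gamma$-names $N$ with oracle $z$, and let $\mathbf\Gamma=\bigcup_{z\ge_T y^\Gamma}\Gamma(z)$. The \emph{total functions} in $\mathbf\Gamma$ or $\Gamma(z)$ are the $F^N$ for total such names $N$. Fix the computable bijection $(z,x)\mapsto\langle z,x\rangle$ from $\mathcal N^2$ to $\mathcal N$ that interleaves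 $z$ and $x$. \textbf{Statement.} For every class description $\Gamma$, there is a total function $U\in\Gamma(y^\Gamma)$ that is universal for the total $\mathbf\Gamma$ functions: the functions $x\mapsto U(\langle z,x\rangle)$, for $z\in\mathcal N$, are exactly the total functions in $\mathbf\Gamma$; moreover $1-U\notin\mathbf\Gamma$. Consequently $\mathbf\Gamma$ is a non-self-dual Wadge class: the collection of all $A\subseteq\mathcal N$ whose characteristic function is a total function in $\mathbf\Gamma$ equals $\{A : A\text{ is a continuous preimage of }B\}$ for some $B\subseteq\mathcal N$, and it is not closed under complements. -/

import Mathlib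

open Encodable

namespace Wadge

/-- Baire space, with the product topology of the discrete topologies. -/
abbrev Baire : Type := ℕ → ℕ

/-! ### Computability relative to an oracle -/

/-- `f` is computed by the oracle `z` on the set `D`: some partial `z`-recursive function converges
to `f a` for every `a ∈ D`. Nothing is asked about inputs outside `D`. -/
def ComputableOn {α β : Type} [Primcodable α] [Primcodable β] (z : Baire) (D : Set α)
    (f : α → β) : Prop :=
  ∃ g : α →. β, RecursiveIn {(z : ℕ →. ℕ)} g ∧ ∀ a ∈ D, f a ∈ g a

/-- The oracle `z` decides the predicate `P` on the set `D`. -/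
def DecidableOn {α : Type} [Primcodable α] (z : Baire) (D : Set α) (P : α → Prop) : Prop :=
  ∃ g : α →. Bool, RecursiveIn {(z : ℕ →. ℕ)} g ∧ ∀ a ∈ D, ∃ b ∈ g a, (b = true ↔ P a)

/-- `y ≤_T z` for elements of Baire space. -/
def TuringLE (y z : Baire) : Prop := TuringReducible (y : ℕ →. ℕ) (z : ℕ →. ℕ)

/-! ### Ordinals as well-orderings of sets of natural numbers -/

/-- A well-ordering of a subset of `ℕ`. -/
structure NOrdinal where
  field : Set ℕ
  lt : ℕ → ℕ → Prop
  mem_of_lt : ∀ {a b : ℕ}, lt a b → a ∈ field ∧ b ∈ field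
  trans : ∀ {a b c : ℕ}, lt a b → lt b c → lt a c
  trichotomous : ∀ {a b : ℕ}, a ∈ field → b ∈ field → lt a b ∨ a = b ∨ lt b a
  wf : WellFounded lt

namespace NOrdinal

/-- `α ≤ β`: `α` is an initial segment of `β` (possibly all of `β`). -/
def IsInitial (α β : NOrdinal) : Prop :=
  α.field ⊆ β.field ∧ (∀ a ∈ α.field, ∀ b ∈ α.field, (α.lt a b ↔ β.lt a b)) ∧
    ∀ a b : ℕ, β.lt a b → b ∈ α.field → a ∈ α.field

open Classical in
/-- The `α`-least element of a set `A`, if there is one. -/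
noncomputable def least (α : NOrdinal) (A : Set ℕ) : Option ℕ :=
  if h : ∃ a ∈ A, ∀ b ∈ A, b = a ∨ α.lt a b then some h.choose else none

open Classical in
/-- The `α`-greatest element of a set `A`, if there is one. -/
noncomputable def greatest (α : NOrdinal) (A : Set ℕ) : Option ℕ :=
  if h : ∃ a ∈ A, ∀ b ∈ A, b = a ∨ α.lt b a then some h.choose else none

/-- The successor function of `α`; undefined at the greatest element. -/
noncomputable def succ (α : NOrdinal) (a : ℕ) : Option ℕ := α.least {b | α.lt a b}

/-- `a` is a limit point of `α`. -/
def IsLimitPoint (α : NOrdinal) (a : ℕ) : Prop :=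
  a ∈ α.field ∧ (∃ b, α.lt b a) ∧ ∀ b, α.lt b a → ∃ c, α.lt b c ∧ α.lt c a

/-- The oracle `z` computes the ordinals `α i`, uniformly in `i ∈ D`: it computes the fields, the
order relations, the successor functions, the sets of limit points, the initial elements and the
greatest elements. The last two include the information whether they exist, so they tell whether
`α i` is zero, a successor or a limit. -/
def ComputedOn {ι : Type} [Primcodable ι] (z : Baire) (D : Set ι) (α : ι → NOrdinal) : Prop :=
  DecidableOn z {p : ι × ℕ | p.1 ∈ D} (fun p => p.2 ∈ (α p.1).field) ∧
  DecidableOn z {p : ι × ℕ × ℕ | p.1 ∈ D} (fun p => (α p.1).lt p.2.1 p.2.2) ∧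
  ComputableOn z {p : ι × ℕ | p.1 ∈ D} (fun p => (α p.1).succ p.2) ∧
  DecidableOn z {p : ι × ℕ | p.1 ∈ D} (fun p => (α p.1).IsLimitPoint p.2) ∧
  ComputableOn z D (fun i => (α i).least (α i).field) ∧
  ComputableOn z D (fun i => (α i).greatest (α i).field)

/-- The oracle `z` computes the ordinal `α`. -/
def Computed (z : Baire) (α : NOrdinal) : Prop :=
  ComputedOn z (Set.univ : Set Unit) (fun _ => α)

end NOrdinal

/-! ### Finite and infinite strings -/

/-- Finite and infinite sequences of natural numbers. -/
inductive Str : Type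
  | fin (l : List ℕ) : Str
  | inf (x : Baire) : Str

namespace Str

/-- The length of a string. -/
def len : Str → ℕ∞
  | fin l => (l.length : ℕ∞)
  | inf _ => ⊤

/-- The first `i` entries (all entries, if there are fewer than `i`). -/
def take : Str → ℕ → List ℕ
  | fin l, i => l.take i
  | inf x, i => (List.range i).map x

/-- `σ` is an initial segment of `τ` (not necessarily a proper one). -/
def IsPrefix : Str → Str → Prop
  | fin l, τ => τ.take l.length = l
  | inf x, τ => τ = inf x

open Classical in
/-- The string that lists the values of `g` along the increasing enumeration of `P`, leaving out
the first `n` elements of `P`. -/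
noncomputable def enumerate (P : Set ℕ) (n : ℕ) (g : ℕ → ℕ) : Str :=
  if h : P.Finite then fin (((h.toFinset.sort (· ≤ ·)).drop n).map g)
  else inf (fun j => g (Nat.nth (· ∈ P) (n + j)))

end Str

/-! ### Jumps of strings

The universal machine has an oracle tape with the string `ρ` and an extra oracle tape with `z`. On
input `e = ⟨c, m⟩` it runs, for all `⟨j, t⟩` in turn, the `c`-th program for `t` steps on `m` and the
first `j` entries of both tapes, and it halts as soon as one of these runs halts. The attempt
`⟨j, t⟩` on input `e` is made at stage `⟨e, ⟨j, t⟩⟩`, so that at most one input is enumerated at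
each stage. -/

/-- At stage `s` the machine with tapes `z` and `ρ` is seen to halt on the input `s.unpair.1`. As
`s` is smaller than the length of `ρ`, only existing entries of `ρ` are used. -/
def HaltsAt (z : Baire) (ρ : Str) (s : ℕ) : Prop :=
  (s : ℕ∞) < ρ.len ∧
    (Nat.Partrec.Code.evaln s.unpair.2.unpair.2
      (Denumerable.ofNat Nat.Partrec.Code s.unpair.1.unpair.1)
      (encode ((Str.inf z).take s.unpair.2.unpair.1, ρ.take s.unpair.2.unpair.1,
        s.unpair.1.unpair.2))).isSome

/-- The jump `ρ'` relative to `z`: the inputs on which the universal machine halts in fewer than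
`|ρ|` steps. -/
def jump (z : Baire) (ρ : Str) : Set ℕ := {e | ∃ s, HaltsAt z ρ s ∧ s.unpair.1 = e}

open Classical in
/-- The last element enumerated into the jump of `ρ` before stage `s`; `⊥` (that is, `-1`) if no
element has been enumerated. -/
noncomputable def lastBefore (z : Baire) (ρ : Str) : ℕ → WithBot ℕ∞
  | 0 => ⊥
  | s + 1 =>
    if HaltsAt z ρ s ∧ ∀ r < s, HaltsAt z ρ r → r.unpair.1 ≠ s.unpair.1 then
      (((s.unpair.1 : ℕ) : ℕ∞) : WithBot ℕ∞)
    else lastBefore z ρ s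

/-- `p(ρ)`: the last element enumerated into the jump of a finite string `ρ` (`-1` if the jump is
empty); `∞` for an infinite string. -/
noncomputable def lastEnum (z : Baire) : Str → WithBot ℕ∞
  | .fin l => lastBefore z (.fin l) l.length
  | .inf _ => ((⊤ : ℕ∞) : WithBot ℕ∞)

/-! ### The true stage relations -/

/-- If `R` is the relation `⪯_α`, and `n = n_α` is the bound of `α` in a larger ordinal, then this
is the string `τ^(α)`: the increasing enumeration of all `σ ≺_α τ`, excluding the first `n` of them,
with finite strings coded by natural numbers. (All strings `σ ≺_α τ` are proper initial segments of
`τ`.) -/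
noncomputable def derivedString (n : ℕ) (R : Str → Str → Prop) (τ : Str) : Str :=
  Str.enumerate {i : ℕ | (i : ℕ∞) < τ.len ∧ R (.fin (τ.take i)) τ} n (fun i => encode (τ.take i))

/-- The condition for passing from `⪯_α` (the relation `R`) to `⪯_{α+1}`, where `n = n_α`: there is
no `e < p(σ^(α))` in the jump of `τ^(α)` that is not in the jump of `σ^(α)`. -/
def JumpAgree (z : Baire) (n : ℕ) (R : Str → Str → Prop) (σ τ : Str) : Prop :=
  ¬ ∃ e : ℕ, ((e : ℕ∞) : WithBot ℕ∞) < lastEnum z (derivedString n R σ) ∧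
    e ∈ jump z (derivedString n R τ) ∧ e ∉ jump z (derivedString n R σ)

/-- For `n` in the field of `δ`, the relation `⪯^z_α` where `α` is the initial segment of `δ` below
`n`. The recursion of the true stage relations (initial segment at `0`, intersection at limits,
`JumpAgree` added at successors) is unfolded into one clause; the theorems below recover the three
cases. -/
noncomputable def trueStageBelow (z : Baire) (δ : NOrdinal) : ℕ → Str → Str → Prop :=
  δ.wf.fix fun n ih σ τ =>
    σ.IsPrefix τ ∧ ∀ (m : ℕ) (h : δ.lt m n), JumpAgree z m (ih m h) σ τ

/-- The true stage relation `σ ⪯^z_δ τ`. -/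
def TrueStage (z : Baire) (δ : NOrdinal) (σ τ : Str) : Prop :=
  σ.IsPrefix τ ∧ ∀ m ∈ δ.field, JumpAgree z m (trueStageBelow z δ m) σ τ

theorem trueStageBelow_iff (z : Baire) (δ : NOrdinal) (n : ℕ) (σ τ : Str) :
    trueStageBelow z δ n σ τ ↔
      σ.IsPrefix τ ∧ ∀ m, δ.lt m n → JumpAgree z m (trueStageBelow z δ m) σ τ := by
  unfold trueStageBelow
  rw [WellFounded.fix_eq]

/-- The initial segment of `δ` below `n`. -/
def NOrdinal.below (δ : NOrdinal) (n : ℕ) : NOrdinal where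
  field := {m | δ.lt m n}
  lt a b := δ.lt a b ∧ δ.lt b n
  mem_of_lt h := ⟨δ.trans h.1 h.2, h.2⟩
  trans h k := ⟨δ.trans h.1 k.1, k.2⟩
  trichotomous {a b} ha hb := by
    rcases δ.trichotomous (δ.mem_of_lt ha).1 (δ.mem_of_lt hb).1 with h | h | h
    · exact Or.inl ⟨h, hb⟩
    · exact Or.inr (Or.inl h)
    · exact Or.inr (Or.inr ⟨h, ha⟩)
  wf := Subrelation.wf (fun h => h.1) δ.wf

theorem trueStageBelow_below (z : Baire) (δ : NOrdinal) (n m : ℕ) (h : δ.lt m n) :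
    trueStageBelow z (δ.below n) m = trueStageBelow z δ m := by
  induction m using δ.wf.induction with
  | _ m ih =>
    funext σ τ
    apply propext
    rw [trueStageBelow_iff, trueStageBelow_iff]
    refine and_congr_right fun _ => forall_congr' fun k => ?_
    constructor
    · intro H hk
      have := H ⟨hk, h⟩
      rwa [ih k hk (δ.trans hk h)] at this
    · intro H hk
      rw [ih k hk.1 (δ.trans hk.1 h)]
      exact H hk.1

/-- The relation `⪯_α` does not depend on the larger ordinal in which it is computed. -/
theorem trueStage_below (z : Baire) (δ : NOrdinal) (n : ℕ) :
    TrueStage z (δ.below n) = trueStageBelow z δ n := by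
  funext σ τ
  apply propext
  rw [trueStageBelow_iff]
  refine and_congr_right fun _ => forall_congr' fun k => ?_
  constructor
  · intro H hk
    have := H hk
    rwa [trueStageBelow_below z δ n k hk] at this
  · intro H hk
    rw [trueStageBelow_below z δ n k hk]
    exact H hk

/-- The relation `⪯_0`. -/
theorem trueStage_zero (z : Baire) (δ : NOrdinal) (h : δ.field = ∅) (σ τ : Str) :
    TrueStage z δ σ τ ↔ σ.IsPrefix τ := by
  simp [TrueStage, h]

/-- The successor case: `δ = α + 1`, where `α` is the initial segment below the greatest element
`n` of `δ`. -/
theorem trueStage_succ (z : Baire) (δ : NOrdinal) (n : ℕ) (hn : n ∈ δ.field)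
    (hmax : ∀ m ∈ δ.field, m = n ∨ δ.lt m n) (σ τ : Str) :
    TrueStage z δ σ τ ↔
      TrueStage z (δ.below n) σ τ ∧ JumpAgree z n (TrueStage z (δ.below n)) σ τ := by
  rw [trueStage_below, trueStageBelow_iff, TrueStage]
  constructor
  · rintro ⟨h, H⟩
    exact ⟨⟨h, fun m hm => H m (δ.mem_of_lt hm).1⟩, H n hn⟩
  · rintro ⟨⟨h, H⟩, K⟩
    refine ⟨h, fun m hm => ?_⟩
    rcases hmax m hm with rfl | hm
    · exact K
    · exact H m hm

/-- The limit case. -/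
theorem trueStage_limit (z : Baire) (δ : NOrdinal) (hne : δ.field.Nonempty)
    (hlim : ∀ m ∈ δ.field, ∃ n, δ.lt m n) (σ τ : Str) :
    TrueStage z δ σ τ ↔ ∀ n ∈ δ.field, TrueStage z (δ.below n) σ τ := by
  simp only [trueStage_below, trueStageBelow_iff]
  constructor
  · rintro ⟨h, H⟩ n _
    exact ⟨h, fun m hm => H m (δ.mem_of_lt hm).1⟩
  · intro H
    obtain ⟨a, ha⟩ := hne
    refine ⟨(H a ha).1, fun m hm => ?_⟩
    obtain ⟨n, hn⟩ := hlim m hm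
    exact (H n (δ.mem_of_lt hn).2).2 m hn

/-! ### Forests -/

/-- `S` is convex for `⪯^z_α`. -/
def IsForest (z : Baire) (α : NOrdinal) (S : Set (List ℕ)) : Prop :=
  ∀ σ ρ τ : List ℕ, TrueStage z α (.fin σ) (.fin ρ) → TrueStage z α (.fin ρ) (.fin τ) →
    σ ∈ S → τ ∈ S → ρ ∈ S

/-- The set `[S]^z_α` of `x` such that `σ ≺^z_α x` for infinitely many `σ ∈ S`. -/
def paths (z : Baire) (α : NOrdinal) (S : Set (List ℕ)) : Set Baire :=
  {x | {σ : List ℕ | σ ∈ S ∧ TrueStage z α (.fin σ) (.inf x)}.Infinite}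

/-! ### Class descriptions -/

/-- `s` is a leaf of the tree `T`. -/
def IsLeaf (T : Set (List ℕ)) (s : List ℕ) : Prop := s ∈ T ∧ ∀ n : ℕ, s ++ [n] ∉ T

/-- The elements of the tree `T` that are not leaves. -/
def nonLeaves (T : Set (List ℕ)) : Set (List ℕ) := {s | s ∈ T ∧ ∃ n : ℕ, s ++ [n] ∈ T}

/-- A class description. The functions `ξ` and `η` only matter at non-leaves of the tree, and
`label` only matters at leaves. -/
structure ClassDescription where
  /-- the oracle `y^Γ` -/
  y : Baire
  /-- the tree `T_Γ` -/
  T : Set (List ℕ)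
  ξ : List ℕ → NOrdinal
  η : List ℕ → NOrdinal
  label : List ℕ → Bool
  root_mem : [] ∈ T
  mem_of_append : ∀ (s : List ℕ) (n : ℕ), s ++ [n] ∈ T → s ∈ T
  wellFounded : ∀ x : Baire, ∃ n : ℕ, (Str.inf x).take n ∉ T
  η_ne_zero : ∀ s ∈ nonLeaves T, (η s).field.Nonempty
  ξ_mono : ∀ s ∈ nonLeaves T, ∀ t ∈ nonLeaves T, s <+: t → (ξ s).IsInitial (ξ t)
  decidable_T : DecidableOn y Set.univ (fun s => s ∈ T)
  decidable_leaf : DecidableOn y Set.univ (fun s => IsLeaf T s)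
  computable_label : ComputableOn y {s | IsLeaf T s} label
  computable_ξ : NOrdinal.ComputedOn y (nonLeaves T) ξ
  computable_η : NOrdinal.ComputedOn y (nonLeaves T) η

namespace ClassDescription

/-- `β < γ` in `η + 1`, where elements of `η + 1` are elements of the field of `η` or the extra
greatest element `none`. -/
def boundLT (η : NOrdinal) : Option ℕ → Option ℕ → Prop
  | some a, some b => η.lt a b
  | some _, none => True
  | none, _ => False

/-- A `Γ`-name. The child `s ++ [n]` of `s` is represented by the number `n`. Values of `f`, `β` and
`lim` only matter for non-leaves `s`, for `σ ∈ S` and for `x ∈ [S]`. -/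
structure Name (Γ : ClassDescription) where
  /-- the oracle `z^N` -/
  z : Baire
  /-- the level of the forest: `o(Γ)` if the root of `T_Γ` is not a leaf, and any `z`-computable
  ordinal otherwise (this is the convention for `o(Γ) = ω₁`) -/
  level : NOrdinal
  /-- the forest `S^N` -/
  S : Set (List ℕ)
  f : List ℕ → List ℕ → ℕ
  β : List ℕ → List ℕ → Option ℕ
  /-- `lim s` is the function on `[S]` approximated by `f s` -/
  lim : List ℕ → Baire → ℕ
  le_z : TuringLE Γ.y z
  level_eq : [] ∈ nonLeaves Γ.T → level = Γ.ξ []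
  level_computed : NOrdinal.Computed z level
  isForest : IsForest z level S
  decidable_S : DecidableOn z Set.univ (fun σ => σ ∈ S)
  computable_f : ComputableOn z {p : List ℕ × List ℕ | p.1 ∈ nonLeaves Γ.T ∧ p.2 ∈ S}
    (fun p => f p.1 p.2)
  computable_β : ComputableOn z {p : List ℕ × List ℕ | p.1 ∈ nonLeaves Γ.T ∧ p.2 ∈ S}
    (fun p => β p.1 p.2)
  approximates : ∀ s ∈ nonLeaves Γ.T, ∀ x ∈ paths z level S,
    {σ : List ℕ | TrueStage z (Γ.ξ s) (.fin σ) (.inf x) ∧ ¬ (σ ∈ S ∧ f s σ = lim s x)}.Finite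
  β_mem : ∀ s ∈ nonLeaves Γ.T, ∀ σ ∈ S, ∀ b : ℕ, β s σ = some b → b ∈ (Γ.η s).field
  β_anti : ∀ s ∈ nonLeaves Γ.T, ∀ σ ∈ S, ∀ τ ∈ S, TrueStage z (Γ.ξ s) (.fin σ) (.fin τ) →
    β s τ = β s σ ∨ boundLT (Γ.η s) (β s τ) (β s σ)
  β_lt : ∀ s ∈ nonLeaves Γ.T, ∀ σ ∈ S, ∀ τ ∈ S, TrueStage z (Γ.ξ s) (.fin σ) (.fin τ) →
    f s σ ≠ f s τ → boundLT (Γ.η s) (β s τ) (β s σ)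
  child_mem : ∀ s ∈ nonLeaves Γ.T, ∀ σ ∈ S, s ++ [f s σ] ∈ Γ.T
  default : ∀ s ∈ nonLeaves Γ.T, ∀ σ ∈ S, β s σ = none → ∀ n < f s σ, s ++ [n] ∉ Γ.T

namespace Name

variable {Γ : ClassDescription}

/-- `s` is the leaf of `T_Γ` reached from the root by following the functions `lim` at `x`. -/
def IsLeafAt (N : Name Γ) (x : Baire) (s : List ℕ) : Prop :=
  IsLeaf Γ.T s ∧ ∀ (t : List ℕ) (n : ℕ), t ++ [n] <+: s → N.lim t x = n

/-- The leaf `ℓ^N(x)`, for `x ∈ [S^N]`. -/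
noncomputable def leaf (N : Name Γ) (x : Baire) : List ℕ := Classical.epsilon (N.IsLeafAt x)

/-- The partial function `F^N`, with domain `[S^N]`. -/
noncomputable def toFun (N : Name Γ) : Baire →. Bool :=
  fun x => ⟨x ∈ paths N.z N.level N.S, fun _ => Γ.label (N.leaf x)⟩

/-- A name is total if its forest consists of all finite strings. -/
def IsTotal (N : Name Γ) : Prop := N.S = Set.univ

end Name

variable (Γ : ClassDescription)

/-- The class `Γ(z)` of partial functions. -/
def lightface (z : Baire) : Set (Baire →. Bool) := {F | ∃ N : Name Γ, N.z = z ∧ N.toFun = F}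

/-- The class `𝚪` of partial functions. -/
def boldface : Set (Baire →. Bool) := ⋃ z ∈ {z : Baire | TuringLE Γ.y z}, Γ.lightface z

/-- The functions named by total `Γ(z)`-names. -/
def totalLightface (z : Baire) : Set (Baire → Bool) :=
  {F | ∃ N : Name Γ, N.z = z ∧ N.IsTotal ∧ N.toFun = (F : Baire →. Bool)}

/-- The total functions in `𝚪`. -/
def totalBoldface : Set (Baire → Bool) :=
  {F | ∃ N : Name Γ, N.IsTotal ∧ N.toFun = (F : Baire →. Bool)}

/-- The pointclass of `Γ`: the sets whose characteristic functions are total functions in `𝚪`. -/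
def pointclass : Set (Set Baire) :=
  {A | ∃ F ∈ Γ.totalBoldface, A = {x | F x = true}}

end ClassDescription

/-! ### Universal functions and Wadge classes -/

/-- The computable bijection `(z, x) ↦ ⟨z, x⟩` that interleaves `z` and `x`. -/
def pairing (z x : Baire) : Baire := fun n => if n % 2 = 0 then z (n / 2) else x (n / 2)

/-- `U` is universal for the class `C`: the functions `x ↦ U ⟨z, x⟩` are exactly those in `C`. -/
def IsUniversalFor (U : Baire → Bool) (C : Set (Baire → Bool)) : Prop :=
  {F | ∃ z : Baire, F = fun x => U (pairing z x)} = C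

/-- Wadge reducibility. -/
def WadgeLE (A B : Set Baire) : Prop := ∃ g : Baire → Baire, Continuous g ∧ A = g ⁻¹' B

/-- `C` is the Wadge class of some set. -/
def IsWadgeClass (C : Set (Set Baire)) : Prop := ∃ B : Set Baire, C = {A | WadgeLE A B}

/-- `C` is not self-dual, i.e. not closed under complements. -/
def IsNonSelfDual (C : Set (Set Baire)) : Prop := ∃ A ∈ C, Aᶜ ∉ C

end Wadge

/-! Everything rests on one simulation, `exists_name`: given `y`-computable continuous maps `Z` and
`G`, there is a total name with oracle `y` that, at each point `w`, reaches the same leaf as any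
name `N` with oracle `Z w` at the point `G w`, provided that the functions of `N` are recognized by
a `y`-decidable predicate along the prefixes of `w`. If `w` codes a program, an oracle and an
argument, this yields the universal function (`exists_sections_eq`). If `Z` is constant and `G` is
an arbitrary continuous function, made computable by enlarging the oracle, it yields closure under
continuous preimages (`comp_mem_totalBoldface`), and this even for a non-total name whose function
happens to be defined everywhere. Closure puts the sections of `U` into the class and makes the
class the Wadge class of `{x | U x = true}`. It also gives the diagonal argument: if `1 - U` were in
the class, so would be `x ↦ 1 - U ⟨x, x⟩`, which would then be the section of `U` at some `z`, a
contradiction at `x = z`.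

The obstacle is that `N` is governed by the true stages of `G w` relative to `Z w`, whereas the
simulating name sees only the true stages of `w` relative to `y`. The bridge is the notion of
certificate (`Cert`). A string `σ` is a true stage of the image if, for each lower level `m`, no `e`
below the last element enumerated at `σ` and missing there enters the jump later. By the recursion
theorem there is a program `c` that puts `⟨c, (s, m, e)⟩` into the jump of the `m`-th derived string
of `w` exactly when `e` enters the corresponding jump of the image. A true stage `ρ` of `w` that has
passed this number without enumerating it guarantees that it never will be enumerated, and so it
vouches for `e`. Conversely `p(ρ)` tends to infinity along the true stages of `w`, so every true
stage of the image is certified eventually. This is `cert_spec`, an induction on the level in which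
correctness of `c` at the levels `m` below is the induction hypothesis (`mem_jump_iff_of_cert`). It
needs that there are infinitely many true stages (`treeLike_rel`) and that the relations on finite
strings are decidable (`Dec.rel`).

Given certificates, the simulating name starts at each node with the leftmost child and the top
bound, and adopts the child and bound of a certified `σ` whenever that bound is smaller.
Well-foundedness makes the run stabilize at the least bound that occurs, and the descent condition
on `N` forces the child adopted there to be the limit value (`lim_approx_eq`). -/

namespace Wadge

/-! ### Primitive recursive predicates with bounded quantifiers -/

section Primrec

variable {α β γ : Type} [Primcodable α] [Primcodable β] [Primcodable γ]

theorem PrimrecPred.exists_lt_bound {P : α → ℕ → Prop} {n : α → ℕ}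
    (hP : PrimrecPred fun p : α × ℕ => P p.1 p.2) (hn : Primrec n) :
    PrimrecPred fun a => ∃ i < n a, P a i := by
  have h : PrimrecRel fun (i : ℕ) (a : α) => P a i :=
    PrimrecPred.comp (f := fun p : ℕ × α => (p.2, p.1)) hP (Primrec.snd.pair Primrec.fst)
  exact (PrimrecRel.comp h.exists_mem_list (Primrec.list_range.comp hn) Primrec.id).of_eq
    fun a => by simp

theorem PrimrecPred.forall_lt_bound {P : α → ℕ → Prop} {n : α → ℕ}
    (hP : PrimrecPred fun p : α × ℕ => P p.1 p.2) (hn : Primrec n) :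
    PrimrecPred fun a => ∀ i < n a, P a i := by
  have h : PrimrecRel fun (i : ℕ) (a : α) => P a i :=
    PrimrecPred.comp (f := fun p : ℕ × α => (p.2, p.1)) hP (Primrec.snd.pair Primrec.fst)
  exact (PrimrecRel.comp h.forall_mem_list (Primrec.list_range.comp hn) Primrec.id).of_eq
    fun a => by simp

theorem PrimrecPred.exists_decode_lt {P : α → β → Prop} {n : α → ℕ}
    (hP : PrimrecPred fun p : α × β => P p.1 p.2) (hn : Primrec n) :
    PrimrecPred fun a => ∃ i < n a, ∃ b, decode (α := β) i = some b ∧ P a b := by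
  have h : PrimrecRel fun (b : β) (a : α) => P a b :=
    PrimrecPred.comp (f := fun p : β × α => (p.2, p.1)) hP (Primrec.snd.pair Primrec.fst)
  have hL : Primrec fun a => (List.range (n a)).filterMap (decode (α := β)) :=
    Primrec.listFilterMap (Primrec.list_range.comp hn) (Primrec.decode.comp Primrec.snd).to₂
  refine (PrimrecRel.comp h.exists_mem_list hL Primrec.id).of_eq fun a => ?_
  simp only [List.mem_filterMap, List.mem_range, id]
  constructor
  · rintro ⟨b, ⟨i, hi, hb⟩, h⟩
    exact ⟨i, hi, b, hb, h⟩
  · rintro ⟨i, hi, b, hb, h⟩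
    exact ⟨b, ⟨i, hi, hb⟩, h⟩

end Primrec

/-! ### Predicates that are computably enumerable or decidable in an oracle -/

/-- The list of the first `k` values of `z`. -/
def pre (z : Baire) (k : ℕ) : List ℕ := (List.range k).map z

@[simp] theorem length_pre (z : Baire) (k : ℕ) : (pre z k).length = k := by simp [pre]

theorem take_pre (z : Baire) (i k : ℕ) : (pre z k).take i = pre z (min i k) := by
  simp only [pre, ← List.map_take, List.take_range]

theorem getElem?_pre (z : Baire) (i k : ℕ) (h : i < k) : (pre z k)[i]? = some (z i) := by
  simp [pre, h]

theorem pre_prefix (z : Baire) {i k : ℕ} (h : i ≤ k) : pre z i <+: pre z k := by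
  have := List.take_prefix i (pre z k)
  rwa [take_pre, min_eq_left h] at this

theorem eq_pre_of_prefix {z : Baire} {l : List ℕ} {k : ℕ} (h : l <+: pre z k) :
    l = pre z l.length := by
  have h2 := h.length_le
  rw [length_pre] at h2
  have h3 := List.prefix_iff_eq_take.1 h
  rwa [take_pre, min_eq_left h2] at h3

/-- `P` is computably enumerable in the oracle `z`. -/
def CE {α : Type} [Primcodable α] (z : Baire) (P : α → Prop) : Prop :=
  ∃ Q : List ℕ × α → Prop, PrimrecPred Q ∧ ∀ a, P a ↔ ∃ k, Q (pre z k, a)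

/-- `P` and its complement are computably enumerable in `z`. -/
def Dec {α : Type} [Primcodable α] (z : Baire) (P : α → Prop) : Prop :=
  CE z P ∧ CE z fun a => ¬ P a

/-- `f` has a graph that is computably enumerable in `z`. -/
def Cmp {α β : Type} [Primcodable α] [Primcodable β] (z : Baire) (f : α → β) : Prop :=
  CE z fun p : α × β => f p.1 = p.2

attribute [fun_prop] CE Dec Cmp

section CE

variable {α β γ : Type} [Primcodable α] [Primcodable β] [Primcodable γ] {z : Baire}

theorem CE.of_eq {P Q : α → Prop} (hP : CE z P) (h : ∀ a, P a ↔ Q a) : CE z Q :=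
  (funext fun a => propext (h a) : P = Q) ▸ hP

theorem PrimrecPred.ce {P : α → Prop} (h : PrimrecPred P) : CE z P :=
  ⟨fun p => P p.2, h.comp Primrec.snd, fun _ => by simp⟩

/-- The matrix of a computably enumerable predicate may be taken to be monotone. -/
theorem CE.exists_monotone {P : α → Prop} (h : CE z P) :
    ∃ Q : List ℕ × α → Prop, PrimrecPred Q ∧ (∀ a, P a ↔ ∃ k, Q (pre z k, a)) ∧
      ∀ u v a, u <+: v → Q (u, a) → Q (v, a) := by
  obtain ⟨Q, hQ, h⟩ := h
  -- Closing the matrix upwards: a string is accepted as soon as one of its prefixes is, itself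
  -- included because of the `+ 1`.
  refine ⟨fun p => ∃ i < p.1.length + 1, Q (p.1.take i, p.2), ?_, ?_, ?_⟩
  · refine PrimrecPred.exists_lt_bound (P := fun p i => Q (p.1.take i, p.2)) ?_
      (Primrec.succ.comp (Primrec.list_length.comp Primrec.fst))
    exact hQ.comp ((Primrec.list_take.comp Primrec.snd (Primrec.fst.comp Primrec.fst)).pair
      (Primrec.snd.comp Primrec.fst))
  · intro a
    rw [h]
    constructor
    · rintro ⟨k, hk⟩
      exact ⟨k, k, by simp, by simpa [take_pre] using hk⟩
    · rintro ⟨k, i, _, hk⟩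
      exact ⟨_, by rwa [take_pre] at hk⟩
  · rintro u v a huv ⟨i, hi, hQ⟩
    refine ⟨i, hi.trans_le (Nat.succ_le_succ huv.length_le), ?_⟩
    obtain ⟨t, rfl⟩ := huv
    rwa [List.take_append_of_le_length (Nat.lt_succ_iff.1 hi)]

@[fun_prop]
theorem CE.and {P Q : α → Prop} (hP : CE z P) (hQ : CE z Q) : CE z fun a => P a ∧ Q a := by
  obtain ⟨P', hP', h1, m1⟩ := hP.exists_monotone
  obtain ⟨Q', hQ', h2, m2⟩ := hQ.exists_monotone
  refine ⟨fun p => P' p ∧ Q' p, hP'.and hQ', fun a => ?_⟩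
  show P a ∧ Q a ↔ _
  rw [h1, h2]
  constructor
  · rintro ⟨⟨i, hi⟩, ⟨j, hj⟩⟩
    exact ⟨max i j, m1 _ _ _ (pre_prefix z (le_max_left _ _)) hi,
      m2 _ _ _ (pre_prefix z (le_max_right _ _)) hj⟩
  · rintro ⟨k, h⟩
    exact ⟨⟨k, h.1⟩, ⟨k, h.2⟩⟩

@[fun_prop]
theorem CE.or {P Q : α → Prop} (hP : CE z P) (hQ : CE z Q) : CE z fun a => P a ∨ Q a := by
  obtain ⟨P', hP', h1⟩ := hP
  obtain ⟨Q', hQ', h2⟩ := hQ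
  exact ⟨fun p => P' p ∨ Q' p, hP'.or hQ', fun a => by
    show P a ∨ Q a ↔ _
    rw [h1, h2, exists_or]⟩

/-- The search for a witness is absorbed into the search for a prefix: a prefix of length `k`
permits all witnesses with code below `k`, and by monotonicity the prefix may grow until the code
fits. -/
theorem CE.ex {P : α → β → Prop} (hP : CE z fun p : α × β => P p.1 p.2) :
    CE z fun a => ∃ b, P a b := by
  obtain ⟨Q, hQ, h, m⟩ := hP.exists_monotone
  refine ⟨fun p => ∃ i < p.1.length, ∃ b, decode (α := β) i = some b ∧ Q (p.1, (p.2, b)),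
    ?_, fun a => ?_⟩
  · refine PrimrecPred.exists_decode_lt (P := fun (p : List ℕ × α) (b : β) => Q (p.1, (p.2, b))) ?_
      (Primrec.list_length.comp Primrec.fst)
    exact hQ.comp ((Primrec.fst.comp Primrec.fst).pair
      ((Primrec.snd.comp Primrec.fst).pair Primrec.snd))
  · constructor
    · rintro ⟨b, hb⟩
      obtain ⟨k, hk⟩ := (h (a, b)).1 hb
      exact ⟨max k (encode b + 1), encode b, by simp, b, encodek b,
        m _ _ _ (pre_prefix z (le_max_left _ _)) hk⟩
    · rintro ⟨k, i, _, b, _, hb⟩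
      exact ⟨b, (h (a, b)).2 ⟨k, hb⟩⟩

/-- Finitely many searches succeed, and by monotonicity the longest of their prefixes serves for all
of them. -/
theorem CE.ball {P : α → ℕ → Prop} {n : α → ℕ} (hP : CE z fun p : α × ℕ => P p.1 p.2)
    (hn : Primrec n) : CE z fun a => ∀ i < n a, P a i := by
  obtain ⟨Q, hQ, h, m⟩ := hP.exists_monotone
  refine ⟨fun p => ∀ i < n p.2, Q (p.1, (p.2, i)), ?_, fun a => ?_⟩
  · refine PrimrecPred.forall_lt_bound (P := fun (p : List ℕ × α) i => Q (p.1, (p.2, i))) ?_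
      (hn.comp Primrec.snd)
    exact hQ.comp ((Primrec.fst.comp Primrec.fst).pair
      ((Primrec.snd.comp Primrec.fst).pair Primrec.snd))
  · constructor
    · intro H
      have : ∀ i, ∃ k, i < n a → Q (pre z k, (a, i)) := fun i => by
        by_cases hi : i < n a
        · obtain ⟨k, hk⟩ := (h (a, i)).1 (H i hi)
          exact ⟨k, fun _ => hk⟩
        · exact ⟨0, fun h => absurd h hi⟩
      choose k hk using this
      refine ⟨(Finset.range (n a)).sup k, fun i hi => ?_⟩
      exact m _ _ _ (pre_prefix z (Finset.le_sup (Finset.mem_range.2 hi))) (hk i hi)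
    · rintro ⟨k, hk⟩ i hi
      exact (h (a, i)).2 ⟨k, hk i hi⟩

theorem CE.comp_primrec {P : β → Prop} {f : α → β} (hP : CE z P) (hf : Primrec f) :
    CE z fun a => P (f a) := by
  obtain ⟨Q, hQ, h⟩ := hP
  exact ⟨fun p => Q (p.1, f p.2), hQ.comp (Primrec.fst.pair (hf.comp Primrec.snd)), fun a => h _⟩

theorem Primrec.cmp {f : α → β} (hf : Primrec f) : Cmp z f := by
  classical
  exact PrimrecPred.ce (PrimrecRel.comp Primrec.eq (hf.comp Primrec.fst) Primrec.snd)

theorem CE.comp {P : β → Prop} {f : α → β} (hP : CE z P) (hf : Cmp z f) :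
    CE z fun a => P (f a) := by
  have h : CE z fun a => ∃ b, f a = b ∧ P b :=
    CE.ex (P := fun a b => f a = b ∧ P b) (CE.and hf (hP.comp_primrec Primrec.snd))
  exact h.of_eq fun a => by simp

theorem CE.ball' {P : α → ℕ → Prop} {n : α → ℕ} (hP : CE z fun p : α × ℕ => P p.1 p.2)
    (hn : Cmp z n) : CE z fun a => ∀ i < n a, P a i := by
  have h : CE z fun p : α × ℕ => ∀ i < p.2, P p.1 i :=
    CE.ball (P := fun (p : α × ℕ) i => P p.1 i)
      (hP.comp_primrec (f := fun p : (α × ℕ) × ℕ => (p.1.1, p.2))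
        ((Primrec.fst.comp Primrec.fst).pair Primrec.snd)) Primrec.snd
  have h2 : CE z fun a => ∃ m, n a = m ∧ ∀ i < m, P a i :=
    CE.ex (P := fun a m => n a = m ∧ ∀ i < m, P a i) (CE.and hn h)
  exact h2.of_eq fun a => by simp

/-! Computable functions. -/

@[fun_prop] theorem Cmp.id : Cmp z (fun a : α => a) := Primrec.cmp Primrec.id

@[fun_prop] theorem Cmp.const (b : β) : Cmp z (fun _ : α => b) := Primrec.cmp (Primrec.const b)

@[fun_prop]
theorem Cmp.comp {f : β → γ} {g : α → β} (hf : Cmp z f) (hg : Cmp z g) :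
    Cmp z fun a => f (g a) := by
  have h : CE z fun p : α × γ => ∃ b, g p.1 = b ∧ f b = p.2 :=
    CE.ex (P := fun (p : α × γ) b => g p.1 = b ∧ f b = p.2)
      (CE.and
        (CE.comp_primrec (f := fun q : (α × γ) × β => (q.1.1, q.2)) hg
          ((Primrec.fst.comp Primrec.fst).pair Primrec.snd))
        (CE.comp_primrec (f := fun q : (α × γ) × β => (q.2, q.1.2)) hf
          (Primrec.snd.pair (Primrec.snd.comp Primrec.fst))))
  exact h.of_eq fun a => by simp

@[fun_prop]
theorem Cmp.prodMk {f : α → β} {g : α → γ} (hf : Cmp z f) (hg : Cmp z g) :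
    Cmp z fun a => (f a, g a) := by
  have h : CE z fun p : α × (β × γ) => f p.1 = p.2.1 ∧ g p.1 = p.2.2 :=
    CE.and
      (CE.comp_primrec (f := fun q : α × (β × γ) => (q.1, q.2.1)) hf
        (Primrec.fst.pair (Primrec.fst.comp Primrec.snd)))
      (CE.comp_primrec (f := fun q : α × (β × γ) => (q.1, q.2.2)) hg
        (Primrec.fst.pair (Primrec.snd.comp Primrec.snd)))
  exact h.of_eq fun a => by simp [Prod.ext_iff]

theorem Primrec.cmp_comp {f : β → γ} (hf : Primrec f) {g : α → β} (hg : Cmp z g) :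
    Cmp z fun a => f (g a) := (Primrec.cmp hf).comp hg

theorem Primrec₂.cmp_comp {δ : Type} [Primcodable δ] {f : β → γ → δ} (hf : Primrec₂ f)
    {g : α → β} {h : α → γ} (hg : Cmp z g) (hh : Cmp z h) :
    Cmp z fun a => f (g a) (h a) :=
  (Primrec.cmp (f := fun p : β × γ => f p.1 p.2) hf).comp (hg.prodMk hh)

@[fun_prop] theorem Cmp.fst {f : α → β × γ} (hf : Cmp z f) : Cmp z fun a => (f a).1 :=
  Primrec.cmp_comp Primrec.fst hf

@[fun_prop] theorem Cmp.snd {f : α → β × γ} (hf : Cmp z f) : Cmp z fun a => (f a).2 :=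
  Primrec.cmp_comp Primrec.snd hf

@[fun_prop]
theorem Cmp.take {f : α → ℕ} {g : α → List β} (hf : Cmp z f) (hg : Cmp z g) :
    Cmp z fun a => (g a).take (f a) := Primrec₂.cmp_comp Primrec.list_take hf hg

@[fun_prop]
theorem Cmp.drop {f : α → ℕ} {g : α → List β} (hf : Cmp z f) (hg : Cmp z g) :
    Cmp z fun a => (g a).drop (f a) := Primrec₂.cmp_comp Primrec.list_drop hf hg

@[fun_prop]
theorem Cmp.length {g : α → List β} (hg : Cmp z g) : Cmp z fun a => (g a).length :=
  Primrec.cmp_comp Primrec.list_length hg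

@[fun_prop]
theorem Cmp.getElem? {f : α → ℕ} {g : α → List β} (hf : Cmp z f) (hg : Cmp z g) :
    Cmp z fun a => (g a)[f a]? := Primrec₂.cmp_comp Primrec.list_getElem? hg hf

@[fun_prop]
theorem Cmp.append {f g : α → List β} (hf : Cmp z f) (hg : Cmp z g) :
    Cmp z fun a => f a ++ g a := Primrec₂.cmp_comp Primrec.list_append hf hg

@[fun_prop]
theorem Cmp.cons {f : α → β} {g : α → List β} (hf : Cmp z f) (hg : Cmp z g) :
    Cmp z fun a => f a :: g a := Primrec₂.cmp_comp Primrec.list_cons hf hg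

@[fun_prop]
theorem Cmp.optionSome {f : α → β} (hf : Cmp z f) : Cmp z fun a => some (f a) :=
  Primrec.cmp_comp Primrec.option_some hf

@[fun_prop]
theorem Cmp.add {f g : α → ℕ} (hf : Cmp z f) (hg : Cmp z g) : Cmp z fun a => f a + g a :=
  Primrec₂.cmp_comp Primrec.nat_add hf hg

@[fun_prop]
theorem Cmp.natPair {f g : α → ℕ} (hf : Cmp z f) (hg : Cmp z g) :
    Cmp z fun a => Nat.pair (f a) (g a) := Primrec₂.cmp_comp Primrec₂.natPair hf hg

@[fun_prop]
theorem Cmp.unpair {f : α → ℕ} (hf : Cmp z f) : Cmp z fun a => (f a).unpair :=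
  Primrec.cmp_comp Primrec.unpair hf

@[fun_prop]
theorem Cmp.encode {f : α → β} (hf : Cmp z f) : Cmp z fun a => encode (f a) :=
  Primrec.cmp_comp Primrec.encode hf

@[fun_prop]
theorem Cmp.decode {f : α → ℕ} (hf : Cmp z f) : Cmp z fun a => decode (α := β) (f a) :=
  Primrec.cmp_comp Primrec.decode hf

@[fun_prop]
theorem Cmp.evaln {f h : α → ℕ} {g : α → Nat.Partrec.Code} (hf : Cmp z f) (hg : Cmp z g)
    (hh : Cmp z h) : Cmp z fun a => Nat.Partrec.Code.evaln (f a) (g a) (h a) :=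
  Primrec.cmp_comp (f := fun p : (ℕ × Nat.Partrec.Code) × ℕ =>
    Nat.Partrec.Code.evaln p.1.1 p.1.2 p.2) Nat.Partrec.Code.primrec_evaln
    ((hf.prodMk hg).prodMk hh)

@[fun_prop]
theorem Cmp.ofNat {β : Type} [Denumerable β] {f : α → ℕ} (hf : Cmp z f) :
    Cmp z fun a => Denumerable.ofNat β (f a) := Primrec.cmp_comp (Primrec.ofNat β) hf

theorem Cmp.oracle : Cmp z z := by
  refine ⟨fun p => p.1[p.2.1]? = some p.2.2, ?_, fun p => ?_⟩
  · exact PrimrecRel.comp Primrec.eq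
      (Primrec.list_getElem?.comp Primrec.fst (Primrec.fst.comp Primrec.snd))
      (Primrec.option_some.comp (Primrec.snd.comp Primrec.snd))
  · constructor
    · intro h
      exact ⟨p.1 + 1, by simp only [getElem?_pre z p.1 (p.1 + 1) (Nat.lt_succ_self _), h]⟩
    · rintro ⟨k, hk⟩
      obtain ⟨h, e⟩ := List.getElem?_eq_some_iff.1 hk
      rw [← e]
      simp [pre]

/-! Decidable predicates. -/

theorem Dec.of_eq {P Q : α → Prop} (hP : Dec z P) (h : ∀ a, P a ↔ Q a) : Dec z Q :=
  (funext fun a => propext (h a) : P = Q) ▸ hP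

theorem PrimrecPred.dec {P : α → Prop} (h : PrimrecPred P) : Dec z P :=
  ⟨PrimrecPred.ce h, PrimrecPred.ce h.not⟩

theorem Dec.comp {P : β → Prop} {f : α → β} (hP : Dec z P) (hf : Cmp z f) :
    Dec z fun a => P (f a) := ⟨hP.1.comp hf, hP.2.comp hf⟩

@[fun_prop]
theorem Dec.not {P : α → Prop} (hP : Dec z P) : Dec z fun a => ¬ P a :=
  ⟨hP.2, hP.1.of_eq fun a => by simp⟩

@[fun_prop]
theorem Dec.and {P Q : α → Prop} (hP : Dec z P) (hQ : Dec z Q) : Dec z fun a => P a ∧ Q a :=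
  ⟨hP.1.and hQ.1, (hP.2.or hQ.2).of_eq fun a => by tauto⟩

@[fun_prop]
theorem Dec.or {P Q : α → Prop} (hP : Dec z P) (hQ : Dec z Q) : Dec z fun a => P a ∨ Q a :=
  ⟨hP.1.or hQ.1, (hP.2.and hQ.2).of_eq fun a => by tauto⟩

theorem Dec.imp {P Q : α → Prop} (hP : Dec z P) (hQ : Dec z Q) : Dec z fun a => P a → Q a :=
  (hP.not.or hQ).of_eq fun a => by tauto

@[fun_prop]
theorem Dec.iff {P Q : α → Prop} (hP : Dec z P) (hQ : Dec z Q) : Dec z fun a => P a ↔ Q a :=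
  ((hP.imp hQ).and (hQ.imp hP)).of_eq fun a => by tauto

theorem Dec.ball {P : α → ℕ → Prop} {n : α → ℕ} (hP : Dec z fun p : α × ℕ => P p.1 p.2)
    (hn : Cmp z n) : Dec z fun a => ∀ i < n a, P a i := by
  refine ⟨hP.1.ball' hn, ?_⟩
  have h : CE z fun a => ∃ i, i < n a ∧ ¬ P a i := by
    refine CE.ex (P := fun a i => i < n a ∧ ¬ P a i) (CE.and ?_ hP.2)
    exact CE.comp (P := fun p : ℕ × ℕ => p.1 < p.2) (f := fun p : α × ℕ => (p.2, n p.1))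
      (PrimrecPred.ce Primrec.nat_lt) (by fun_prop)
  exact h.of_eq fun a => by push Not; rfl

theorem Dec.bex {P : α → ℕ → Prop} {n : α → ℕ} (hP : Dec z fun p : α × ℕ => P p.1 p.2)
    (hn : Cmp z n) : Dec z fun a => ∃ i < n a, P a i :=
  ((Dec.ball (P := fun a i => ¬ P a i) hP.not hn).not).of_eq fun a => by push Not; rfl

@[fun_prop]
theorem Dec.eq {f g : α → β} (hf : Cmp z f) (hg : Cmp z g) : Dec z fun a => f a = g a := by
  classical
  exact Dec.comp (P := fun p : β × β => p.1 = p.2) (PrimrecPred.dec Primrec.eq) (hf.prodMk hg)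

@[fun_prop]
theorem Dec.lt {f g : α → ℕ} (hf : Cmp z f) (hg : Cmp z g) : Dec z fun a => f a < g a :=
  Dec.comp (P := fun p : ℕ × ℕ => p.1 < p.2) (PrimrecPred.dec Primrec.nat_lt) (hf.prodMk hg)

@[fun_prop]
theorem Dec.le {f g : α → ℕ} (hf : Cmp z f) (hg : Cmp z g) : Dec z fun a => f a ≤ g a :=
  Dec.comp (P := fun p : ℕ × ℕ => p.1 ≤ p.2) (PrimrecPred.dec Primrec.nat_le) (hf.prodMk hg)

@[fun_prop]
theorem Dec.mem {f : α → β} {g : α → List β} (hf : Cmp z f) (hg : Cmp z g) :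
    Dec z fun a => f a ∈ g a := by
  classical
  have h : PrimrecRel fun (l : List β) (b : β) => ∃ a ∈ l, a = b := Primrec.eq.exists_mem_list
  exact (Dec.comp (P := fun p : List β × β => ∃ a ∈ p.1, a = p.2) (PrimrecPred.dec h)
    (hg.prodMk hf)).of_eq fun a => by simp

@[fun_prop]
theorem Dec.prefix {f g : α → List β} (hf : Cmp z f) (hg : Cmp z g) :
    Dec z fun a => f a <+: g a :=
  (Dec.eq hf (Cmp.take (Cmp.length hf) hg)).of_eq fun _ => List.prefix_iff_eq_take.symm

@[fun_prop]
theorem Dec.isSome {f : α → Option β} (hf : Cmp z f) : Dec z fun a => (f a).isSome := by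
  have h : PrimrecPred fun o : Option β => o.isSome = true :=
    PrimrecRel.comp Primrec.eq Primrec.option_isSome (Primrec.const true)
  exact Dec.comp (PrimrecPred.dec h) hf

/-- Filtering a range by a decidable predicate is computable. -/
theorem Cmp.filter_range {P : α → ℕ → Prop} [∀ a, DecidablePred (P a)] {n : α → ℕ}
    (hP : Dec z fun p : α × ℕ => P p.1 p.2) (hn : Cmp z n) :
    Cmp z fun a => (List.range (n a)).filter (P a) := by
  -- The list of truth values is guessed and checked entry by entry. A primitive recursive function
  -- then turns it into the filtered range.
  have key : Cmp z fun a => (List.range (n a)).map fun i => decide (P a i) := by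
    have h : CE z fun p : α × List Bool => p.2.length = n p.1 ∧
        ∀ i < n p.1, (P p.1 i ∧ p.2[i]? = some true) ∨
          (¬ P p.1 i ∧ p.2[i]? = some false) := by
      refine CE.and (Dec.eq (by fun_prop) (by fun_prop)).1 (CE.ball' (P := fun (p : α × List Bool) i =>
        (P p.1 i ∧ p.2[i]? = some true) ∨ (¬ P p.1 i ∧ p.2[i]? = some false))
        ?_ (by fun_prop))
      have h1 : Dec z fun q : (α × List Bool) × ℕ => P q.1.1 q.2 :=
        Dec.comp (f := fun q : (α × List Bool) × ℕ => (q.1.1, q.2)) hP (by fun_prop)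
      exact (CE.and h1.1 (Dec.eq (by fun_prop) (by fun_prop)).1).or
        (CE.and h1.2 (Dec.eq (by fun_prop) (by fun_prop)).1)
    refine h.of_eq fun p => ⟨?_, ?_⟩
    · rintro ⟨h1, h2⟩
      refine List.ext_getElem? fun i => ?_
      by_cases hi : i < n p.1
      · rcases h2 i hi with h | h <;> simp [h, hi]
      · rw [List.getElem?_eq_none (by simpa using hi), List.getElem?_eq_none (by omega)]
    · intro h
      rw [← h]
      refine ⟨by simp, fun i hi => ?_⟩
      by_cases hp : P p.1 i <;> simp [hp, hi]
  have h2 : Primrec fun p : ℕ × List Bool =>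
      (List.range p.1).filterMap fun i => (p.2[i]?).bind fun b => bif b then some i else none := by
    refine Primrec.listFilterMap (Primrec.list_range.comp Primrec.fst) ?_
    refine Primrec.option_bind
      (Primrec.list_getElem?.comp (Primrec.snd.comp Primrec.fst) Primrec.snd) ?_
    exact (Primrec.cond Primrec.snd (Primrec.option_some.comp (Primrec.snd.comp Primrec.fst))
      (Primrec.const none)).to₂
  have h3 := Primrec.cmp_comp h2 (hn.prodMk key)
  refine (CE.of_eq h3 fun p => ?_)
  have : (List.range (n p.1)).filter (P p.1) = (List.range (n p.1)).filterMap fun i =>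
      ((((List.range (n p.1)).map fun i => decide (P p.1 i)))[i]?).bind
        fun b => bif b then some i else none := by
    rw [← List.filterMap_eq_filter]
    refine List.filterMap_congr fun i hi => ?_
    have := List.mem_range.1 hi
    by_cases hp : P p.1 i <;> simp [this, hp, Option.guard]
  exact Eq.congr_left this.symm

end CE

/-! ### Recursiveness in an oracle and computable enumerability -/

theorem recursiveIn_of_natPrimrec {O : Set (ℕ →. ℕ)} {f : ℕ → ℕ} (hf : Nat.Primrec f) :
    Nat.RecursiveIn O fun n => Part.some (f n) := hf.recursiveIn

theorem recursiveIn_comp_total {O : Set (ℕ →. ℕ)} {f : ℕ →. ℕ} {g : ℕ → ℕ}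
    (hf : Nat.RecursiveIn O f) (hg : Nat.RecursiveIn O fun n => Part.some (g n)) :
    Nat.RecursiveIn O fun n => f (g n) :=
  (hf.comp hg).of_eq fun _ => Part.bind_some _ _

theorem recursiveIn_pair_total {O : Set (ℕ →. ℕ)} {f g : ℕ → ℕ}
    (hf : Nat.RecursiveIn O fun n => Part.some (f n))
    (hg : Nat.RecursiveIn O fun n => Part.some (g n)) :
    Nat.RecursiveIn O fun n => Part.some (Nat.pair (f n) (g n)) :=
  (hf.pair hg).of_eq fun _ => by simp [Seq.seq]

/-- Primitive recursion with one oracle query per step. It is the bridge from predicates on finite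
oracle prefixes to `RecursiveIn`. -/
theorem recursiveIn_pre (z : Baire) :
    Nat.RecursiveIn {(z : ℕ →. ℕ)} fun k => Part.some (encode (pre z k)) := by
  have hz : Nat.RecursiveIn {(z : ℕ →. ℕ)} (z : ℕ →. ℕ) := .oracle _ rfl
  have hstep : Nat.RecursiveIn {(z : ℕ →. ℕ)} fun p =>
      Part.some (encode ((Denumerable.ofNat (List ℕ) p.unpair.2.unpair.2) ++
        [z p.unpair.2.unpair.1])) := by
    have h1 : Nat.RecursiveIn {(z : ℕ →. ℕ)} fun p => Part.some (z p.unpair.2.unpair.1) :=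
      recursiveIn_comp_total (f := (z : ℕ →. ℕ)) (g := fun p => p.unpair.2.unpair.1) hz
        (recursiveIn_of_natPrimrec
        (Nat.Primrec.left.comp Nat.Primrec.right))
    have h2 : Nat.RecursiveIn {(z : ℕ →. ℕ)} fun p => Part.some p.unpair.2.unpair.2 :=
      recursiveIn_of_natPrimrec (Nat.Primrec.right.comp Nat.Primrec.right)
    have h3 : Nat.Primrec fun p : ℕ =>
        encode (Denumerable.ofNat (List ℕ) p.unpair.1 ++ [p.unpair.2]) := by
      rw [← Primrec.nat_iff]
      exact Primrec.encode.comp (Primrec.list_concat.comp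
        ((Primrec.ofNat _).comp (Primrec.fst.comp Primrec.unpair))
        (Primrec.snd.comp Primrec.unpair))
    refine (recursiveIn_comp_total (recursiveIn_of_natPrimrec h3)
      (recursiveIn_pair_total h2 h1)).of_eq fun n => ?_
    simp
  have h := recursiveIn_comp_total (Nat.RecursiveIn.prec
    (recursiveIn_of_natPrimrec (Nat.Primrec.const (encode ([] : List ℕ)))) hstep)
    (recursiveIn_of_natPrimrec ((Nat.Primrec.const 0).pair Nat.Primrec.id))
  refine h.of_eq fun k => ?_
  simp only [Nat.unpair_pair, id]
  induction k with
  | zero => rfl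
  | succ k ih =>
    simp only [ih]
    simp [pre, List.range_succ]

section

variable {α β : Type} [Primcodable α] [Primcodable β] {z : Baire}

/-- Induction on the construction of `g`. A primitive recursion is witnessed by the finite list of
its intermediate values, which can be checked locally; a minimization is witnessed by its value,
with a bounded quantifier over the earlier arguments. -/
theorem natRecursiveIn_ce_graph {g : ℕ →. ℕ} (h : Nat.RecursiveIn {(z : ℕ →. ℕ)} g) :
    CE z fun p : ℕ × ℕ => p.2 ∈ g p.1 := by
  induction h with
  | zero =>
    exact (Dec.eq (f := fun p : ℕ × ℕ => p.2) (g := fun _ => 0)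
      (by fun_prop) (by fun_prop)).1.of_eq fun p => Part.mem_some_iff.symm
  | succ => exact (Dec.eq (f := fun p : ℕ × ℕ => p.2) (g := fun p => p.1 + 1)
      (by fun_prop) (by fun_prop)).1.of_eq fun p => by simp
  | left => exact (Dec.eq (f := fun p : ℕ × ℕ => p.2) (g := fun p => p.1.unpair.1)
      (by fun_prop) (by fun_prop)).1.of_eq fun p => by simp
  | right => exact (Dec.eq (f := fun p : ℕ × ℕ => p.2) (g := fun p => p.1.unpair.2)
      (by fun_prop) (by fun_prop)).1.of_eq fun p => by simp
  | oracle g hg =>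
    rw [Set.mem_singleton_iff] at hg
    subst hg
    exact CE.of_eq (Cmp.oracle (z := z)) fun p => by simp [eq_comm]
  | @pair f h _ _ ihf ihh =>
    have H : CE z fun p : ℕ × ℕ => p.2.unpair.1 ∈ f p.1 ∧ p.2.unpair.2 ∈ h p.1 :=
      (ihf.comp (f := fun p : ℕ × ℕ => (p.1, p.2.unpair.1)) (by fun_prop)).and
        (ihh.comp (f := fun p : ℕ × ℕ => (p.1, p.2.unpair.2)) (by fun_prop))
    refine H.of_eq fun p => ?_
    simp only [Seq.seq, Part.map_eq_map, Part.mem_bind_iff, Part.mem_map_iff, exists_exists_and_eq_and]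
    constructor
    · rintro ⟨h1, h2⟩
      exact ⟨_, h1, _, h2, by simp⟩
    · rintro ⟨a, ha, b, hb, e⟩
      rw [← e]
      simpa using ⟨ha, hb⟩
  | @comp f h _ _ ihf ihh =>
    have H : CE z fun p : ℕ × ℕ => ∃ b, b ∈ h p.1 ∧ p.2 ∈ f b :=
      CE.ex (P := fun (p : ℕ × ℕ) b => b ∈ h p.1 ∧ p.2 ∈ f b)
        ((ihh.comp (f := fun p : (ℕ × ℕ) × ℕ => (p.1.1, p.2)) (by fun_prop)).and
        (ihf.comp (f := fun p : (ℕ × ℕ) × ℕ => (p.2, p.1.2)) (by fun_prop)))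
    exact H.of_eq fun p => Part.mem_bind_iff.symm
  | @prec f h _ _ ihf ihh =>
    have H : CE z fun p : ℕ × ℕ => ∃ l : List ℕ, ((∃ b, l[0]? = some b ∧ b ∈ f p.1.unpair.1) ∧
        l[p.1.unpair.2]? = some p.2) ∧ ∀ i < p.1.unpair.2, ∃ b : ℕ × ℕ, (l[i]? = some b.1 ∧
          l[i + 1]? = some b.2) ∧ b.2 ∈ h (Nat.pair p.1.unpair.1 (Nat.pair i b.1)) := by
      refine CE.ex (P := fun (p : ℕ × ℕ) (l : List ℕ) =>
        ((∃ b, l[0]? = some b ∧ b ∈ f p.1.unpair.1) ∧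
        l[p.1.unpair.2]? = some p.2) ∧ ∀ i < p.1.unpair.2, ∃ b : ℕ × ℕ, (l[i]? = some b.1 ∧
          l[i + 1]? = some b.2) ∧ b.2 ∈ h (Nat.pair p.1.unpair.1 (Nat.pair i b.1))) ?_
      refine CE.and (CE.and ?_ (Dec.eq (by fun_prop) (by fun_prop)).1)
        (CE.ball' (P := fun (q : (ℕ × ℕ) × List ℕ) i => ∃ b : ℕ × ℕ, (q.2[i]? = some b.1 ∧
          q.2[i + 1]? = some b.2) ∧ b.2 ∈ h (Nat.pair q.1.1.unpair.1 (Nat.pair i b.1)))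
          ?_ (by fun_prop))
      · refine CE.ex (P := fun (q : (ℕ × ℕ) × List ℕ) b =>
          q.2[0]? = some b ∧ b ∈ f q.1.1.unpair.1) (CE.and (Dec.eq (by fun_prop) (by fun_prop)).1 ?_)
        exact ihf.comp (f := fun q : ((ℕ × ℕ) × List ℕ) × ℕ => (q.1.1.1.unpair.1, q.2))
          (by fun_prop)
      · refine CE.ex (P := fun (q : ((ℕ × ℕ) × List ℕ) × ℕ) (b : ℕ × ℕ) => (q.1.2[q.2]? = some b.1 ∧
          q.1.2[q.2 + 1]? = some b.2) ∧ b.2 ∈ h (Nat.pair q.1.1.1.unpair.1 (Nat.pair q.2 b.1)))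
          (CE.and (CE.and (Dec.eq (by fun_prop) (by fun_prop)).1
            (Dec.eq (by fun_prop) (by fun_prop)).1) ?_)
        exact ihh.comp (f := fun q : (((ℕ × ℕ) × List ℕ) × ℕ) × (ℕ × ℕ) =>
          (Nat.pair q.1.1.1.1.unpair.1 (Nat.pair q.1.2 q.2.1), q.2.2)) (by fun_prop)
    refine H.of_eq fun p => ?_
    obtain ⟨p, c⟩ := p
    obtain ⟨⟨a, n⟩, rfl⟩ : ∃ q : ℕ × ℕ, p = Nat.pair q.1 q.2 := ⟨p.unpair, by simp⟩
    simp only [Nat.unpair_pair]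
    constructor
    · rintro ⟨l, ⟨⟨b, hb, hbf⟩, hc⟩, hl⟩
      have key : ∀ i ≤ n, ∀ v, l[i]? = some v → v ∈ (Nat.rec (f a) (fun y IH =>
          IH.bind fun i => h (Nat.pair a (Nat.pair y i))) i : Part ℕ) := by
        intro i
        induction i with
        | zero =>
          intro _ v hv
          rw [hb] at hv
          cases hv
          exact hbf
        | succ i ih =>
          intro hi v hv
          obtain ⟨⟨b1, b2⟩, ⟨h1, h2⟩, h3⟩ := hl i hi
          rw [h2] at hv
          cases hv
          exact Part.mem_bind (ih (by omega) _ h1) h3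
      exact key n le_rfl c hc
    · intro hc
      have key : ∀ n c, c ∈ (Nat.rec (f a) (fun y IH =>
          IH.bind fun i => h (Nat.pair a (Nat.pair y i))) n : Part ℕ) → ∃ l : List ℕ,
          l.length = n + 1 ∧ ((∃ b, l[0]? = some b ∧ b ∈ f a) ∧ l[n]? = some c) ∧
          ∀ i < n, ∃ b : ℕ × ℕ, (l[i]? = some b.1 ∧ l[i + 1]? = some b.2) ∧
            b.2 ∈ h (Nat.pair a (Nat.pair i b.1)) := by
        intro n
        induction n with
        | zero => intro c hc; exact ⟨[c], by simp, by simpa using hc, by simp⟩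
        | succ n ih =>
          intro c hc
          obtain ⟨b, hb, hbc⟩ := Part.mem_bind_iff.1 hc
          obtain ⟨l, hlen, ⟨⟨d, hd, hdf⟩, hn⟩, hl⟩ := ih b hb
          refine ⟨l ++ [c], by simp [hlen], ⟨⟨d, ?_, hdf⟩, ?_⟩, fun i hi => ?_⟩
          · rw [List.getElem?_append_left (by omega), hd]
          · rw [List.getElem?_append_right (by omega)]
            simp [hlen]
          · rcases Nat.lt_succ_iff_lt_or_eq.1 hi with hi | rfl
            · obtain ⟨e, he, he2⟩ := hl i hi
              exact ⟨e, by rwa [List.getElem?_append_left (by omega),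
                List.getElem?_append_left (by omega)], he2⟩
            · refine ⟨(b, c), ⟨?_, ?_⟩, hbc⟩
              · rw [List.getElem?_append_left (by omega), hn]
              · rw [List.getElem?_append_right (by omega)]
                simp [hlen]
      obtain ⟨l, _, h1, h2⟩ := key n c hc
      exact ⟨l, h1, h2⟩
  | @rfind f _ ihf =>
    have H : CE z fun p : ℕ × ℕ => 0 ∈ f (Nat.pair p.1 p.2) ∧
        ∀ i < p.2, ∃ b, b ≠ 0 ∧ b ∈ f (Nat.pair p.1 i) := by
      refine CE.and (ihf.comp (f := fun p : ℕ × ℕ => (Nat.pair p.1 p.2, 0)) (by fun_prop))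
        (CE.ball' (P := fun (p : ℕ × ℕ) i => ∃ b, b ≠ 0 ∧ b ∈ f (Nat.pair p.1 i)) ?_ (by fun_prop))
      refine CE.ex (P := fun (q : (ℕ × ℕ) × ℕ) b => b ≠ 0 ∧ b ∈ f (Nat.pair q.1.1 q.2))
        (CE.and (Dec.not (Dec.eq (by fun_prop) (by fun_prop))).1 ?_)
      exact ihf.comp (f := fun q : ((ℕ × ℕ) × ℕ) × ℕ => (Nat.pair q.1.1.1 q.1.2, q.2))
        (by fun_prop)
    refine H.of_eq fun p => ?_
    refine Iff.trans ?_ Nat.mem_rfind.symm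
    simp only [Part.map_eq_map, Part.mem_map_iff]
    constructor
    · rintro ⟨h0, h1⟩
      refine ⟨⟨0, h0, by simp⟩, fun {i} hi => ?_⟩
      obtain ⟨b, hb, hbf⟩ := h1 i hi
      exact ⟨b, hbf, by simpa using hb⟩
    · rintro ⟨⟨b, hb, e⟩, h1⟩
      have hb0 : b = 0 := by simpa using e
      subst hb0
      refine ⟨hb, fun i hi => ?_⟩
      obtain ⟨b, hb, e⟩ := h1 hi
      exact ⟨b, by simpa using e, hb⟩

theorem recursiveIn_ce_graph {g : α →. β} (h : RecursiveIn {(z : ℕ →. ℕ)} g) :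
    CE z fun p : α × β => p.2 ∈ g p.1 := by
  refine ((natRecursiveIn_ce_graph h).comp
    (f := fun p : α × β => (encode p.1, encode p.2)) (by fun_prop)).of_eq fun p => ?_
  simp

/-- A single-valued computably enumerable relation is the graph of a partial recursive function. -/
theorem CE.exists_recursiveIn {P : α → β → Prop} (h : CE z fun p : α × β => P p.1 p.2) :
    ∃ g : α →. β, RecursiveIn {(z : ℕ →. ℕ)} g ∧
      ∀ a b, P a b → (∀ b', P a b' → b' = b) → b ∈ g a := by
  obtain ⟨Q, hQ, h⟩ := h
  obtain ⟨hQd, hQ'⟩ := id hQ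
  let H : List ℕ × ℕ → ℕ → Option β := fun q n =>
    (decode (α := α) n).bind fun a => (decode (α := β) q.2).bind fun b =>
      if Q (q.1, (a, b)) then some b else none
  have hH : Primrec₂ H := by
    refine Primrec.option_bind (Primrec.decode.comp Primrec.snd) ?_
    refine Primrec.option_bind
      (Primrec.decode.comp (Primrec.snd.comp (Primrec.fst.comp Primrec.fst))) ?_
    refine Primrec.ite (hQ.comp ((Primrec.fst.comp (Primrec.fst.comp
      (Primrec.fst.comp Primrec.fst))).pair ((Primrec.snd.comp Primrec.fst).pair Primrec.snd)))
      (Primrec.option_some.comp Primrec.snd) (Primrec.const none)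
  -- `F` is `0` at a failed attempt and one more than the code of the value at a successful one.
  -- This explains the test `1 - F = 0` in the search and the final predecessor.
  let F : ℕ → ℕ := fun p => encode (H (pre z p.unpair.2.unpair.1, p.unpair.2.unpair.2) p.unpair.1)
  have hF : Nat.RecursiveIn {(z : ℕ →. ℕ)} fun p => Part.some (F p) := by
    have h1 : Nat.RecursiveIn {(z : ℕ →. ℕ)} fun p =>
        Part.some (encode (pre z p.unpair.2.unpair.1)) := by
      have h0 : Nat.Primrec fun p : ℕ => p.unpair.2.unpair.1 :=
        Nat.Primrec.left.comp Nat.Primrec.right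
      refine ((recursiveIn_pre z).comp h0.recursiveIn).of_eq fun n => ?_
      simp
    have h3 : Nat.Primrec fun p : ℕ => encode (H (Denumerable.ofNat (List ℕ) p.unpair.1,
        p.unpair.2.unpair.2.unpair.2) p.unpair.2.unpair.1) := by
      rw [← Primrec.nat_iff]
      have a1 := Primrec.snd.comp Primrec.unpair
      refine Primrec.encode.comp (hH.comp (((Primrec.ofNat _).comp
        (Primrec.fst.comp Primrec.unpair)).pair ?_) ?_)
      · exact a1.comp (a1.comp a1)
      · exact (Primrec.fst.comp Primrec.unpair).comp a1
    refine (Nat.RecursiveIn.comp h3.recursiveIn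
      (Nat.RecursiveIn.pair h1 Nat.Primrec.id.recursiveIn)).of_eq fun n => ?_
    simp [Seq.seq, F]
  have hsub : Nat.Primrec fun n : ℕ => 1 - n := by
    rw [← Primrec.nat_iff]
    exact Primrec.nat_sub.comp (Primrec.const 1) Primrec.id
  have hfind : Nat.RecursiveIn {(z : ℕ →. ℕ)} fun n => Nat.rfind fun k =>
      Part.some (decide (1 - F (Nat.pair n k) = 0)) := by
    refine (Nat.RecursiveIn.rfind
      (recursiveIn_comp_total (recursiveIn_of_natPrimrec hsub) hF)).of_eq fun n => ?_
    simp
  let G : ℕ →. ℕ := fun n => (Nat.rfind fun k =>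
    Part.some (decide (1 - F (Nat.pair n k) = 0))).map fun k => (F (Nat.pair n k)).pred
  have hval : Nat.RecursiveIn {(z : ℕ →. ℕ)} G := by
    refine (Nat.RecursiveIn.comp
      (recursiveIn_comp_total (recursiveIn_of_natPrimrec Nat.Primrec.pred) hF)
      (Nat.RecursiveIn.pair (recursiveIn_of_natPrimrec Nat.Primrec.id) hfind)).of_eq fun n => ?_
    ext m
    simp [Seq.seq, G, eq_comm]
  have hG' : ∀ n m, m ∈ G n → ∃ k, ∃ a b, decode (α := α) n = some a ∧ encode b = m ∧
      Q (pre z k, (a, b)) := by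
    intro n m hm
    obtain ⟨i, hi, rfl⟩ := (Part.mem_map_iff _).1 hm
    obtain ⟨hi1, -⟩ := Nat.mem_rfind.1 hi
    have hF1 : F (Nat.pair n i) ≠ 0 := by
      simp at hi1
      omega
    have : H (pre z i.unpair.1, i.unpair.2) n ≠ none := by
      intro hn
      apply hF1
      simp [F, hn]
    obtain ⟨b, hb⟩ := Option.ne_none_iff_exists'.1 this
    have hb' := hb
    simp only [H, Option.bind_eq_some_iff] at hb
    obtain ⟨a, ha, b', _, hb2⟩ := hb
    split_ifs at hb2 with hQab
    cases hb2
    refine ⟨i.unpair.1, a, b, ha, ?_, hQab⟩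
    simp [F, hb']
  have hGdom : ∀ a b, P a b → (G (encode a)).Dom := by
    intro a b hab
    obtain ⟨k, hk⟩ := (h (a, b)).1 hab
    have hdom : (Nat.rfind fun i => Part.some (decide (1 - F (Nat.pair (encode a) i) = 0))).Dom := by
      refine Nat.rfind_dom.2 ⟨Nat.pair k (encode b), ?_, fun _ => trivial⟩
      simp [F, H, hk]
    exact hdom
  refine ⟨fun a => (G (encode a)).bind fun m => Part.ofOption (decode (α := β) m), ?_, ?_⟩
  · have h1 : Nat.RecursiveIn {(z : ℕ →. ℕ)} fun n : ℕ =>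
        (Part.ofOption (decode (α := α) n)).map encode := by
      have : RecursiveIn {(z : ℕ →. ℕ)} fun a : α => Part.some a := RecursiveIn.some
      refine Nat.RecursiveIn.of_eq this fun n => ?_
      ext
      simp [eq_comm]
    refine Nat.RecursiveIn.of_eq (f := fun n => ((Part.ofOption (decode (α := α) n)).map
      encode).bind G) (hval.comp h1) fun n => ?_
    refine Part.ext fun m => ?_
    refine Part.mem_bind_iff.trans ?_
    simp only [Part.mem_bind_iff, Part.mem_map_iff, Part.mem_ofOption,
      Option.mem_def]
    constructor
    · rintro ⟨_, ⟨a, ha, rfl⟩, hm⟩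
      obtain ⟨k, a', b, _, rfl, _⟩ := hG' _ _ hm
      exact ⟨a, ha, b, ⟨_, hm, by simp⟩, rfl⟩
    · rintro ⟨a, ha, b, ⟨m', hm', hb⟩, rfl⟩
      obtain ⟨k, a', b', _, rfl, _⟩ := hG' _ _ hm'
      simp only [encodek, Option.some.injEq] at hb
      subst hb
      exact ⟨_, ⟨a, ha, rfl⟩, hm'⟩
  · intro a b hab hu
    have hd := hGdom a b hab
    obtain ⟨k, a', b', ha, hb, hQ⟩ := hG' _ _ (Part.get_mem hd)
    simp only [encodek, Option.some.injEq] at ha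
    subst ha
    have := hu b' ((h (a, b')).2 ⟨k, hQ⟩)
    subst this
    exact Part.mem_bind (Part.get_mem hd) (by simp [← hb])

/-! ### Transfer between computability on a set and enumerable predicates -/

theorem ComputableOn.of_ce {D : Set α} {f : α → β} {P : α → β → Prop}
    (h : CE z fun p : α × β => P p.1 p.2) (hP : ∀ a ∈ D, ∀ b, P a b ↔ f a = b) :
    ComputableOn z D f := by
  obtain ⟨g, hg, H⟩ := h.exists_recursiveIn
  refine ⟨g, hg, fun a ha => H a (f a) ((hP a ha _).2 rfl) fun b' hb' => ((hP a ha _).1 hb').symm⟩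

theorem ComputableOn.exists_ce {D : Set α} {f : α → β} (h : ComputableOn z D f) :
    ∃ P : α × β → Prop, CE z P ∧ ∀ a ∈ D, ∀ b, P (a, b) ↔ f a = b := by
  obtain ⟨g, hg, H⟩ := h
  exact ⟨_, recursiveIn_ce_graph hg, fun a ha b =>
    ⟨fun hb => Part.mem_unique (H a ha) hb, fun e => e ▸ H a ha⟩⟩

theorem DecidableOn.exists_ce {D : Set α} {P : α → Prop} (h : DecidableOn z D P) :
    ∃ P₁ P₂ : α → Prop, CE z P₁ ∧ CE z P₂ ∧ ∀ a ∈ D, (P₁ a ↔ P a) ∧ (P₂ a ↔ ¬ P a) := by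
  obtain ⟨g, hg, H⟩ := h
  refine ⟨fun a => true ∈ g a, fun a => false ∈ g a,
    (recursiveIn_ce_graph hg).comp (f := fun a => (a, true)) (by fun_prop),
    (recursiveIn_ce_graph hg).comp (f := fun a => (a, false)) (by fun_prop), fun a ha => ?_⟩
  obtain ⟨b, hb, hbP⟩ := H a ha
  have : ∀ c, c ∈ g a ↔ c = b := fun c => ⟨fun hc => Part.mem_unique hc hb, fun e => e ▸ hb⟩
  refine ⟨(this true).trans ?_, (this false).trans ?_⟩ <;> cases b <;> simp_all

theorem DecidableOn.dec {P : α → Prop} (h : DecidableOn z Set.univ P) : Dec z P := by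
  obtain ⟨P₁, P₂, h1, h2, H⟩ := h.exists_ce
  exact ⟨h1.of_eq fun a => (H a trivial).1, h2.of_eq fun a => (H a trivial).2⟩

/-- A decision procedure on `D` may diverge elsewhere; asking about membership in the decidable set
`D` first makes it total. -/
theorem DecidableOn.dec_and {D : Set α} {P : α → Prop} (h : DecidableOn z D P)
    (hD : Dec z fun a => a ∈ D) : Dec z fun a => a ∈ D ∧ P a := by
  obtain ⟨P₁, P₂, h1, h2, H⟩ := h.exists_ce
  refine ⟨(hD.1.and h1).of_eq fun a => ?_, (hD.2.or (hD.1.and h2)).of_eq fun a => ?_⟩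
  · exact and_congr_right fun ha => (H a ha).1
  · have := H a
    tauto

theorem Dec.decidableOn {P : α → Prop} (h : Dec z P) (D : Set α) : DecidableOn z D P := by
  classical
  have h1 : CE z fun p : α × Bool => (P p.1 ∧ p.2 = true) ∨ (¬ P p.1 ∧ p.2 = false) :=
    ((h.1.comp (f := fun p : α × Bool => p.1) (by fun_prop)).and
      (Dec.eq (by fun_prop) (by fun_prop)).1).or
    ((h.2.comp (f := fun p : α × Bool => p.1) (by fun_prop)).and
      (Dec.eq (by fun_prop) (by fun_prop)).1)
  obtain ⟨g, hg, H⟩ := ComputableOn.of_ce (D := D) (f := fun a => decide (P a))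
    (P := fun a b => (P a ∧ b = true) ∨ (¬ P a ∧ b = false)) h1 (fun a _ b => by
      by_cases ha : P a <;> cases b <;> simp [ha])
  exact ⟨g, hg, fun a ha => ⟨_, H a ha, by simp⟩⟩

theorem Cmp.computableOn {f : α → β} (h : Cmp z f) (D : Set α) : ComputableOn z D f :=
  ComputableOn.of_ce (P := fun a b => f a = b) h fun _ _ _ => Iff.rfl

/-! ### Turing reducibility and change of oracle -/

theorem TuringLE.of_cmp {y : Baire} (h : Cmp z y) : TuringLE y z := by
  obtain ⟨g, hg, H⟩ := h.computableOn Set.univ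
  exact RecursiveIn.of_eq_tot hg fun n => H n trivial

theorem TuringLE.cmp {y : Baire} (h : TuringLE y z) : Cmp z y :=
  CE.of_eq (recursiveIn_ce_graph (g := (y : ℕ →. ℕ)) h) fun p => by simp [eq_comm]

theorem TuringLE.recursiveIn {y : Baire} (h : TuringLE y z) {g : α →. β}
    (hg : RecursiveIn {(y : ℕ →. ℕ)} g) : RecursiveIn {(z : ℕ →. ℕ)} g :=
  hg.subst fun f hf => by
    rw [Set.mem_singleton_iff.1 hf]
    exact h

theorem ComputableOn.mono {y : Baire} (h : TuringLE y z) {D : Set α} {f : α → β}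
    (hf : ComputableOn y D f) : ComputableOn z D f := by
  obtain ⟨g, hg, H⟩ := hf
  exact ⟨g, h.recursiveIn hg, H⟩

theorem DecidableOn.mono {y : Baire} (h : TuringLE y z) {D : Set α} {P : α → Prop}
    (hf : DecidableOn y D P) : DecidableOn z D P := by
  obtain ⟨g, hg, H⟩ := hf
  exact ⟨g, h.recursiveIn hg, H⟩

theorem TuringLE.cmp_pre {y : Baire} (hy : TuringLE y z) : Cmp z (Wadge.pre y) := by
  have h : CE z fun p : ℕ × List ℕ => p.2.length = p.1 ∧ ∀ i < p.1, p.2[i]? = some (y i) := by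
    refine CE.and (Dec.eq (by fun_prop) (by fun_prop)).1
      (CE.ball' (P := fun (p : ℕ × List ℕ) i => p.2[i]? = some (y i)) ?_ (by fun_prop))
    have := Cmp.comp (g := fun p : (ℕ × List ℕ) × ℕ => p.2) hy.cmp (by fun_prop)
    exact (Dec.eq (by fun_prop) this.optionSome).1
  exact h.of_eq fun p => by
    constructor
    · rintro ⟨h1, h2⟩
      refine List.ext_getElem? fun i => ?_
      by_cases hi : i < p.1
      · rw [h2 i hi, getElem?_pre y i _ hi]
      · rw [List.getElem?_eq_none (by simpa using hi), List.getElem?_eq_none (by omega)]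
    · intro h
      rw [← h]
      exact ⟨by simp, fun i hi => getElem?_pre y i _ hi⟩

theorem TuringLE.refl (z : Baire) : TuringLE z z := TuringLE.of_cmp Cmp.oracle

theorem CE.mono {y : Baire} (h : TuringLE y z) {P : α → Prop} (hP : CE y P) : CE z P := by
  obtain ⟨Q, hQ, H⟩ := hP
  have hy := h.cmp_pre
  have h1 : CE z fun a => ∃ k, Q (Wadge.pre y k, a) :=
    CE.ex (P := fun a k => Q (Wadge.pre y k, a))
      ((PrimrecPred.ce hQ).comp (f := fun p : α × ℕ => (Wadge.pre y p.2, p.1)) (by fun_prop))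
  exact h1.of_eq fun a => (H a).symm

theorem Dec.mono {y : Baire} (h : TuringLE y z) {P : α → Prop} (hP : Dec y P) : Dec z P :=
  ⟨hP.1.mono h, hP.2.mono h⟩

end

/-! ### Strings, prefixes and jumps -/

theorem take_inf (z : Baire) (k : ℕ) : (Str.inf z).take k = pre z k := rfl

theorem isPrefix_fin {l l' : List ℕ} : (Str.fin l).IsPrefix (.fin l') ↔ l <+: l' := by
  rw [List.prefix_iff_eq_take, eq_comm]
  rfl

theorem isPrefix_inf {l : List ℕ} {x : Baire} :
    (Str.fin l).IsPrefix (.inf x) ↔ l = pre x l.length := by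
  rw [eq_comm]
  rfl

theorem isPrefix_pre (x : Baire) (k : ℕ) : (Str.fin (pre x k)).IsPrefix (.inf x) := by
  simp [isPrefix_inf]

theorem isPrefix_trans {l l' : List ℕ} {υ : Str} (h : (Str.fin l).IsPrefix (.fin l'))
    (h' : (Str.fin l').IsPrefix υ) : (Str.fin l).IsPrefix υ := by
  rw [isPrefix_fin] at h
  cases υ with
  | fin m =>
    rw [isPrefix_fin] at h' ⊢
    exact h.trans h'
  | inf x =>
    rw [isPrefix_inf] at h' ⊢
    rw [h'] at h
    exact eq_pre_of_prefix h

theorem isPrefix_conv {l l' : List ℕ} {υ : Str} (h : (Str.fin l).IsPrefix υ)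
    (h' : (Str.fin l').IsPrefix υ) (hl : l.length ≤ l'.length) :
    (Str.fin l).IsPrefix (.fin l') := by
  rw [isPrefix_fin]
  cases υ with
  | fin m =>
    rw [isPrefix_fin] at h h'
    exact List.prefix_of_prefix_length_le h h' hl
  | inf x =>
    rw [isPrefix_inf] at h h'
    rw [h, h']
    exact pre_prefix x hl

theorem length_le_len {u : List ℕ} {υ : Str} (h : (Str.fin u).IsPrefix υ) :
    (u.length : ℕ∞) ≤ υ.len := by
  cases υ with
  | fin m => exact Nat.cast_le.2 (isPrefix_fin.1 h).length_le
  | inf x => exact le_top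

theorem take_of_isPrefix {u : List ℕ} {υ : Str} (h : (Str.fin u).IsPrefix υ) {j : ℕ}
    (hj : j ≤ u.length) : υ.take j = u.take j := by
  cases υ with
  | fin m =>
    obtain ⟨t, rfl⟩ := isPrefix_fin.1 h
    exact List.take_append_of_le_length hj
  | inf x =>
    rw [isPrefix_inf] at h
    rw [h, take_pre, min_eq_left hj]
    rfl

theorem haltsAt_isPrefix (z : Baire) {u : List ℕ} {υ : Str} (h : (Str.fin u).IsPrefix υ) {s : ℕ}
    (hs : s < u.length) : HaltsAt z (.fin u) s ↔ HaltsAt z υ s := by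
  have h1 : ((s : ℕ) : ℕ∞) < (Str.fin u).len := Nat.cast_lt.2 hs
  have h2 : (s : ℕ∞) < υ.len := h1.trans_le (length_le_len h)
  have hj : s.unpair.2.unpair.1 ≤ u.length :=
    ((Nat.unpair_left_le _).trans (Nat.unpair_right_le s)).trans hs.le
  unfold HaltsAt
  rw [take_of_isPrefix h hj]
  simp only [h1, h2, true_and]
  rfl

theorem lt_of_haltsAt_fin {z : Baire} {u : List ℕ} {s : ℕ} (h : HaltsAt z (.fin u) s) :
    s < u.length := Nat.cast_lt.1 h.1

/-- At stage `s` a new element is enumerated into the jump. -/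
def NewAt (z : Baire) (υ : Str) (s : ℕ) : Prop :=
  HaltsAt z υ s ∧ ∀ r < s, HaltsAt z υ r → r.unpair.1 ≠ s.unpair.1

theorem newAt_isPrefix (z : Baire) {u : List ℕ} {υ : Str} (h : (Str.fin u).IsPrefix υ) {s : ℕ}
    (hs : s < u.length) : NewAt z (.fin u) s ↔ NewAt z υ s := by
  refine and_congr (haltsAt_isPrefix z h hs) (forall_congr' fun r => forall_congr' fun hr => ?_)
  rw [haltsAt_isPrefix z h (hr.trans hs)]

theorem mem_jump_iff {z : Baire} {υ : Str} {e : ℕ} :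
    e ∈ jump z υ ↔ ∃ s, NewAt z υ s ∧ s.unpair.1 = e := by
  classical
  constructor
  · intro h
    have h' : ∃ s, HaltsAt z υ s ∧ s.unpair.1 = e := h
    refine ⟨Nat.find h', ⟨(Nat.find_spec h').1, fun r hr h1 h2 => ?_⟩, (Nat.find_spec h').2⟩
    exact Nat.find_min h' hr ⟨h1, h2.trans (Nat.find_spec h').2⟩
  · rintro ⟨s, h, rfl⟩
    exact ⟨s, h.1, rfl⟩

theorem NewAt.injective {z : Baire} {υ : Str} {r s : ℕ} (hr : NewAt z υ r) (hs : NewAt z υ s)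
    (h : r.unpair.1 = s.unpair.1) : r = s := by
  rcases lt_trichotomy r s with h1 | h1 | h1
  · exact absurd h (hs.2 r h1 hr.1)
  · exact h1
  · exact absurd h.symm (hr.2 s h1 hs.1)

theorem jump_mono (z : Baire) {u : List ℕ} {υ : Str} (h : (Str.fin u).IsPrefix υ) :
    jump z (.fin u) ⊆ jump z υ := by
  rintro e ⟨s, hs, he⟩
  exact ⟨s, (haltsAt_isPrefix z h (lt_of_haltsAt_fin hs)).1 hs, he⟩

theorem lastBefore_succ (z : Baire) (υ : Str) (s : ℕ) [Decidable (NewAt z υ s)] :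
    lastBefore z υ (s + 1) =
      if NewAt z υ s then (((s.unpair.1 : ℕ) : ℕ∞) : WithBot ℕ∞) else lastBefore z υ s := by
  rw [lastBefore]
  congr

theorem lastBefore_isPrefix (z : Baire) {u : List ℕ} {υ : Str} (h : (Str.fin u).IsPrefix υ) :
    ∀ {s : ℕ}, s ≤ u.length → lastBefore z (.fin u) s = lastBefore z υ s := by
  classical
  intro s
  induction s with
  | zero => intro _; rfl
  | succ s ih =>
    intro hs
    rw [lastBefore_succ, lastBefore_succ, ih (by omega)]
    simp only [newAt_isPrefix z h hs]

theorem lastBefore_cases (z : Baire) (υ : Str) (s : ℕ) : ∀ t, s ≤ t →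
    lastBefore z υ t = lastBefore z υ s ∨ ∃ r, s ≤ r ∧ r < t ∧ NewAt z υ r ∧
      lastBefore z υ t = (((r.unpair.1 : ℕ) : ℕ∞) : WithBot ℕ∞) := by
  classical
  intro t ht
  induction t, ht using Nat.le_induction with
  | base => exact Or.inl rfl
  | succ t ht ih =>
    rw [lastBefore_succ]
    split_ifs with h
    · exact Or.inr ⟨t, ht, t.lt_succ_self, h, rfl⟩
    · rcases ih with h | ⟨r, h1, h2, h3⟩
      · exact Or.inl h
      · exact Or.inr ⟨r, h1, h2.trans t.lt_succ_self, h3⟩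

/-- The jumps of `U` and `V` agree up to the last element enumerated into the jump of `U`. -/
def Agree (z : Baire) (U V : Str) : Prop :=
  ¬ ∃ e : ℕ, ((e : ℕ∞) : WithBot ℕ∞) < lastEnum z U ∧ e ∈ jump z V ∧ e ∉ jump z U

theorem jumpAgree_iff {z : Baire} {n : ℕ} {R : Str → Str → Prop} {σ τ : Str} :
    JumpAgree z n R σ τ ↔ Agree z (derivedString n R σ) (derivedString n R τ) := Iff.rfl

theorem agree_nil (z : Baire) (V : Str) : Agree z (.fin []) V := by
  rintro ⟨e, he, _⟩
  exact not_lt_bot he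

theorem Agree.conv {z : Baire} {U W : Str} {v : List ℕ} (h : Agree z U W)
    (hv : (Str.fin v).IsPrefix W) : Agree z U (.fin v) := by
  rintro ⟨e, he, h1, h2⟩
  exact h ⟨e, he, jump_mono z hv h1, h2⟩

/-- Suppose `e` is below the last element of `u` and is missing from the jumps of both `u` and `v`.
Either the last element of `v` is that of `u`, or it was enumerated after `u`, and then agreement of
`u` with `v` makes it at least the last element of `u`. In both cases `e` lies below the last
element of `v`, so agreement of `v` with `W` keeps it out. -/
theorem Agree.trans {z : Baire} {u v : List ℕ} {W : Str} (huv : (Str.fin u).IsPrefix (.fin v))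
    (h1 : Agree z (.fin u) (.fin v)) (h2 : Agree z (.fin v) W) : Agree z (.fin u) W := by
  rintro ⟨e, he, heW, heu⟩
  by_cases hev : e ∈ jump z (.fin v)
  · exact h1 ⟨e, he, hev, heu⟩
  · refine h2 ⟨e, lt_of_lt_of_le he ?_, heW, hev⟩
    rcases lastBefore_cases z (.fin v) u.length v.length (isPrefix_fin.1 huv).length_le with
      h | ⟨r, hur, _, hr, h⟩
    · rw [lastEnum, lastEnum, h, lastBefore_isPrefix z huv le_rfl]
    · rw [lastEnum.eq_1 z v, h]
      by_contra hlt
      refine h1 ⟨r.unpair.1, not_le.1 hlt, ⟨r, hr.1, rfl⟩, ?_⟩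
      rintro ⟨r', h1, h2⟩
      have hl := lt_of_haltsAt_fin h1
      exact hr.2 r' (hl.trans_le hur) ((haltsAt_isPrefix z huv hl).1 h1) h2

/-! ### Enumeration into the jump of an infinite string -/

theorem jump_inf_infinite (z D : Baire) : (jump z (.inf D)).Infinite := by
  have hinj : Function.Injective fun m : ℕ => Nat.pair (encode Nat.Partrec.Code.zero) m :=
    fun a b h => (Nat.pair_eq_pair.1 h).2
  refine (Set.infinite_range_of_injective hinj).mono ?_
  rintro _ ⟨m, rfl⟩
  let c := encode (([] : List ℕ), ([] : List ℕ), m)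
  refine ⟨Nat.pair (Nat.pair (encode Nat.Partrec.Code.zero) m) (Nat.pair 0 (c + 1)), ⟨?_, ?_⟩, ?_⟩
  · exact ENat.natCast_lt_top _
  · simp only [Nat.unpair_pair, Denumerable.ofNat_encode]
    have : Nat.Partrec.Code.evaln (c + 1) Nat.Partrec.Code.zero c = some 0 := by
      simp [Nat.Partrec.Code.evaln]
    exact Option.isSome_iff_exists.2 ⟨0, this⟩
  · simp

theorem exists_newAt_gt (z D : Baire) (s q : ℕ) :
    ∃ r, s ≤ r ∧ NewAt z (.inf D) r ∧ q < r.unpair.1 := by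
  obtain ⟨e, he, hes⟩ := (jump_inf_infinite z D).exists_notMem_finset
    (Finset.range (q + 1) ∪ (Finset.range s).image fun r => r.unpair.1)
  obtain ⟨r, hr, rfl⟩ := mem_jump_iff.1 he
  simp only [Finset.mem_union, Finset.mem_range, Finset.mem_image, not_or, not_exists,
    not_and] at hes
  exact ⟨r, not_lt.1 fun h => hes.2 r h rfl, hr, by omega⟩

/-- Dekker's true stages: from stage `s` on infinitely many elements appear, and the stage at which
the least of them appears is never undercut later. -/
theorem exists_newAt_min (z D : Baire) (s : ℕ) :
    ∃ r, s ≤ r ∧ NewAt z (.inf D) r ∧ ∀ t, r < t → NewAt z (.inf D) t →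
      ¬ t.unpair.1 < r.unpair.1 := by
  classical
  have h : ∃ e r, s ≤ r ∧ NewAt z (.inf D) r ∧ r.unpair.1 = e := by
    obtain ⟨r, h1, h2, _⟩ := exists_newAt_gt z D s 0
    exact ⟨_, r, h1, h2, rfl⟩
  obtain ⟨r, h1, h2, h3⟩ := Nat.find_spec h
  refine ⟨r, h1, h2, fun t ht hn hlt => ?_⟩
  rw [h3] at hlt
  exact Nat.find_min h hlt ⟨t, h1.trans ht.le, hn, rfl⟩

theorem lastEnum_pre (z D : Baire) (t : ℕ) :
    lastEnum z (.fin (pre D t)) = lastBefore z (.inf D) t := by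
  rw [lastEnum, length_pre]
  exact lastBefore_isPrefix z (isPrefix_pre D t) (by simp)

/-- No element is new twice, so only finitely many stages enumerate something at most `q`. Once
these have passed and a larger element has appeared, the last element remains above `q`. -/
theorem exists_lt_lastEnum_pre (z D : Baire) (q : ℕ) :
    ∃ s, ∀ t, s ≤ t → ((q : ℕ∞) : WithBot ℕ∞) < lastEnum z (.fin (pre D t)) := by
  classical
  have hfin : {s | NewAt z (.inf D) s ∧ s.unpair.1 ≤ q}.Finite := by
    refine Set.Finite.of_finite_image (f := fun s : ℕ => s.unpair.1)
      ((Set.finite_Iic q).subset ?_) ?_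
    · rintro _ ⟨s, hs, rfl⟩
      exact hs.2
    · intro a ha b hb h
      exact ha.1.injective hb.1 h
  obtain ⟨S, hS⟩ := hfin.bddAbove
  obtain ⟨r, hr, hn, hq⟩ := exists_newAt_gt z D (S + 1) q
  refine ⟨r + 1, fun t ht => ?_⟩
  rw [lastEnum_pre]
  have hcast : ∀ k : ℕ, q < k → ((q : ℕ∞) : WithBot ℕ∞) < ((k : ℕ∞) : WithBot ℕ∞) := fun k hk => by
    exact_mod_cast hk
  rcases lastBefore_cases z (.inf D) (r + 1) t ht with h | ⟨r', h1, _, h2, h⟩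
  · rw [h, lastBefore_succ, if_pos hn]
    exact hcast _ hq
  · rw [h]
    refine hcast _ (not_le.1 fun hle => ?_)
    have : r' ≤ S := hS ⟨h2, hle⟩
    omega

/-! ### Tree-like relations and derived strings -/

/-- The properties of the true stage relations that are preserved at successors and limits. -/
structure TreeLike (R : Str → Str → Prop) : Prop where
  isPrefix : ∀ {σ τ}, R σ τ → σ.IsPrefix τ
  trans : ∀ {σ τ : List ℕ} {υ : Str}, R (.fin σ) (.fin τ) → R (.fin τ) υ → R (.fin σ) υ
  conv : ∀ {σ τ : List ℕ} {υ : Str}, R (.fin σ) υ → R (.fin τ) υ → σ.length ≤ τ.length →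
    R (.fin σ) (.fin τ)
  infinite : ∀ x : Baire, {k | R (.fin (pre x k)) (.inf x)}.Infinite

open Classical in
theorem filter_range_eq_map_nth (P : ℕ → Prop) (k : ℕ) :
    (List.range k).filter (fun i => P i) = (List.range (Nat.count P k)).map (Nat.nth P) := by
  induction k with
  | zero => simp
  | succ k ih =>
    rw [List.range_succ, List.filter_append, ih, Nat.count_succ]
    by_cases h : P k
    · simp [h, List.range_succ, Nat.nth_count h]
    · simp [h]

open Classical in
theorem derivedString_fin (n : ℕ) (R : Str → Str → Prop) (l : List ℕ) :
    derivedString n R (.fin l) = .fin ((((List.range l.length).filter fun i =>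
      R (.fin (l.take i)) (.fin l)).drop n).map fun i => encode (l.take i)) := by
  have hset : {i : ℕ | (i : ℕ∞) < (Str.fin l).len ∧ R (.fin ((Str.fin l).take i)) (.fin l)} =
      {i | i < l.length ∧ R (.fin (l.take i)) (.fin l)} := by
    ext i
    exact and_congr Nat.cast_lt Iff.rfl
  have hf : {i : ℕ | i < l.length ∧ R (.fin (l.take i)) (.fin l)}.Finite :=
    (Set.finite_lt_nat l.length).subset fun i hi => hi.1
  unfold derivedString
  rw [hset, Str.enumerate, dif_pos hf]
  congr 3
  refine List.Perm.eq_of_pairwise (le := (· ≤ ·)) (fun a b _ _ h h' => le_antisymm h h')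
    (Finset.pairwise_sort _ _)
    ((List.pairwise_lt_range.imp le_of_lt).filter _) ?_
  rw [List.perm_ext_iff_of_nodup (Finset.sort_nodup _ _) (List.nodup_range.filter _)]
  intro a
  simp

section Derived

variable {R : Str → Str → Prop} (n : ℕ) (x : Baire)

/-- The indices of the initial segments of `x` that are `R`-below `x`. -/
def Path (R : Str → Str → Prop) (x : Baire) (k : ℕ) : Prop := R (.fin (pre x k)) (.inf x)

/-- The derived string of an infinite string with an infinite path. -/
noncomputable def derived (n : ℕ) (R : Str → Str → Prop) (x : Baire) : Baire :=
  fun j => encode (pre x (Nat.nth (Path R x) (n + j)))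

theorem derivedString_inf (hR : TreeLike R) :
    derivedString n R (.inf x) = .inf (derived n R x) := by
  have hset : {i : ℕ | (i : ℕ∞) < (Str.inf x).len ∧ R (.fin ((Str.inf x).take i)) (.inf x)} =
      {i | Path R x i} := by
    ext i
    simp [Str.len, Path, take_inf]
  unfold derivedString
  rw [hset, Str.enumerate, dif_neg (show ¬ {i | Path R x i}.Finite from hR.infinite x)]
  rfl

-- By transitivity and convexity, the predecessors of a true stage of `x` are the true stages of `x`
-- of smaller length. Hence the derived string of the stage is an initial segment of that of `x`,
-- shortened by the `n` omitted entries.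
open Classical in
theorem derivedString_pre (hR : TreeLike R) {k : ℕ} (hk : Path R x k) :
    derivedString n R (.fin (pre x k)) =
      .fin (pre (derived n R x) (Nat.count (Path R x) k - n)) := by
  rw [derivedString_fin, length_pre]
  congr 1
  have h1 : (List.range k).filter (fun i => R (.fin ((pre x k).take i)) (.fin (pre x k))) =
      (List.range k).filter fun i => Path R x i := by
    refine List.filter_congr fun i hi => ?_
    have hi := List.mem_range.1 hi
    rw [take_pre, min_eq_left hi.le, decide_eq_decide]
    exact ⟨fun h => hR.trans h hk, fun h => hR.conv h hk (by simpa using hi.le)⟩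
  rw [h1, filter_range_eq_map_nth, ← List.map_drop, List.range_eq_range', List.drop_range',
    List.map_map]
  refine List.ext_getElem (by simp) fun i hi hi' => ?_
  have hlt : Nat.nth (Path R x) (n + i) < k := by
    refine Nat.nth_lt_of_lt_count ?_
    simp at hi
    omega
  simp [derived, pre]
  rw [← List.map_take, List.take_range, min_eq_left hlt.le]

theorem derivedString_isPrefix (hR : TreeLike R) {l : List ℕ} {υ : Str} (h : R (.fin l) υ) :
    ∃ u, derivedString n R (.fin l) = .fin u ∧
      (Str.fin u).IsPrefix (derivedString n R υ) := by
  classical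
  refine ⟨_, derivedString_fin n R l, ?_⟩
  cases υ with
  | inf x =>
    have hl := isPrefix_inf.1 (hR.isPrefix h)
    have hk : Path R x l.length := by
      unfold Path
      rwa [← hl]
    have := derivedString_pre n x hR hk
    rw [← hl, derivedString_fin] at this
    rw [this, derivedString_inf n x hR]
    exact isPrefix_pre _ _
  | fin m =>
    obtain ⟨t, rfl⟩ := isPrefix_fin.1 (hR.isPrefix h)
    rw [derivedString_fin, isPrefix_fin]
    have h1 : (List.range l.length).filter (fun i => R (.fin (l.take i)) (.fin l)) =
        (List.range l.length).filter fun i => R (.fin ((l ++ t).take i)) (.fin (l ++ t)) := by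
      refine List.filter_congr fun i hi => ?_
      have hi := List.mem_range.1 hi
      rw [List.take_append_of_le_length hi.le, decide_eq_decide]
      exact ⟨fun h' => hR.trans h' h, fun h' => hR.conv h' h (by simp)⟩
    have h2 : (((List.range l.length).filter fun i => R (.fin (l.take i)) (.fin l)).drop n).map
        (fun i => encode (l.take i)) =
        (((List.range l.length).filter fun i => R (.fin (l.take i)) (.fin l)).drop n).map
        (fun i => encode ((l ++ t).take i)) := by
      refine List.map_congr_left fun i hi => ?_
      have hi := List.mem_range.1 (List.mem_of_mem_filter (List.mem_of_mem_drop hi))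
      rw [List.take_append_of_le_length hi.le]
    rw [h2, h1]
    have h3 : List.range l.length <+: List.range (l ++ t).length := by
      rw [List.length_append, List.range_add]
      exact List.prefix_append _ _
    exact ((h3.filter _).drop n).map _

/-- The successor step in producing true stages: a Dekker true stage for the enumeration of the jump
of the derived string of `x` is turned back into an initial segment of `x`. -/
theorem infinite_agree (z : Baire) (hR : TreeLike R) :
    {k | Path R x k ∧ JumpAgree z n R (.fin (pre x k)) (.inf x)}.Infinite := by
  classical
  refine Set.infinite_of_forall_exists_gt fun K => ?_
  obtain ⟨s, hs, hn, hmin⟩ := exists_newAt_min z (derived n R x) K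
  have hinf : {k | Path R x k}.Infinite := hR.infinite x
  -- With `n` entries omitted, the derived string of this stage has length `s + 1`, so `s` is the
  -- last stage it sees and the element of stage `s` is its last element.
  have hP : Path R x (Nat.nth (Path R x) (n + (s + 1))) := Nat.nth_mem_of_infinite hinf _
  refine ⟨Nat.nth (Path R x) (n + (s + 1)), ⟨hP, ?_⟩, ?_⟩
  · rw [jumpAgree_iff, derivedString_pre n x hR hP, derivedString_inf n x hR,
      Nat.count_nth_of_infinite hinf, Nat.add_sub_cancel_left]
    rintro ⟨e, he, h1, h2⟩
    rw [lastEnum_pre, lastBefore_succ, if_pos hn] at he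
    obtain ⟨r, hr, rfl⟩ := mem_jump_iff.1 h1
    have hlt : r.unpair.1 < s.unpair.1 := by exact_mod_cast he
    have hrs : ¬ r < s + 1 := fun h => h2 ⟨r, (haltsAt_isPrefix z (isPrefix_pre _ _)
      (by simpa using h)).2 hr.1, rfl⟩
    exact hmin r (by omega) hr hlt
  · have : n + (s + 1) ≤ Nat.nth (Path R x) (n + (s + 1)) :=
      (Nat.nth_strictMono hinf).le_apply
    omega

theorem exists_lt_lastEnum (z : Baire) (hR : TreeLike R) (q : ℕ) :
    ∃ N, ∀ k, N ≤ k → Path R x k →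
      ((q : ℕ∞) : WithBot ℕ∞) < lastEnum z (derivedString n R (.fin (pre x k))) := by
  classical
  obtain ⟨s, hs⟩ := exists_lt_lastEnum_pre z (derived n R x) q
  have hinf : {k | Path R x k}.Infinite := hR.infinite x
  refine ⟨Nat.nth (Path R x) (n + s), fun k hk hP => ?_⟩
  rw [derivedString_pre n x hR hP]
  apply hs
  have := Nat.count_monotone (Path R x) hk
  rw [Nat.count_nth_of_infinite hinf] at this
  omega

/-- The jump of the derived string of `x` is the union of the jumps along the path. -/
theorem mem_jump_derivedString (z : Baire) (hR : TreeLike R) (e : ℕ) :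
    e ∈ jump z (derivedString n R (.inf x)) ↔
      ∃ k, Path R x k ∧ e ∈ jump z (derivedString n R (.fin (pre x k))) := by
  classical
  constructor
  · intro h
    rw [derivedString_inf n x hR] at h
    obtain ⟨s, hs, he⟩ := h
    have hinf : {k | Path R x k}.Infinite := hR.infinite x
    have hP : Path R x (Nat.nth (Path R x) (n + (s + 1))) := Nat.nth_mem_of_infinite hinf _
    refine ⟨_, hP, ?_⟩
    rw [derivedString_pre n x hR hP, Nat.count_nth_of_infinite hinf, Nat.add_sub_cancel_left]
    exact ⟨s, (haltsAt_isPrefix z (isPrefix_pre _ _) (by simp)).2 hs, he⟩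
  · rintro ⟨k, hk, h⟩
    obtain ⟨u, hu, hp⟩ := derivedString_isPrefix n hR hk
    rw [hu] at h
    exact jump_mono z hp h

end Derived

/-! ### The true stage relations are tree-like -/

/-- The elements of `δ` below `o`, where `none` stands for the top. -/
def Below (δ : NOrdinal) : Option ℕ → ℕ → Prop
  | none, m => m ∈ δ.field
  | some n, m => δ.lt m n

theorem Below.mem {δ : NOrdinal} {o : Option ℕ} {m : ℕ} (h : Below δ o m) : m ∈ δ.field := by
  cases o with
  | none => exact h
  | some n => exact (δ.mem_of_lt h).1

theorem Below.of_lt {δ : NOrdinal} {o : Option ℕ} {m k : ℕ} (h : Below δ o m) (hk : δ.lt k m) :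
    Below δ o k := by
  cases o with
  | none => exact (δ.mem_of_lt hk).1
  | some n => exact δ.trans hk h

/-- The true stage relation at the initial segment of `δ` below `o`. -/
noncomputable def rel (z : Baire) (δ : NOrdinal) : Option ℕ → Str → Str → Prop
  | none => TrueStage z δ
  | some n => trueStageBelow z δ n

theorem rel_iff {z : Baire} {δ : NOrdinal} {o : Option ℕ} {σ τ : Str} :
    rel z δ o σ τ ↔ σ.IsPrefix τ ∧ ∀ m, Below δ o m → JumpAgree z m (rel z δ (some m)) σ τ := by
  cases o with
  | none => exact Iff.rfl
  | some n => exact trueStageBelow_iff z δ n σ τ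

/-- Properties of relations below a level pass to the level. -/
theorem NOrdinal.induction_below {δ : NOrdinal} {P : Option ℕ → Prop}
    (h : ∀ o, (∀ m, Below δ o m → P (some m)) → P o) (o : Option ℕ) : P o := by
  have hs : ∀ n, P (some n) := fun n => by
    induction n using δ.wf.induction with
    | _ n ih => exact h (some n) ih
  exact h o fun m _ => hs m

/-- Only the levels named by small numbers constrain short strings. The highest of these finitely
many levels is what `treeLike_rel` needs to control. -/
theorem NOrdinal.exists_max_lt (δ : NOrdinal) (o : Option ℕ) : ∀ M,
    (∀ m < M, ¬ Below δ o m) ∨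
      ∃ k < M, Below δ o k ∧ ∀ m < M, Below δ o m → m = k ∨ δ.lt m k := by
  intro M
  induction M with
  | zero => exact Or.inl fun m hm => absurd hm (Nat.not_lt_zero m)
  | succ M ih =>
    by_cases hM : Below δ o M
    · right
      rcases ih with h | ⟨k, hkM, hk, h⟩
      · refine ⟨M, M.lt_succ_self, hM, fun m hm hb => ?_⟩
        rcases Nat.lt_succ_iff_lt_or_eq.1 hm with h' | h'
        · exact absurd hb (h m h')
        · exact Or.inl h'
      · rcases δ.trichotomous hk.mem hM.mem with hlt | rfl | hlt
        · refine ⟨M, M.lt_succ_self, hM, fun m hm hb => ?_⟩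
          rcases Nat.lt_succ_iff_lt_or_eq.1 hm with h' | h'
          · rcases h m h' hb with rfl | h''
            · exact Or.inr hlt
            · exact Or.inr (δ.trans h'' hlt)
          · exact Or.inl h'
        · exact absurd hkM (lt_irrefl _)
        · refine ⟨k, hkM.trans M.lt_succ_self, hk, fun m hm hb => ?_⟩
          rcases Nat.lt_succ_iff_lt_or_eq.1 hm with h' | rfl
          · exact h m h' hb
          · exact Or.inr hlt
    · rcases ih with h | ⟨k, hkM, hk, h⟩
      · left
        intro m hm
        rcases Nat.lt_succ_iff_lt_or_eq.1 hm with h' | rfl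
        · exact h m h'
        · exact hM
      · refine Or.inr ⟨k, hkM.trans M.lt_succ_self, hk, fun m hm hb => ?_⟩
        rcases Nat.lt_succ_iff_lt_or_eq.1 hm with h' | rfl
        · exact h m h' hb
        · exact absurd hb hM

theorem JumpAgree.trans {z : Baire} {n : ℕ} {R : Str → Str → Prop} (hR : TreeLike R)
    {σ τ : List ℕ} {υ : Str} (h : R (.fin σ) (.fin τ)) (h' : R (.fin τ) υ)
    (h1 : JumpAgree z n R (.fin σ) (.fin τ)) (h2 : JumpAgree z n R (.fin τ) υ) :
    JumpAgree z n R (.fin σ) υ := by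
  obtain ⟨u, hu, hp⟩ := derivedString_isPrefix n hR h
  obtain ⟨v, hv, hp'⟩ := derivedString_isPrefix n hR h'
  rw [jumpAgree_iff] at *
  rw [hv] at hp
  rw [hu, hv] at h1
  rw [hv] at h2
  rw [hu]
  exact Agree.trans hp h1 h2

theorem JumpAgree.conv {z : Baire} {n : ℕ} {R : Str → Str → Prop} (hR : TreeLike R)
    {σ : Str} {τ : List ℕ} {υ : Str} (h' : R (.fin τ) υ) (h1 : JumpAgree z n R σ υ) :
    JumpAgree z n R σ (.fin τ) := by
  obtain ⟨v, hv, hp'⟩ := derivedString_isPrefix n hR h'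
  rw [jumpAgree_iff] at *
  rw [hv]
  exact h1.conv hp'

/-- With at most `n` predecessors, omitting the first `n` leaves the empty derived string, whose
last element is `-1`, and the condition is vacuous. -/
theorem jumpAgree_of_filter_length_le (z : Baire) {n : ℕ} {R : Str → Str → Prop} {l : List ℕ}
    {υ : Str} {P : ℕ → Prop} [DecidablePred P] (hP : ∀ i < l.length,
      R (.fin (l.take i)) (.fin l) → P i)
    (hn : Nat.count P l.length ≤ n) : JumpAgree z n R (.fin l) υ := by
  classical
  rw [jumpAgree_iff, derivedString_fin, List.drop_eq_nil_of_le]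
  · exact agree_nil z _
  · refine le_trans ?_ hn
    rw [Nat.count_eq_card_filter_range, ← List.toFinset_card_of_nodup (List.nodup_range.filter _)]
    refine Finset.card_le_card fun i hi => ?_
    simp only [List.toFinset_filter, decide_eq_true_eq, Finset.mem_filter, List.mem_toFinset,
      List.mem_range] at hi
    exact Finset.mem_filter.2 ⟨Finset.mem_range.2 hi.1, hP i hi.1 hi.2⟩

theorem jumpAgree_of_length_le (z : Baire) {n : ℕ} {R : Str → Str → Prop} {l : List ℕ}
    {υ : Str} (hn : l.length ≤ n) : JumpAgree z n R (.fin l) υ := by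
  classical
  exact jumpAgree_of_filter_length_le z (P := fun _ => True) (fun _ _ _ => trivial)
    ((Nat.count_le (p := fun _ => True)).trans hn)

/-- Transitivity and convexity pass through each level by the corresponding facts about jumps. The
existence of infinitely many true stages is the delicate point at limits, where an intersection of
infinite sets has to remain infinite. The omitted entries save it: for each `K` only the finitely
many levels named by numbers up to `K` matter, and these are handled at once by the highest of them.
-/
theorem treeLike_rel (z : Baire) (δ : NOrdinal) (o : Option ℕ) : TreeLike (rel z δ o) := by
  induction o using NOrdinal.induction_below (δ := δ) with
  | _ o ih =>
  refine ⟨fun h => (rel_iff.1 h).1, ?_, ?_, ?_⟩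
  · intro σ τ υ h h'
    rw [rel_iff] at h h' ⊢
    have sub : ∀ {m : ℕ} {σ τ : Str}, Below δ o m → (σ.IsPrefix τ ∧
        ∀ m, Below δ o m → JumpAgree z m (rel z δ (some m)) σ τ) → rel z δ (some m) σ τ :=
      fun hm h => rel_iff.2 ⟨h.1, fun k hk => h.2 k (hm.of_lt hk)⟩
    exact ⟨isPrefix_trans h.1 h'.1, fun m hm => JumpAgree.trans (ih m hm) (sub hm h) (sub hm h')
      (h.2 m hm) (h'.2 m hm)⟩
  · intro σ τ υ h h' hl
    rw [rel_iff] at h h' ⊢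
    refine ⟨isPrefix_conv h.1 h'.1 hl, fun m hm => JumpAgree.conv (ih m hm) ?_ (h.2 m hm)⟩
    exact rel_iff.2 ⟨h'.1, fun k hk => h'.2 k (hm.of_lt hk)⟩
  · intro x
    classical
    refine Set.infinite_of_forall_exists_gt fun K => ?_
    -- `P` consists of the true stages one level above the highest level `n` with a name at most
    -- `K`, or of all stages if there is no such level. Each level `m` is either already satisfied
    -- on `P` or has a name exceeding `K` and all its predecessors of elements of `P` in `P`.
    obtain ⟨P, hinf, hP⟩ : ∃ P : ℕ → Prop, {k | P k}.Infinite ∧ ∀ m, Below δ o m →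
        (∀ k, P k → JumpAgree z m (rel z δ (some m)) (.fin (pre x k)) (.inf x)) ∨
        (K + 1 ≤ m ∧ ∀ k, P k → ∀ i < k,
          rel z δ (some m) (.fin (pre x i)) (.fin (pre x k)) → P i) := by
      rcases δ.exists_max_lt o (K + 1) with h | ⟨n, hnK, hn, h⟩
      · refine ⟨fun _ => True, by simpa using Set.infinite_univ, fun m hm => Or.inr ⟨?_, fun _ _ _ _ _ => trivial⟩⟩
        exact not_lt.1 fun hlt => h m hlt hm
      · refine ⟨_, infinite_agree n x z (ih n hn), fun m hm => ?_⟩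
        rcases δ.trichotomous hm.mem hn.mem with hlt | rfl | hlt
        · exact Or.inl fun k hk => (rel_iff.1 hk.1).2 m hlt
        · exact Or.inl fun k hk => hk.2
        · refine Or.inr ⟨not_lt.1 fun hmK => ?_, fun k hk i _ hik => ?_⟩
          · rcases h m hmK hm with rfl | h'
            · exact δ.wf.irrefl.irrefl _ hlt
            · exact δ.wf.irrefl.irrefl _ (δ.trans h' hlt)
          · have h1 : rel z δ (some n) (.fin (pre x i)) (.fin (pre x k)) :=
              rel_iff.2 ⟨(rel_iff.1 hik).1, fun j hj => (rel_iff.1 hik).2 j (δ.trans hj hlt)⟩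
            exact ⟨(ih n hn).trans h1 hk.1,
              JumpAgree.trans (ih n hn) h1 hk.1 ((rel_iff.1 hik).2 n hlt) hk.2⟩
    -- This element of `P` exceeds `K` and has exactly `K + 1` smaller elements of `P`. Every level
    -- `m ≥ K + 1` that is not already satisfied thus omits all of its predecessors.
    refine ⟨Nat.nth P (K + 1), ?_, ?_⟩
    · refine rel_iff.2 ⟨isPrefix_pre _ _, fun m hm => ?_⟩
      have hmem : P (Nat.nth P (K + 1)) := Nat.nth_mem_of_infinite hinf _
      rcases hP m hm with h | ⟨hKm, h⟩
      · exact h _ hmem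
      · refine jumpAgree_of_filter_length_le z (P := P) ?_ ?_
        · intro i hi hr
          rw [length_pre] at hi
          rw [take_pre, min_eq_left hi.le] at hr
          exact h _ hmem i hi hr
        · rw [length_pre, Nat.count_nth_of_infinite hinf]
          exact hKm
    · exact (Nat.nth_strictMono hinf).le_apply

/-! ### Locality in the oracle -/

/-- The infinite extension of a finite string by zeros. -/
def ext (l : List ℕ) : Baire := fun i => l.getD i 0

theorem ext_of_prefix {l : List ℕ} {z : Baire} (h : l = pre z l.length) :
    ∀ i < l.length, ext l i = z i := by
  intro i hi
  unfold ext
  rw [List.getD_eq_getElem?_getD]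
  conv_lhs => rw [h]
  rw [getElem?_pre z i _ hi]
  rfl

theorem pre_congr {z z' : Baire} {L j : ℕ} (h : ∀ i < L, z i = z' i) (hj : j ≤ L) :
    pre z j = pre z' j := by
  refine List.map_congr_left fun i hi => h i ((List.mem_range.1 hi).trans_le hj)

theorem haltsAt_congr {z z' : Baire} {u : List ℕ} (h : ∀ i < u.length, z i = z' i) (s : ℕ) :
    HaltsAt z (.fin u) s ↔ HaltsAt z' (.fin u) s := by
  refine and_congr_right fun hs => ?_
  have hs : s < u.length := Nat.cast_lt.1 hs
  have hj : s.unpair.2.unpair.1 ≤ u.length :=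
    ((Nat.unpair_left_le _).trans (Nat.unpair_right_le s)).trans hs.le
  rw [take_inf, take_inf, pre_congr h hj]

theorem jump_congr {z z' : Baire} {u : List ℕ} (h : ∀ i < u.length, z i = z' i) :
    jump z (.fin u) = jump z' (.fin u) := by
  ext e
  exact exists_congr fun s => and_congr_left fun _ => haltsAt_congr h s

theorem lastEnum_congr {z z' : Baire} {u : List ℕ} (h : ∀ i < u.length, z i = z' i) :
    lastEnum z (.fin u) = lastEnum z' (.fin u) := by
  classical
  have : ∀ s, lastBefore z (.fin u) s = lastBefore z' (.fin u) s := fun s => by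
    induction s with
    | zero => rfl
    | succ s ih =>
      rw [lastBefore_succ, lastBefore_succ, ih]
      have : NewAt z (.fin u) s ↔ NewAt z' (.fin u) s := by
        simp only [NewAt, haltsAt_congr h]
      simp only [this]
  exact this _

/-- Stage `s` of a jump reads at most `s` entries of the oracle, and a derived string is no longer
than the string it comes from. This locality allows an infinite oracle to be replaced by a finite
string in decision procedures. -/
theorem rel_congr {z z' : Baire} (δ : NOrdinal) (o : Option ℕ) {σ τ : List ℕ}
    (h : ∀ i < τ.length, z i = z' i) :
    rel z δ o (.fin σ) (.fin τ) ↔ rel z' δ o (.fin σ) (.fin τ) := by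
  classical
  induction o using NOrdinal.induction_below (δ := δ) generalizing σ τ with
  | _ o ih =>
  rw [rel_iff, rel_iff]
  refine and_congr_right fun hp => forall_congr' fun m => forall_congr' fun hm => ?_
  have hl := (isPrefix_fin.1 hp).length_le
  have key : ∀ l : List ℕ, (∀ i < l.length, z i = z' i) → ∃ u : List ℕ, u.length ≤ l.length ∧
      derivedString m (rel z δ (some m)) (.fin l) = .fin u ∧
      derivedString m (rel z' δ (some m)) (.fin l) = .fin u := by
    intro l hl
    refine ⟨_, ?_, derivedString_fin _ _ _, ?_⟩
    · rw [List.length_map, List.length_drop]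
      exact (Nat.sub_le _ _).trans ((List.length_filter_le _ _).trans (by simp))
    · rw [derivedString_fin]
      congr 4
      funext i
      rw [decide_eq_decide]
      exact (ih m hm hl).symm
  obtain ⟨u, hu, hu1, hu2⟩ := key σ fun i hi => h i (hi.trans_le hl)
  obtain ⟨v, hv, hv1, hv2⟩ := key τ h
  rw [jumpAgree_iff, jumpAgree_iff, hu1, hu2, hv1, hv2]
  have h1 : ∀ i < u.length, z i = z' i := fun i hi => h i ((hi.trans_le hu).trans_le hl)
  have h2 : ∀ i < v.length, z i = z' i := fun i hi => h i (hi.trans_le hv)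
  unfold Agree
  rw [jump_congr h1, jump_congr h2, lastEnum_congr h1]

/-! ### Decidability of the true stage relations on finite strings -/

section Decidability

variable {α : Type} [Primcodable α] {y : Baire}

@[fun_prop]
theorem Cmp.pre_ext {l : α → List ℕ} {j : α → ℕ} (hl : Cmp y l) (hj : Cmp y j) :
    Cmp y fun a => pre (ext (l a)) (j a) := by
  refine Primrec₂.cmp_comp (f := fun (l : List ℕ) j => pre (ext l) j) ?_ hl hj
  exact Primrec.list_map (Primrec.list_range.comp Primrec.snd)
    ((Primrec.list_getD 0).comp (Primrec.fst.comp Primrec.fst) Primrec.snd)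

@[fun_prop]
theorem Cmp.map_take {l : α → List ℕ} {r : α → List ℕ} (hl : Cmp y l) (hr : Cmp y r) :
    Cmp y fun a => (r a).map fun i => Encodable.encode ((l a).take i) := by
  refine Primrec₂.cmp_comp (f := fun (l r : List ℕ) => r.map fun i => Encodable.encode (l.take i)) ?_ hl hr
  exact Primrec.list_map Primrec.snd
    (Primrec.encode.comp (Primrec.list_take.comp Primrec.snd (Primrec.fst.comp Primrec.fst)))

@[fun_prop]
theorem Dec.haltsAt {l u : α → List ℕ} {s : α → ℕ} (hl : Cmp y l) (hu : Cmp y u)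
    (hs : Cmp y s) : Dec y fun a => HaltsAt (ext (l a)) (.fin (u a)) (s a) := by
  have h : Dec y fun a => s a < (u a).length ∧
    (Nat.Partrec.Code.evaln (s a).unpair.2.unpair.2
      (Denumerable.ofNat Nat.Partrec.Code (s a).unpair.1.unpair.1)
      (encode (pre (ext (l a)) (s a).unpair.2.unpair.1, (u a).take (s a).unpair.2.unpair.1,
        (s a).unpair.1.unpair.2))).isSome := by fun_prop
  exact h.of_eq fun a => and_congr Nat.cast_lt.symm Iff.rfl

@[fun_prop]
theorem Dec.newAt {l u : α → List ℕ} {s : α → ℕ} (hl : Cmp y l) (hu : Cmp y u)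
    (hs : Cmp y s) : Dec y fun a => NewAt (ext (l a)) (.fin (u a)) (s a) := by
  unfold NewAt
  refine Dec.and (by fun_prop) (Dec.ball ?_ hs)
  exact Dec.imp (by fun_prop) (by fun_prop)

@[fun_prop]
theorem Dec.mem_jump {l u : α → List ℕ} {e : α → ℕ} (hl : Cmp y l) (hu : Cmp y u)
    (he : Cmp y e) : Dec y fun a => e a ∈ jump (ext (l a)) (.fin (u a)) := by
  have h : Dec y fun a => ∃ s < (u a).length, HaltsAt (ext (l a)) (.fin (u a)) s ∧
      s.unpair.1 = e a := Dec.bex (by fun_prop) (by fun_prop)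
  exact h.of_eq fun a => ⟨fun ⟨s, _, h⟩ => ⟨s, h⟩, fun ⟨s, h⟩ => ⟨s, lt_of_haltsAt_fin h.1, h⟩⟩

/-- A form with bounded quantifiers, from which decidability can be read off. -/
theorem lt_lastBefore_iff (z : Baire) (υ : Str) (e : ℕ) (t : ℕ) :
    ((e : ℕ∞) : WithBot ℕ∞) < lastBefore z υ t ↔
      ∃ s < t, (NewAt z υ s ∧ ∀ r < t, s < r → ¬ NewAt z υ r) ∧ e < s.unpair.1 := by
  classical
  induction t with
  | zero => simp [lastBefore]
  | succ t ih =>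
    rw [lastBefore_succ]
    split_ifs with h
    · have hc : ((e : ℕ∞) : WithBot ℕ∞) < ((t.unpair.1 : ℕ∞) : WithBot ℕ∞) ↔ e < t.unpair.1 := by
        exact_mod_cast Iff.rfl
      rw [hc]
      constructor
      · intro he
        exact ⟨t, t.lt_succ_self, ⟨h, fun r h1 h2 => by omega⟩, he⟩
      · rintro ⟨s, hs, ⟨h1, h2⟩, h3⟩
        rcases Nat.lt_succ_iff_lt_or_eq.1 hs with hs | rfl
        · exact absurd h (h2 t t.lt_succ_self hs)
        · exact h3
    · rw [ih]
      constructor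
      · rintro ⟨s, hs, ⟨h1, h2⟩, h3⟩
        refine ⟨s, hs.trans t.lt_succ_self, ⟨h1, fun r hr hsr => ?_⟩, h3⟩
        rcases Nat.lt_succ_iff_lt_or_eq.1 hr with hr | rfl
        · exact h2 r hr hsr
        · exact h
      · rintro ⟨s, hs, ⟨h1, h2⟩, h3⟩
        rcases Nat.lt_succ_iff_lt_or_eq.1 hs with hs | rfl
        · exact ⟨s, hs, ⟨h1, fun r hr => h2 r (hr.trans t.lt_succ_self)⟩, h3⟩
        · exact absurd h1 h

@[fun_prop]
theorem Dec.lt_lastEnum {l u : α → List ℕ} {e : α → ℕ} (hl : Cmp y l) (hu : Cmp y u)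
    (he : Cmp y e) :
    Dec y fun a => ((e a : ℕ∞) : WithBot ℕ∞) < lastEnum (ext (l a)) (.fin (u a)) := by
  simp only [lastEnum, lt_lastBefore_iff]
  refine Dec.bex (Dec.and (Dec.and (by fun_prop) (Dec.ball ?_ (by fun_prop))) (by fun_prop))
    (by fun_prop)
  exact Dec.imp (by fun_prop) (by fun_prop)

@[fun_prop]
theorem Dec.agree {l u v : α → List ℕ} (hl : Cmp y l) (hu : Cmp y u) (hv : Cmp y v) :
    Dec y fun a => Agree (ext (l a)) (.fin (u a)) (.fin (v a)) := by
  have h : Dec y fun a => ∀ s < (v a).length, HaltsAt (ext (l a)) (.fin (v a)) s →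
      ((s.unpair.1 : ℕ∞) : WithBot ℕ∞) < lastEnum (ext (l a)) (.fin (u a)) →
        s.unpair.1 ∈ jump (ext (l a)) (.fin (u a)) :=
    Dec.ball (Dec.imp (by fun_prop) (Dec.imp (by fun_prop) (by fun_prop))) (by fun_prop)
  refine h.of_eq fun a => ⟨?_, ?_⟩
  · rintro h ⟨_, h1, ⟨s, hs, rfl⟩, h3⟩
    exact h3 (h s (lt_of_haltsAt_fin hs) hs h1)
  · intro h s _ h1 h2
    by_contra h3
    exact h ⟨_, h2, ⟨s, h1, rfl⟩, h3⟩

/-- The derived string of the initial segment of `τ` of length `j`, read off a table whose entries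
`(m, i, j)` list the true stage relations between the initial segments of `τ`. -/
def tableDerived (t : List (ℕ × ℕ × ℕ)) (τ : List ℕ) (m j : ℕ) : List ℕ :=
  (((List.range j).filter fun i => (m, i, j) ∈ t).drop m).map fun i => encode (τ.take i)

@[fun_prop]
theorem Cmp.tableDerived {t : α → List (ℕ × ℕ × ℕ)} {τ : α → List ℕ} {m j : α → ℕ}
    (ht : Cmp y t) (hτ : Cmp y τ) (hm : Cmp y m) (hj : Cmp y j) :
    Cmp y fun a => tableDerived (t a) (τ a) (m a) (j a) := by
  unfold Wadge.tableDerived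
  have h : Cmp y fun a => (List.range (j a)).filter fun i => (m a, i, j a) ∈ t a :=
    Cmp.filter_range (by fun_prop) hj
  exact Cmp.map_take hτ (by fun_prop)

/-- The table says that the initial segments of `τ` of lengths `i` and `j` are related at the
level `o`. -/
def TableRel (l : List ℕ) (δ : NOrdinal) (τ : List ℕ) (t : List (ℕ × ℕ × ℕ)) (o : Option ℕ)
    (i j : ℕ) : Prop :=
  ∀ m < τ.length, Below δ o m →
    Agree (ext l) (.fin (tableDerived t τ m i)) (.fin (tableDerived t τ m j))

/-- The table satisfies the recursive clauses of the true stage relations. -/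
def TableConsistent (l : List ℕ) (δ : NOrdinal) (τ : List ℕ) (t : List (ℕ × ℕ × ℕ)) : Prop :=
  ∀ m < τ.length, ∀ j < τ.length + 1, ∀ i < j + 1,
    (m, i, j) ∈ t ↔ TableRel l δ τ t (some m) i j

/-- Levels named by numbers at least the length of `τ` impose no condition, because their derived
strings are empty. A finite table therefore carries all the information that the recursion needs. -/
theorem tableRel_iff {l : List ℕ} {δ : NOrdinal} {τ : List ℕ} {t : List (ℕ × ℕ × ℕ)}
    {o : Option ℕ} (h : ∀ m < τ.length, Below δ o m → ∀ j ≤ τ.length, ∀ i ≤ j,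
      ((m, i, j) ∈ t ↔ rel (ext l) δ (some m) (.fin (τ.take i)) (.fin (τ.take j))))
    {i j : ℕ} (hij : i ≤ j) (hj : j ≤ τ.length) :
    TableRel l δ τ t o i j ↔ rel (ext l) δ o (.fin (τ.take i)) (.fin (τ.take j)) := by
  classical
  have key : ∀ m < τ.length, Below δ o m → ∀ j ≤ τ.length,
      derivedString m (rel (ext l) δ (some m)) (.fin (τ.take j)) =
        .fin (tableDerived t τ m j) := by
    intro m hm hb j hj
    rw [derivedString_fin, tableDerived, List.length_take, min_eq_left hj]
    congr 1
    have h1 : (List.range j).filter (fun i => rel (ext l) δ (some m)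
        (.fin ((τ.take j).take i)) (.fin (τ.take j))) =
        (List.range j).filter fun i => (m, i, j) ∈ t := by
      refine List.filter_congr fun i hi => ?_
      have hi := List.mem_range.1 hi
      rw [List.take_take, min_eq_left hi.le, decide_eq_decide]
      exact (h m hm hb j hj i hi.le).symm
    rw [h1]
    refine List.map_congr_left fun i hi => ?_
    have hi := List.mem_range.1 (List.mem_of_mem_filter (List.mem_of_mem_drop hi))
    rw [List.take_take, min_eq_left hi.le]
  rw [rel_iff]
  constructor
  · intro H
    refine ⟨isPrefix_fin.2 (List.take_prefix_take_left hij), fun m hm => ?_⟩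
    by_cases hml : m < τ.length
    · rw [jumpAgree_iff, key m hml hm i (hij.trans hj), key m hml hm j hj]
      exact H m hml hm
    · exact jumpAgree_of_length_le _ (by rw [List.length_take]; omega)
  · rintro ⟨_, H⟩ m hml hm
    have := H m hm
    rwa [jumpAgree_iff, key m hml hm i (hij.trans hj), key m hml hm j hj] at this

/-- Induction along `δ`: the recursive clauses leave a consistent table no freedom at the relevant
triples. -/
theorem TableConsistent.mem_iff {l : List ℕ} {δ : NOrdinal} {τ : List ℕ}
    {t : List (ℕ × ℕ × ℕ)} (h : TableConsistent l δ τ t) : ∀ m < τ.length, ∀ j ≤ τ.length,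
      ∀ i ≤ j, ((m, i, j) ∈ t ↔ rel (ext l) δ (some m) (.fin (τ.take i)) (.fin (τ.take j))) := by
  intro m
  induction m using δ.wf.induction with
  | _ m ih =>
  intro hm j hj i hij
  rw [h m hm j (by omega) i (by omega)]
  exact tableRel_iff (o := some m) (fun k hk hb => ih k hb hk) hij hj

theorem exists_tableConsistent (l : List ℕ) (δ : NOrdinal) (τ : List ℕ) :
    ∃ t, TableConsistent l δ τ t := by
  classical
  let t := ((Finset.range τ.length ×ˢ Finset.range (τ.length + 1) ×ˢ
    Finset.range (τ.length + 1)).filter fun p : ℕ × ℕ × ℕ =>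
      rel (ext l) δ (some p.1) (.fin (τ.take p.2.1)) (.fin (τ.take p.2.2))).toList
  have ht : ∀ m < τ.length, ∀ j ≤ τ.length, ∀ i ≤ j, ((m, i, j) ∈ t ↔
      rel (ext l) δ (some m) (.fin (τ.take i)) (.fin (τ.take j))) := by
    intro m hm j hj i hij
    simp only [t, Finset.mem_toList, Finset.mem_filter, Finset.mem_product, Finset.mem_range]
    exact and_iff_right ⟨hm, by omega, by omega⟩
  refine ⟨t, fun m hm j hj i hij => ?_⟩
  rw [ht m hm j (by omega) i (by omega)]
  exact (tableRel_iff (fun k hk _ => ht k hk) (by omega) (by omega)).symm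

variable {ι : Type} [Primcodable ι]

/-- The true stage relations on finite strings are decidable, uniformly in the oracle and in a
decidable family of ordinals. -/
theorem Dec.rel {δ : ι → NOrdinal}
    (hδ : Dec y fun p : ι × Option ℕ × ℕ => Below (δ p.1) p.2.1 p.2.2)
    {l σ τ : α → List ℕ} {s : α → ι} {o : α → Option ℕ} (hl : Cmp y l) (hs : Cmp y s)
    (ho : Cmp y o) (hσ : Cmp y σ) (hτ : Cmp y τ) :
    Dec y fun a => rel (ext (l a)) (δ (s a)) (o a) (.fin (σ a)) (.fin (τ a)) := by
  have hrow : ∀ {β : Type} [Primcodable β] {l τ : β → List ℕ} {s : β → ι} {t} {o i j},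
      Cmp y l → Cmp y s → Cmp y τ → Cmp y t → Cmp y o → Cmp y i → Cmp y j →
      Dec y fun b => TableRel (l b) (δ (s b)) (τ b) (t b) (o b) (i b) (j b) := by
    intro β _ l τ s t o i j hl hs hτ ht ho hi hj
    refine Dec.ball (Dec.imp ?_ (by fun_prop)) (by fun_prop)
    exact Dec.comp (f := fun q : β × ℕ => (s q.1, o q.1, q.2)) hδ (by fun_prop)
  have hcons : Dec y fun p : α × List (ℕ × ℕ × ℕ) =>
      TableConsistent (l p.1) (δ (s p.1)) (τ p.1) p.2 := by
    refine Dec.ball (Dec.ball (Dec.ball (Dec.iff (by fun_prop) ?_) (by fun_prop)) (by fun_prop))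
      (by fun_prop)
    exact hrow (by fun_prop) (by fun_prop) (by fun_prop) (by fun_prop) (by fun_prop)
      (by fun_prop) (by fun_prop)
  have hrow' : Dec y fun p : α × List (ℕ × ℕ × ℕ) => σ p.1 <+: τ p.1 ∧
      TableRel (l p.1) (δ (s p.1)) (τ p.1) p.2 (o p.1) (σ p.1).length (τ p.1).length :=
    Dec.and (by fun_prop) (hrow (by fun_prop) (by fun_prop) (by fun_prop) (by fun_prop)
      (by fun_prop) (by fun_prop) (by fun_prop))
  have key : ∀ a t, TableConsistent (l a) (δ (s a)) (τ a) t →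
      ((σ a <+: τ a ∧ TableRel (l a) (δ (s a)) (τ a) t (o a) (σ a).length (τ a).length) ↔
        Wadge.rel (ext (l a)) (δ (s a)) (o a) (.fin (σ a)) (.fin (τ a))) := by
    intro a t ht
    have h1 : σ a <+: τ a → (TableRel (l a) (δ (s a)) (τ a) t (o a) (σ a).length (τ a).length ↔
        Wadge.rel (ext (l a)) (δ (s a)) (o a) (.fin (σ a)) (.fin (τ a))) := fun hp => by
      rw [tableRel_iff (fun m hm _ => ht.mem_iff m hm) hp.length_le le_rfl, List.take_length,
        ← List.prefix_iff_eq_take.1 hp]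
    exact ⟨fun h => (h1 h.1).1 h.2, fun h =>
      have hp := isPrefix_fin.1 (rel_iff.1 h).1
      ⟨hp, (h1 hp).2 h⟩⟩
  -- Consistent tables exist and all give the same answer, so searching for one enumerates both the
  -- relation and its negation.
  refine ⟨(CE.ex (P := fun a t => TableConsistent (l a) (δ (s a)) (τ a) t ∧ (σ a <+: τ a ∧
      TableRel (l a) (δ (s a)) (τ a) t (o a) (σ a).length (τ a).length))
      (hcons.1.and hrow'.1)).of_eq fun a => ?_,
    (CE.ex (P := fun a t => TableConsistent (l a) (δ (s a)) (τ a) t ∧ ¬ (σ a <+: τ a ∧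
      TableRel (l a) (δ (s a)) (τ a) t (o a) (σ a).length (τ a).length))
      (hcons.1.and hrow'.2)).of_eq fun a => ?_⟩
  · obtain ⟨t, ht⟩ := exists_tableConsistent (l a) (δ (s a)) (τ a)
    exact ⟨fun ⟨t, h1, h2⟩ => (key a t h1).1 h2, fun h => ⟨t, ht, (key a t ht).2 h⟩⟩
  · obtain ⟨t, ht⟩ := exists_tableConsistent (l a) (δ (s a)) (τ a)
    exact ⟨fun ⟨t, h1, h2⟩ h => h2 ((key a t h1).2 h),
      fun h => ⟨t, ht, fun h' => h ((key a t ht).1 h')⟩⟩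

open Classical in
/-- The derived string of a finite string, as a list. -/
noncomputable def derivedList (z : Baire) (δ : NOrdinal) (m : ℕ) (l : List ℕ) : List ℕ :=
  (((List.range l.length).filter fun i =>
    rel z δ (some m) (.fin (l.take i)) (.fin l)).drop m).map fun i => encode (l.take i)

theorem derivedString_rel (z : Baire) (δ : NOrdinal) (m : ℕ) (l : List ℕ) :
    derivedString m (rel z δ (some m)) (.fin l) = .fin (derivedList z δ m l) :=
  derivedString_fin _ _ _

theorem length_derivedList_le (z : Baire) (δ : NOrdinal) (m : ℕ) (l : List ℕ) :
    (derivedList z δ m l).length ≤ l.length := by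
  unfold derivedList
  rw [List.length_map, List.length_drop]
  exact (Nat.sub_le _ _).trans ((List.length_filter_le _ _).trans (by simp))

theorem derivedList_congr {z z' : Baire} (δ : NOrdinal) (m : ℕ) {l : List ℕ}
    (h : ∀ i < l.length, z i = z' i) : derivedList z δ m l = derivedList z' δ m l := by
  unfold derivedList
  congr 3
  funext i
  rw [decide_eq_decide]
  exact rel_congr δ _ h

theorem Cmp.derivedList {δ : ι → NOrdinal}
    (hδ : Dec y fun p : ι × Option ℕ × ℕ => Below (δ p.1) p.2.1 p.2.2)
    {l τ : α → List ℕ} {s : α → ι} {m : α → ℕ} (hl : Cmp y l) (hs : Cmp y s)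
    (hm : Cmp y m) (hτ : Cmp y τ) :
    Cmp y fun a => derivedList (ext (l a)) (δ (s a)) (m a) (τ a) := by
  classical
  have h : Cmp y fun a => (List.range (τ a).length).filter fun i =>
      Wadge.rel (ext (l a)) (δ (s a)) (some (m a)) (.fin ((τ a).take i)) (.fin (τ a)) := by
    refine Cmp.filter_range ?_ (by fun_prop)
    exact Dec.rel hδ (by fun_prop) (by fun_prop) (by fun_prop) (by fun_prop) (by fun_prop)
  have h2 : Cmp y fun a => (((List.range (τ a).length).filter fun i =>
      Wadge.rel (ext (l a)) (δ (s a)) (some (m a)) (.fin ((τ a).take i)) (.fin (τ a))).drop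
      (m a)).map fun i => Encodable.encode ((τ a).take i) :=
    Cmp.map_take hτ (by fun_prop)
  unfold Wadge.derivedList
  convert h2

end Decidability

/-! ### The jump as a universal computably enumerable predicate -/

theorem mem_jump_inf_iff {y V : Baire} {c : Nat.Partrec.Code} {k : ℕ} :
    Nat.pair (encode c) k ∈ jump y (.inf V) ↔
      ∃ j, (c.eval (encode (pre y j, pre V j, k))).Dom := by
  constructor
  · rintro ⟨s, ⟨_, h⟩, hs⟩
    rw [hs] at h
    simp only [Nat.unpair_pair, Denumerable.ofNat_encode] at h
    obtain ⟨x, hx⟩ := Option.isSome_iff_exists.1 h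
    exact ⟨s.unpair.2.unpair.1, Part.dom_iff_mem.2 ⟨x, Nat.Partrec.Code.evaln_sound hx⟩⟩
  · rintro ⟨j, hj⟩
    obtain ⟨x, hx⟩ := Part.dom_iff_mem.1 hj
    obtain ⟨t, ht⟩ := Nat.Partrec.Code.evaln_complete.1 hx
    refine ⟨Nat.pair (Nat.pair (encode c) k) (Nat.pair j t), ⟨ENat.natCast_lt_top _, ?_⟩, by simp⟩
    simp only [Nat.unpair_pair, Denumerable.ofNat_encode]
    exact Option.isSome_iff_exists.2 ⟨x, ht⟩

/-- A program for the universal machine that may refer to itself. -/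
theorem exists_code_mem_jump {y : Baire} {B : Nat.Partrec.Code × List ℕ × ℕ → Prop} (hB : CE y B)
    (hmono : ∀ c v v' k, v <+: v' → B (c, v, k) → B (c, v', k)) :
    ∃ c : Nat.Partrec.Code, ∀ V k,
      Nat.pair (encode c) k ∈ jump y (.inf V) ↔ ∃ i, B (c, pre V i, k) := by
  obtain ⟨Q, hQ, hBQ, hm⟩ := hB.exists_monotone
  -- The machine reads both tapes to the same length. The matrix may discard a tail of the tape `V`,
  -- so that a long oracle prefix can be combined with a short piece of `V`.
  let Q' : List ℕ × Nat.Partrec.Code × List ℕ × ℕ → Prop := fun p =>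
    ∃ i < p.2.2.1.length + 1, Q (p.1, (p.2.1, p.2.2.1.take i, p.2.2.2))
  have hQ' : PrimrecPred Q' := by
    have h1 : Primrec fun p : List ℕ × Nat.Partrec.Code × List ℕ × ℕ => p.2.2.1 :=
      Primrec.fst.comp (Primrec.snd.comp Primrec.snd)
    refine PrimrecPred.exists_lt_bound (P := fun p : List ℕ × Nat.Partrec.Code × List ℕ × ℕ =>
      fun i => Q (p.1, (p.2.1, p.2.2.1.take i, p.2.2.2))) ?_
      (Primrec.succ.comp (Primrec.list_length.comp h1))
    refine hQ.comp ((Primrec.fst.comp Primrec.fst).pair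
      ((Primrec.fst.comp (Primrec.snd.comp Primrec.fst)).pair
        (Primrec.pair (Primrec.list_take.comp Primrec.snd (h1.comp Primrec.fst))
          (Primrec.snd.comp (Primrec.snd.comp (Primrec.snd.comp Primrec.fst))))))
  obtain ⟨hd, -⟩ := id hQ'
  let F : Nat.Partrec.Code × ℕ → Option ℕ := fun q =>
    (decode (α := List ℕ × List ℕ × ℕ) q.2).bind fun p =>
      if Q' (p.1, (q.1, p.2.1, p.2.2)) then some 0 else none
  have hF : Primrec F := by
    refine Primrec.option_bind (Primrec.decode.comp Primrec.snd) ?_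
    refine Primrec.ite (hQ'.comp ?_) (Primrec.const (some 0)) (Primrec.const none)
    exact (Primrec.fst.comp Primrec.snd).pair
      ((Primrec.fst.comp Primrec.fst).pair (Primrec.snd.comp Primrec.snd))
  -- Kleene's recursion theorem supplies the program with its own code `c`.
  obtain ⟨c, hc⟩ := Nat.Partrec.Code.fixed_point₂
    (f := fun c n => Part.ofOption (F (c, n))) (Computable.ofOption hF.to_comp)
  have hdom : ∀ u v k, (c.eval (encode (u, v, k))).Dom ↔ Q' (u, (c, v, k)) := by
    intro u v k
    have h1 : c.eval (encode (u, v, k)) = Part.ofOption (F (c, encode (u, v, k))) := congrFun hc _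
    have h2 : F (c, encode (u, v, k)) = if Q' (u, (c, v, k)) then some 0 else none := by
      simp [F]
    rw [h1, h2]
    split_ifs with h
    · simpa using h
    · simpa using h
  refine ⟨c, fun V k => ?_⟩
  rw [mem_jump_inf_iff]
  constructor
  · rintro ⟨j, hj⟩
    obtain ⟨i, _, h⟩ := (hdom _ _ _).1 hj
    have h := (hBQ (c, (pre V j).take i, k)).2 ⟨j, h⟩
    exact ⟨j, hmono _ _ _ _ (List.take_prefix _ _) h⟩
  · rintro ⟨i, hi⟩
    obtain ⟨j, hj⟩ := (hBQ _).1 hi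
    refine ⟨max i j, (hdom _ _ _).2 ⟨i, ?_, ?_⟩⟩
    · simp only [length_pre]
      omega
    · simp only [take_pre, min_eq_left (le_max_left i j)]
      exact hm _ _ _ (pre_prefix y (le_max_right i j)) hj

/-! ### Certificates for true stages of computable images -/

/-- A continuous function on Baire space that is computable in `y`, given by its finite
approximations. -/
structure Functional (y : Baire) where
  fn : List ℕ → List ℕ
  lim : Baire → Baire
  cmp : Cmp y fn
  eq_pre : ∀ w k, fn (pre w k) = pre (lim w) (fn (pre w k)).length
  unbounded : ∀ w n, ∃ N, ∀ k, N ≤ k → n ≤ (fn (pre w k)).length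

section Certificates

variable {y : Baire} {ι : Type} [Primcodable ι] (δ : ι → NOrdinal) (Z G : Functional y)

/-- The string `ρ` certifies that `σ` is a true stage at the level `o`, where the program `c`
enumerates the elements of the jumps that have to be avoided. -/
def Cert (c : Nat.Partrec.Code) (s : ι) (o : Option ℕ) (ρ σ : List ℕ) : Prop :=
  σ <+: G.fn ρ ∧ σ.length ≤ (Z.fn ρ).length ∧ ∀ m < σ.length, Below (δ s) o m → ∀ e < σ.length,
    ((e : ℕ∞) : WithBot ℕ∞) <
        lastEnum (ext (Z.fn ρ)) (.fin (derivedList (ext (Z.fn ρ)) (δ s) m σ)) →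
    e ∉ jump (ext (Z.fn ρ)) (.fin (derivedList (ext (Z.fn ρ)) (δ s) m σ)) →
      ((Nat.pair (encode c) (encode (s, m, e)) : ℕ∞) : WithBot ℕ∞) <
        lastEnum (ext (pre y ρ.length)) (.fin (derivedList (ext (pre y ρ.length)) (δ s) m ρ)) ∧
      Nat.pair (encode c) (encode (s, m, e)) ∉
        jump (ext (pre y ρ.length)) (.fin (derivedList (ext (pre y ρ.length)) (δ s) m ρ))

/-- The program `c` enumerates the jumps of the derived strings of the image. -/
def CertBody (p : Nat.Partrec.Code × List ℕ × ℕ) : Prop :=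
  ∃ a : (ι × ℕ × ℕ) × List ℕ × List ℕ, (encode a.1 = p.2.2 ∧ encode a.2.1 ∈ p.2.1) ∧
    Cert δ Z G p.1 a.1.1 (some a.1.2.1) a.2.1 a.2.2 ∧
      a.1.2.2 ∈ jump (ext (Z.fn a.2.1))
        (.fin (derivedList (ext (Z.fn a.2.1)) (δ a.1.1) a.1.2.1 a.2.2))

variable {δ}

/-- The quantifiers in a certificate are bounded by the length of `σ`, and the oracles enter only
through finite strings that are long enough for the computations involved. This is what makes
certificates decidable. -/
theorem Dec.cert {α : Type} [Primcodable α]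
    (hδ : Dec y fun p : ι × Option ℕ × ℕ => Below (δ p.1) p.2.1 p.2.2)
    {c : α → Nat.Partrec.Code} {s : α → ι} {o : α → Option ℕ} {ρ σ : α → List ℕ}
    (hc : Cmp y c) (hs : Cmp y s) (ho : Cmp y o) (hρ : Cmp y ρ) (hσ : Cmp y σ) :
    Dec y fun a => Cert δ Z G (c a) (s a) (o a) (ρ a) (σ a) := by
  have hZ : Cmp y fun a => Z.fn (ρ a) := Z.cmp.comp hρ
  have hG : Cmp y fun a => G.fn (ρ a) := G.cmp.comp hρ
  have hy : Cmp y fun a => pre y (ρ a).length := (TuringLE.refl y).cmp_pre.comp (by fun_prop)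
  unfold Cert
  refine Dec.and (by fun_prop) (Dec.and (by fun_prop) ?_)
  refine Dec.ball (Dec.imp ?_ (Dec.ball ?_ (by fun_prop))) (by fun_prop)
  · exact Dec.comp (f := fun p : α × ℕ => (s p.1, o p.1, p.2)) hδ (by fun_prop)
  · have hZ' : Cmp y fun p : (α × ℕ) × ℕ => Z.fn (ρ p.1.1) :=
      hZ.comp (g := fun p : (α × ℕ) × ℕ => p.1.1) (by fun_prop)
    have hy' : Cmp y fun p : (α × ℕ) × ℕ => pre y (ρ p.1.1).length :=
      hy.comp (g := fun p : (α × ℕ) × ℕ => p.1.1) (by fun_prop)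
    have h1 : Cmp y fun p : (α × ℕ) × ℕ =>
        derivedList (ext (Z.fn (ρ p.1.1))) (δ (s p.1.1)) p.1.2 (σ p.1.1) :=
      Cmp.derivedList hδ hZ' (by fun_prop) (by fun_prop) (by fun_prop)
    have h2 : Cmp y fun p : (α × ℕ) × ℕ =>
        derivedList (ext (pre y (ρ p.1.1).length)) (δ (s p.1.1)) p.1.2 (ρ p.1.1) :=
      Cmp.derivedList hδ hy' (by fun_prop) (by fun_prop) (by fun_prop)
    refine Dec.imp ?_ (Dec.imp (Dec.not ?_) (Dec.and ?_ (Dec.not ?_)))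
    · exact Dec.lt_lastEnum hZ' h1 (by fun_prop)
    · exact Dec.mem_jump hZ' h1 (by fun_prop)
    · exact Dec.lt_lastEnum hy' h2 (by fun_prop)
    · exact Dec.mem_jump hy' h2 (by fun_prop)

theorem ce_certBody (hδ : Dec y fun p : ι × Option ℕ × ℕ => Below (δ p.1) p.2.1 p.2.2) :
    CE y (CertBody δ Z G) := by
  refine CE.ex (P := fun (p : Nat.Partrec.Code × List ℕ × ℕ)
    (a : (ι × ℕ × ℕ) × List ℕ × List ℕ) => (encode a.1 = p.2.2 ∧ encode a.2.1 ∈ p.2.1) ∧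
    Cert δ Z G p.1 a.1.1 (some a.1.2.1) a.2.1 a.2.2 ∧
      a.1.2.2 ∈ jump (ext (Z.fn a.2.1))
        (.fin (derivedList (ext (Z.fn a.2.1)) (δ a.1.1) a.1.2.1 a.2.2))) (Dec.and ?_ ?_).1
  · fun_prop
  · refine Dec.and (Dec.cert Z G hδ (by fun_prop) (by fun_prop) (by fun_prop) (by fun_prop)
      (by fun_prop)) ?_
    have hZ : Cmp y fun p : (Nat.Partrec.Code × List ℕ × ℕ) ×
        ((ι × ℕ × ℕ) × List ℕ × List ℕ) => Z.fn p.2.2.1 := Z.cmp.comp (by fun_prop)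
    exact Dec.mem_jump hZ (Cmp.derivedList hδ hZ (by fun_prop) (by fun_prop) (by fun_prop))
      (by fun_prop)

/-- Self-reference is needed because the certificates that the program searches for speak about the
numbers that the same program enumerates. -/
theorem exists_cert_code (hδ : Dec y fun p : ι × Option ℕ × ℕ => Below (δ p.1) p.2.1 p.2.2) :
    ∃ c : Nat.Partrec.Code, ∀ V k,
      Nat.pair (encode c) k ∈ jump y (.inf V) ↔ ∃ i, CertBody δ Z G (c, pre V i, k) :=
  exists_code_mem_jump (ce_certBody Z G hδ) fun _ _ _ _ hv ⟨a, h, h'⟩ =>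
    ⟨a, ⟨h.1, hv.subset h.2⟩, h'⟩

variable {Z G}

/-- The last element is bounded by the stage at which it was enumerated. Hence a certificate loses
nothing by considering only `e` below the length of `σ`. -/
theorem lt_length_of_lt_lastEnum {z : Baire} {u : List ℕ} {e : ℕ}
    (h : ((e : ℕ∞) : WithBot ℕ∞) < lastEnum z (.fin u)) : e < u.length := by
  obtain ⟨s, hs, _, he⟩ := (lt_lastBefore_iff z (.fin u) e u.length).1 h
  exact (he.trans_le (Nat.unpair_left_le s)).trans hs

theorem Functional.ext_eq (Z : Functional y) (w : Baire) (k : ℕ) {n : ℕ}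
    (hn : n ≤ (Z.fn (pre w k)).length) : ∀ i < n, ext (Z.fn (pre w k)) i = Z.lim w i :=
  fun i hi => ext_of_prefix (Z.eq_pre w k) i (hi.trans_le hn)

theorem Path.of_below {z : Baire} {δ : NOrdinal} {o : Option ℕ} {m : ℕ} (hm : Below δ o m)
    {x : Baire} {k : ℕ} (h : Path (rel z δ o) x k) : Path (rel z δ (some m)) x k :=
  rel_iff.2 ⟨(rel_iff.1 h).1, fun j hj => (rel_iff.1 h).2 j (hm.of_lt hj)⟩

/-- At a level where certificates work, the program enumerates the jump of the image. -/
theorem mem_jump_iff_of_cert {c : Nat.Partrec.Code}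
    (hc : ∀ V k, Nat.pair (encode c) k ∈ jump y (.inf V) ↔ ∃ i, CertBody δ Z G (c, pre V i, k))
    {w : Baire} {s : ι} {m : ℕ}
    (h1 : ∀ σ k, Path (rel y (δ s) (some m)) w k → Cert δ Z G c s (some m) (pre w k) σ →
      rel (Z.lim w) (δ s) (some m) (.fin σ) (.inf (G.lim w)))
    (h2 : ∀ σ, rel (Z.lim w) (δ s) (some m) (.fin σ) (.inf (G.lim w)) → ∀ N, ∃ k, N ≤ k ∧
      Path (rel y (δ s) (some m)) w k ∧ Cert δ Z G c s (some m) (pre w k) σ) (e : ℕ) :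
    Nat.pair (encode c) (encode (s, m, e)) ∈
        jump y (derivedString m (rel y (δ s) (some m)) (.inf w)) ↔
      e ∈ jump (Z.lim w) (derivedString m (rel (Z.lim w) (δ s) (some m)) (.inf (G.lim w))) := by
  classical
  have hR := treeLike_rel y (δ s) (some m)
  have hR' := treeLike_rel (Z.lim w) (δ s) (some m)
  have hinf : {k | Path (rel y (δ s) (some m)) w k}.Infinite := hR.infinite w
  have hj : ∀ k (σ : List ℕ), σ.length ≤ (Z.fn (pre w k)).length →
      jump (ext (Z.fn (pre w k))) (.fin (derivedList (ext (Z.fn (pre w k))) (δ s) m σ)) =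
        jump (Z.lim w) (.fin (derivedList (Z.lim w) (δ s) m σ)) := by
    intro k σ hl
    rw [derivedList_congr (δ s) m (Z.ext_eq w k hl)]
    exact jump_congr (Z.ext_eq w k ((length_derivedList_le _ _ _ _).trans hl))
  rw [derivedString_inf m w hR, hc]
  constructor
  · rintro ⟨i, ⟨⟨s', m', e'⟩, ρ, σ⟩, ⟨he, hρ⟩, hcert, hjump⟩
    have he := encode_injective he
    simp only [Prod.mk.injEq] at he
    obtain ⟨rfl, rfl, rfl⟩ := he
    -- The entries of the derived string are codes of true stages of `w`, so the soundness
    -- hypothesis `h1` applies to the string `ρ` found on the tape.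
    obtain ⟨j, _, hρ⟩ := List.mem_map.1 hρ
    have hρ : pre w (Nat.nth (Path (rel y (δ s') (some m'))  w) (m' + j)) = ρ :=
      encode_injective hρ
    subst hρ
    have hσ := h1 σ _ (Nat.nth_mem_of_infinite hinf _) hcert
    simp only at hjump
    rw [hj _ _ hcert.2.1] at hjump
    obtain ⟨u, hu, hp⟩ := derivedString_isPrefix m' hR' hσ
    rw [derivedString_rel] at hu
    rw [hu] at hjump
    exact jump_mono _ hp hjump
  · intro he
    obtain ⟨k', hk', he⟩ := (mem_jump_derivedString m _ _ hR' e).1 he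
    rw [derivedString_rel] at he
    -- The certifying stage is taken beyond the first `m` true stages, which do not occur on the
    -- tape. This is why certificates must exist at arbitrarily late stages.
    obtain ⟨k, hk, hP, hcert⟩ := h2 _ hk' (Nat.nth (Path (rel y (δ s) (some m)) w) m)
    have hcount := Nat.count_monotone (Path (rel y (δ s) (some m)) w) hk
    rw [Nat.count_nth_of_infinite hinf] at hcount
    refine ⟨Nat.count (Path (rel y (δ s) (some m)) w) k - m + 1,
      ((s, m, e), pre w k, pre (G.lim w) k'), ⟨rfl, ?_⟩, hcert, ?_⟩
    · refine List.mem_map.2 ⟨Nat.count (Path (rel y (δ s) (some m)) w) k - m,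
        List.mem_range.2 (Nat.lt_succ_self _), ?_⟩
      rw [derived, Nat.add_sub_cancel' hcount, Nat.nth_count hP]
    · simp only
      rwa [hj _ _ hcert.2.1]

/-- The true stages of the image are exactly those certified along the true stages of `w`. -/
theorem cert_spec {c : Nat.Partrec.Code}
    (hc : ∀ V k, Nat.pair (encode c) k ∈ jump y (.inf V) ↔ ∃ i, CertBody δ Z G (c, pre V i, k))
    (w : Baire) (s : ι) (o : Option ℕ) :
    (∀ σ k, Path (rel y (δ s) o) w k → Cert δ Z G c s o (pre w k) σ →
      rel (Z.lim w) (δ s) o (.fin σ) (.inf (G.lim w))) ∧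
    (∀ σ, rel (Z.lim w) (δ s) o (.fin σ) (.inf (G.lim w)) → ∀ N, ∃ k, N ≤ k ∧
      Path (rel y (δ s) o) w k ∧ Cert δ Z G c s o (pre w k) σ) := by
  induction o using NOrdinal.induction_below (δ := δ s) with
  | _ o ih =>
  have key := fun m hm => mem_jump_iff_of_cert hc (ih m hm).1 (ih m hm).2
  have hy : ∀ m k, derivedList (ext (pre y k)) (δ s) m (pre w k) =
      derivedList y (δ s) m (pre w k) := fun m k =>
    derivedList_congr (δ s) m fun i hi => ext_of_prefix (by simp) i (by simpa using hi)
  have hy' : ∀ m k, ∀ i < (derivedList y (δ s) m (pre w k)).length, ext (pre y k) i = y i :=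
    fun m k i hi => ext_of_prefix (by simp) i
      (by simpa using hi.trans_le (length_derivedList_le _ _ _ _))
  have hz : ∀ m k (σ : List ℕ), σ.length ≤ (Z.fn (pre w k)).length →
      derivedList (ext (Z.fn (pre w k))) (δ s) m σ = derivedList (Z.lim w) (δ s) m σ :=
    fun m k σ hl => derivedList_congr (δ s) m (Z.ext_eq w k hl)
  have hz' : ∀ m k (σ : List ℕ), σ.length ≤ (Z.fn (pre w k)).length →
      ∀ i < (derivedList (Z.lim w) (δ s) m σ).length, ext (Z.fn (pre w k)) i = Z.lim w i :=
    fun m k σ hl => Z.ext_eq w k ((length_derivedList_le _ _ _ _).trans hl)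
  constructor
  · rintro σ k hk ⟨hG, hZ, hcert⟩
    refine rel_iff.2 ⟨?_, fun m hm => ?_⟩
    · rw [isPrefix_inf]
      rw [G.eq_pre] at hG
      exact eq_pre_of_prefix hG
    -- A certificate is silent about these `m`, but there the derived string of `σ` is empty.
    by_cases hml : σ.length ≤ m
    · exact jumpAgree_of_length_le _ hml
    rw [jumpAgree_iff, derivedString_rel]
    rintro ⟨e, he, h1, h2⟩
    have hel : e < σ.length := (lt_length_of_lt_lastEnum he).trans_le (length_derivedList_le _ _ _ _)
    have := hcert m (not_le.1 hml) hm e hel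
    rw [hz m k σ hZ, length_pre, hy, lastEnum_congr (hz' m k σ hZ), jump_congr (hz' m k σ hZ),
      lastEnum_congr (hy' m k), jump_congr (hy' m k)] at this
    obtain ⟨h3, h4⟩ := this he h2
    -- The number assigned to `e` is below the last element at the true stage of `w` and missing
    -- from the jump there, so it never enters. By the correctness of `c` at level `m`, neither does
    -- `e` for the image.
    have hag := (rel_iff.1 hk).2 m hm
    rw [jumpAgree_iff, derivedString_rel] at hag
    exact hag ⟨_, h3, (key m hm e).2 h1, h4⟩
  · intro σ hσ N
    -- Along the true stages of `w` the last element eventually exceeds any given number. Only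
    -- finitely many pairs `(m, e)` matter for a fixed `σ`, so one late stage serves for all of
    -- them.
    have hlim : ∀ p : ℕ × ℕ, ∃ N, Below (δ s) o p.1 → ∀ k, N ≤ k → Path (rel y (δ s) o) w k →
        ((Nat.pair (encode c) (encode (s, p)) : ℕ∞) : WithBot ℕ∞) <
          lastEnum y (.fin (derivedList y (δ s) p.1 (pre w k))) := by
      intro p
      by_cases hm : Below (δ s) o p.1
      · obtain ⟨N, hN⟩ := exists_lt_lastEnum p.1 w y (treeLike_rel y (δ s) (some p.1))
          (Nat.pair (encode c) (encode (s, p)))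
        refine ⟨N, fun _ k hk hP => ?_⟩
        have := hN k hk (hP.of_below hm)
        rwa [derivedString_rel] at this
      · exact ⟨0, fun h => absurd h hm⟩
    choose N₁ hN₁ using hlim
    obtain ⟨N₂, hN₂⟩ := G.unbounded w σ.length
    obtain ⟨N₃, hN₃⟩ := Z.unbounded w σ.length
    obtain ⟨k, hk, hkN⟩ := ((treeLike_rel y (δ s) o).infinite w).exists_gt
      (max (max N N₂) (max N₃ ((Finset.range σ.length ×ˢ Finset.range σ.length).sup N₁)))
    have hkN' : N < k ∧ N₂ < k ∧ N₃ < k ∧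
        (Finset.range σ.length ×ˢ Finset.range σ.length).sup N₁ < k := by
      simp only [max_lt_iff] at hkN
      tauto
    obtain ⟨hk0, hk2, hk3, hk1⟩ := hkN'
    have hZ := hN₃ k hk3.le
    refine ⟨k, hk0.le, hk, ?_, hZ, fun m hml hm e hel he h2 => ?_⟩
    · have h := isPrefix_inf.1 (rel_iff.1 hσ).1
      rw [h, G.eq_pre]
      exact pre_prefix _ (hN₂ k hk2.le)
    · rw [hz m k σ hZ, lastEnum_congr (hz' m k σ hZ)] at he
      rw [hz m k σ hZ, jump_congr (hz' m k σ hZ)] at h2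
      rw [length_pre, hy, lastEnum_congr (hy' m k), jump_congr (hy' m k)]
      -- If the assigned number had been enumerated at this stage, it would be in the jump along
      -- `w`. Then `e` would enter the jump for the image, contrary to `σ` being a true stage.
      refine ⟨hN₁ (m, e) hm k ((Finset.le_sup (f := N₁) (Finset.mem_product.2
        ⟨Finset.mem_range.2 hml, Finset.mem_range.2 hel⟩)).trans hk1.le) hk, fun hq => ?_⟩
      have hag := (rel_iff.1 hσ).2 m hm
      rw [jumpAgree_iff, derivedString_rel] at hag
      refine hag ⟨e, he, (key m hm e).1 ?_, h2⟩
      obtain ⟨u, hu, hp⟩ := derivedString_isPrefix m (treeLike_rel y (δ s) (some m))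
        (Path.of_below hm hk)
      rw [derivedString_rel] at hu
      rw [hu] at hq
      exact jump_mono _ hp hq

end Certificates

/-! ### Computability of definitions by cases and by recursion -/

section

variable {α β : Type} [Primcodable α] [Primcodable β] {y : Baire}

theorem Cmp.ite {P : α → Prop} [DecidablePred P] {f g : α → β} (hP : Dec y P) (hf : Cmp y f)
    (hg : Cmp y g) : Cmp y fun a => if P a then f a else g a := by
  have h : CE y fun p : α × β => (P p.1 ∧ f p.1 = p.2) ∨ (¬ P p.1 ∧ g p.1 = p.2) :=
    ((hP.1.comp (f := fun p : α × β => p.1) (by fun_prop)).and hf).or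
      ((hP.2.comp (f := fun p : α × β => p.1) (by fun_prop)).and hg)
  refine h.of_eq fun p => ?_
  by_cases hp : P p.1 <;> simp [hp]

theorem Cmp.natRec {f : α → β} {g : α × ℕ × β → β} {n : α → ℕ} (hf : Cmp y f) (hg : Cmp y g)
    (hn : Cmp y n) :
    Cmp y fun a => (Nat.rec (f a) (fun i b => g (a, i, b)) (n a) : β) := by
  have h : CE y fun p : α × β => ∃ l : List β, (l[0]? = some (f p.1) ∧ l[n p.1]? = some p.2) ∧
      ∀ i < n p.1, ∃ b : β, l[i]? = some b ∧ l[i + 1]? = some (g (p.1, i, b)) := by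
    refine CE.ex (P := fun (p : α × β) (l : List β) => (l[0]? = some (f p.1) ∧
      l[n p.1]? = some p.2) ∧ ∀ i < n p.1, ∃ b : β, l[i]? = some b ∧
        l[i + 1]? = some (g (p.1, i, b))) (CE.and (Dec.and (by fun_prop) (by fun_prop)).1 ?_)
    refine CE.ball' (P := fun (q : (α × β) × List β) i => ∃ b : β, q.2[i]? = some b ∧
        q.2[i + 1]? = some (g (q.1.1, i, b))) ?_ (by fun_prop)
    refine CE.ex (P := fun (q : ((α × β) × List β) × ℕ) (b : β) => q.1.2[q.2]? = some b ∧
        q.1.2[q.2 + 1]? = some (g (q.1.1.1, q.2, b))) (Dec.and (by fun_prop) ?_).1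
    have : Cmp y fun q : (((α × β) × List β) × ℕ) × β => g (q.1.1.1.1, q.1.2, q.2) :=
      hg.comp (by fun_prop)
    exact Dec.eq (by fun_prop) (by fun_prop)
  refine h.of_eq fun p => ?_
  constructor
  · rintro ⟨l, ⟨h0, hn⟩, hl⟩
    have key : ∀ i ≤ n p.1, l[i]? = some (Nat.rec (f p.1) (fun i b => g (p.1, i, b)) i : β) := by
      intro i
      induction i with
      | zero => exact fun _ => h0
      | succ i ih =>
        intro hi
        obtain ⟨b, hb, hb'⟩ := hl i hi
        rw [ih (by omega)] at hb
        cases hb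
        exact hb'
    have := key _ le_rfl
    rw [hn] at this
    exact (Option.some.inj this).symm
  · intro h
    refine ⟨(List.range (n p.1 + 1)).map fun i =>
      (Nat.rec (f p.1) (fun i b => g (p.1, i, b)) i : β), ⟨by simp, by simp [← h]⟩, fun i hi => ?_⟩
    exact ⟨_, by rw [List.getElem?_map, List.getElem?_range (by omega)]; rfl,
      by rw [List.getElem?_map, List.getElem?_range (by omega)]; rfl⟩

@[fun_prop]
theorem Cmp.getD {f : α → Option β} {d : α → β} (hf : Cmp y f) (hd : Cmp y d) :
    Cmp y fun a => (f a).getD (d a) := Primrec₂.cmp_comp Primrec.option_getD hf hd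

end

/-! ### Descending runs -/

section Run

open Classical in
/-- Starting from `v₀`, move to `v i` at step `i` if this is allowed and smaller. -/
noncomputable def run {V : Type} (lt : V → V → Prop) (ok : ℕ → Prop) (v : ℕ → V) (v₀ : V) : ℕ → V
  | 0 => v₀
  | i + 1 => if ok i ∧ lt (v i) (run lt ok v v₀ i) then v i else run lt ok v v₀ i

variable {V : Type} {lt : V → V → Prop} {ok ok' : ℕ → Prop} {v : ℕ → V} {v₀ : V}

theorem run_congr {k : ℕ} (h : ∀ i < k, (ok i ↔ ok' i)) : run lt ok v v₀ k = run lt ok' v v₀ k := by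
  induction k with
  | zero => rfl
  | succ k ih =>
    rw [run, run, ih fun i hi => h i (hi.trans k.lt_succ_self)]
    have hk := propext (h k k.lt_succ_self)
    rw [hk]

theorem run_anti (ht : ∀ a b c, lt a b → lt b c → lt a c) {i j : ℕ} (hij : i ≤ j) :
    run lt ok v v₀ j = run lt ok v v₀ i ∨ lt (run lt ok v v₀ j) (run lt ok v v₀ i) := by
  induction j, hij using Nat.le_induction with
  | base => exact Or.inl rfl
  | succ j hij ih =>
    rw [run]
    split_ifs with h
    · right
      rcases ih with h' | h'
      · rw [← h']
        exact h.2
      · exact ht _ _ _ h.2 h'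
    · exact ih

/-- The last conjunct records that the adopted value was below something. For `boundLT` this
excludes the top bound `none`, so that bound is held only before the first move. -/
theorem run_cases (i : ℕ) : run lt ok v v₀ i = v₀ ∨
    ∃ j < i, ok j ∧ run lt ok v v₀ i = v j ∧ ∃ u, lt (v j) u := by
  induction i with
  | zero => exact Or.inl rfl
  | succ i ih =>
    rw [run]
    split_ifs with h
    · exact Or.inr ⟨i, i.lt_succ_self, h.1, rfl, _, h.2⟩
    · rcases ih with h' | ⟨j, hj, h'⟩
      · exact Or.inl h'
      · exact Or.inr ⟨j, hj.trans i.lt_succ_self, h'⟩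

theorem exists_run_stable (hw : WellFounded lt) (ht : ∀ a b c, lt a b → lt b c → lt a c)
    (ok : ℕ → Prop) (v : ℕ → V) (v₀ : V) :
    ∃ I, ∀ i, I ≤ i → run lt ok v v₀ i = run lt ok v v₀ I := by
  obtain ⟨_, ⟨I, rfl⟩, hI⟩ := hw.has_min (Set.range (run lt ok v v₀)) ⟨_, 0, rfl⟩
  exact ⟨I, fun i hi => (run_anti ht hi).resolve_right (hI _ ⟨i, rfl⟩)⟩

theorem not_lt_of_run_stable (hw : WellFounded lt) {I i : ℕ}
    (hI : ∀ i, I ≤ i → run lt ok v v₀ i = run lt ok v v₀ I) (hi : I ≤ i) (hok : ok i) :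
    ¬ lt (v i) (run lt ok v v₀ I) := by
  intro h
  have h1 := hI (i + 1) (hi.trans i.le_succ)
  rw [run, hI i hi, if_pos ⟨hok, h⟩] at h1
  rw [h1] at h
  exact hw.irrefl.irrefl _ h

end Run

/-! ### Ordinals and trees of a class description -/

/-- The empty well-ordering. -/
def NOrdinal.empty : NOrdinal where
  field := ∅
  lt _ _ := False
  mem_of_lt h := h.elim
  trans h := h.elim
  trichotomous h := h.elim
  wf := ⟨fun _ => ⟨_, fun _ h => h.elim⟩⟩

namespace ClassDescription

theorem boundLT_trans {η : NOrdinal} (a b c : Option ℕ) (h : boundLT η a b) (h' : boundLT η b c) :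
    boundLT η a c := by
  cases a with
  | none => exact h.elim
  | some a =>
    cases c with
    | none => trivial
    | some c =>
      cases b with
      | none => exact h'.elim
      | some b => exact η.trans h h'

theorem boundLT_wf (η : NOrdinal) : WellFounded (boundLT η) := by
  have hs : ∀ a : ℕ, Acc (boundLT η) (some a) := fun a => by
    induction a using η.wf.induction with
    | _ a ih =>
      refine ⟨_, fun b hb => ?_⟩
      cases b with
      | none => exact hb.elim
      | some b => exact ih b hb
  refine ⟨fun o => ?_⟩
  cases o with
  | some a => exact hs a
  | none =>
    refine ⟨_, fun b hb => ?_⟩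
    cases b with
    | none => exact hb.elim
    | some b => exact hs b

variable (Γ : ClassDescription)

theorem mem_nonLeaves_iff {s : List ℕ} : s ∈ nonLeaves Γ.T ↔ ∃ n, s ++ [n] ∈ Γ.T :=
  ⟨fun h => h.2, fun ⟨n, hn⟩ => ⟨Γ.mem_of_append s n hn, n, hn⟩⟩

theorem mem_of_prefix {s t : List ℕ} (h : t <+: s) (hs : s ∈ Γ.T) : t ∈ Γ.T := by
  obtain ⟨u, rfl⟩ := h
  induction u using List.reverseRecOn with
  | nil => simpa using hs
  | append_singleton u a ih =>
    rw [← List.append_assoc] at hs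
    exact ih (Γ.mem_of_append _ _ hs)

open Classical in
/-- The leftmost child of a non-leaf. -/
noncomputable def leftmost (s : List ℕ) : ℕ :=
  if h : ∃ n, s ++ [n] ∈ Γ.T then Nat.find h else 0

open Classical in
theorem leftmost_mem {s : List ℕ} (hs : s ∈ nonLeaves Γ.T) : s ++ [Γ.leftmost s] ∈ Γ.T := by
  rw [leftmost, dif_pos hs.2]
  exact Nat.find_spec hs.2

open Classical in
theorem leftmost_min {s : List ℕ} {n : ℕ} (hn : n < Γ.leftmost s) : s ++ [n] ∉ Γ.T := by
  intro h
  rw [leftmost, dif_pos ⟨n, h⟩] at hn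
  exact Nat.find_min _ hn h

theorem eq_leftmost {s : List ℕ} {n : ℕ} (h : s ++ [n] ∈ Γ.T) (hn : ∀ i < n, s ++ [i] ∉ Γ.T) :
    n = Γ.leftmost s := by
  have hs := Γ.mem_nonLeaves_iff.2 ⟨n, h⟩
  rcases lt_trichotomy n (Γ.leftmost s) with h1 | h1 | h1
  · exact absurd h (Γ.leftmost_min h1)
  · exact h1
  · exact absurd (Γ.leftmost_mem hs) (hn _ h1)

open Classical in
/-- The ordinals `ξ s`, made empty at the arguments where they do not matter. -/
noncomputable def level (s : List ℕ) : NOrdinal :=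
  if s ∈ nonLeaves Γ.T then Γ.ξ s else NOrdinal.empty

theorem level_eq {s : List ℕ} (hs : s ∈ nonLeaves Γ.T) : Γ.level s = Γ.ξ s := if_pos hs

variable {Γ} {y : Baire}

theorem dec_tree (hy : TuringLE Γ.y y) : Dec y fun s => s ∈ Γ.T := Γ.decidable_T.dec.mono hy

theorem dec_nonLeaves (hy : TuringLE Γ.y y) : Dec y fun s => s ∈ nonLeaves Γ.T := by
  refine ((dec_tree hy).and (Γ.decidable_leaf.dec.mono hy).not).of_eq fun s => ?_
  simp only [IsLeaf, nonLeaves, Set.mem_ofPred_eq]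
  by_cases hs : s ∈ Γ.T <;> simp [hs]

theorem cmp_leftmost (hy : TuringLE Γ.y y) : Cmp y Γ.leftmost := by
  have h : Dec y fun p : List ℕ × ℕ => (p.1 ∈ nonLeaves Γ.T ∧ p.1 ++ [p.2] ∈ Γ.T ∧
      ∀ i < p.2, p.1 ++ [i] ∉ Γ.T) ∨ (p.1 ∉ nonLeaves Γ.T ∧ p.2 = 0) := by
    have h1 : Dec y fun p : List ℕ × ℕ => p.1 ∈ nonLeaves Γ.T :=
      (dec_nonLeaves hy).comp (f := fun p : List ℕ × ℕ => p.1) (by fun_prop)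
    have h2 : Dec y fun p : List ℕ × ℕ => p.1 ++ [p.2] ∈ Γ.T :=
      (dec_tree hy).comp (f := fun p : List ℕ × ℕ => p.1 ++ [p.2]) (by fun_prop)
    have h3 : Dec y fun p : (List ℕ × ℕ) × ℕ => p.1.1 ++ [p.2] ∈ Γ.T :=
      (dec_tree hy).comp (f := fun p : (List ℕ × ℕ) × ℕ => p.1.1 ++ [p.2]) (by fun_prop)
    have h4 : Dec y fun p : List ℕ × ℕ => ∀ i < p.2, p.1 ++ [i] ∉ Γ.T :=
      Dec.ball h3.not (by fun_prop)
    exact (h1.and (h2.and h4)).or (h1.not.and (by fun_prop))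
  refine h.1.of_eq fun p => ?_
  constructor
  · rintro (⟨_, h1, h2⟩ | ⟨h1, h2⟩)
    · exact (Γ.eq_leftmost h1 h2).symm
    · rw [h2, leftmost, dif_neg fun h => h1 (Γ.mem_nonLeaves_iff.2 h)]
  · intro h
    by_cases hs : p.1 ∈ nonLeaves Γ.T
    · left
      rw [← h]
      exact ⟨hs, Γ.leftmost_mem hs, fun i => Γ.leftmost_min⟩
    · right
      rw [leftmost, dif_neg fun h => hs (Γ.mem_nonLeaves_iff.2 h)] at h
      exact ⟨hs, h.symm⟩

theorem dec_below_level (hy : TuringLE Γ.y y) :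
    Dec y fun p : List ℕ × Option ℕ × ℕ => Below (Γ.level p.1) p.2.1 p.2.2 := by
  have hD := dec_nonLeaves hy
  have h1 := (Γ.computable_ξ.1.mono hy).dec_and
    (hD.comp (f := fun p : List ℕ × ℕ => p.1) (by fun_prop))
  have h2 := (Γ.computable_ξ.2.1.mono hy).dec_and
    (hD.comp (f := fun p : List ℕ × ℕ × ℕ => p.1) (by fun_prop))
  have h3 := h1.comp (f := fun p : List ℕ × Option ℕ × ℕ => (p.1, p.2.2)) (by fun_prop)
  have h4 := h2.comp (f := fun p : List ℕ × Option ℕ × ℕ => (p.1, p.2.2, p.2.1.getD 0))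
    (by fun_prop)
  have h0 : Dec y fun p : List ℕ × Option ℕ × ℕ => p.2.1 = none := by fun_prop
  refine ((h0.and h3).or (h0.not.and h4)).of_eq ?_
  rintro ⟨s, o, m⟩
  by_cases hs : s ∈ nonLeaves Γ.T
  · cases o <;> simp [hs, level, Below]
  · cases o <;> simp [hs, level, Below, NOrdinal.empty]

theorem dec_mem_η (hy : TuringLE Γ.y y) :
    Dec y fun p : List ℕ × ℕ => p.1 ∈ nonLeaves Γ.T ∧ p.2 ∈ (Γ.η p.1).field :=
  (Γ.computable_η.1.mono hy).dec_and
    ((dec_nonLeaves hy).comp (f := fun p : List ℕ × ℕ => p.1) (by fun_prop))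

theorem dec_boundLT (hy : TuringLE Γ.y y) :
    Dec y fun p : List ℕ × Option ℕ × Option ℕ =>
    p.1 ∈ nonLeaves Γ.T ∧ boundLT (Γ.η p.1) p.2.1 p.2.2 := by
  have hD := dec_nonLeaves hy
  have h2 := (Γ.computable_η.2.1.mono hy).dec_and
    (hD.comp (f := fun p : List ℕ × ℕ × ℕ => p.1) (by fun_prop))
  have h4 := h2.comp (f := fun p : List ℕ × Option ℕ × Option ℕ =>
    (p.1, p.2.1.getD 0, p.2.2.getD 0)) (by fun_prop)
  have h1 := hD.comp (f := fun p : List ℕ × Option ℕ × Option ℕ => p.1) (by fun_prop)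
  have h0 : Dec y fun p : List ℕ × Option ℕ × Option ℕ => p.2.1 = none := by fun_prop
  have h0' : Dec y fun p : List ℕ × Option ℕ × Option ℕ => p.2.2 = none := by fun_prop
  refine (h1.and (h0.not.and (h0'.or h4))).of_eq ?_
  rintro ⟨s, o, o'⟩
  refine and_congr_right fun hs => ?_
  cases o <;> cases o' <;> simp [boundLT, hs]

end ClassDescription

/-! ### Restricting computability to computable arguments -/

section

variable {α β γ : Type} [Primcodable α] [Primcodable β] [Primcodable γ] {y z : Baire}

theorem ComputableOn.comp {D : Set α} {E : Set γ} {f : α → β} {g : γ → α}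
    (h : ComputableOn z D f) (hg : Cmp z g) (hE : ∀ c ∈ E, g c ∈ D) :
    ComputableOn z E fun c => f (g c) := by
  obtain ⟨P, hP, H⟩ := h.exists_ce
  exact ComputableOn.of_ce (P := fun c b => P (g c, b))
    (hP.comp (f := fun p : γ × β => (g p.1, p.2)) (by fun_prop)) fun c hc b => H _ (hE c hc) b

open Classical in
theorem decidableOn_iff {D : Set α} {P : α → Prop} :
    DecidableOn z D P ↔ ComputableOn z D fun a => decide (P a) := by
  refine exists_congr fun g => and_congr_right fun _ => forall_congr' fun a =>
    forall_congr' fun _ => ⟨?_, fun h => ⟨_, h, decide_eq_true_iff⟩⟩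
  rintro ⟨b, hb, h⟩
  have : decide (P a) = b := by
    cases b <;> simp_all
  subst this
  exact hb

theorem DecidableOn.comp {D : Set α} {E : Set γ} {P : α → Prop} {g : γ → α}
    (h : DecidableOn z D P) (hg : Cmp z g) (hE : ∀ c ∈ E, g c ∈ D) :
    DecidableOn z E fun c => P (g c) := by
  classical
  exact decidableOn_iff.2 ((decidableOn_iff.1 h).comp hg hE)

theorem NOrdinal.ComputedOn.computed {D : Set α} {δ : α → NOrdinal}
    (h : NOrdinal.ComputedOn y D δ) (hy : TuringLE y z) {i : α} (hi : i ∈ D) :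
    NOrdinal.Computed z (δ i) := by
  obtain ⟨h1, h2, h3, h4, h5, h6⟩ := h
  exact ⟨(h1.mono hy).comp (g := fun p : Unit × ℕ => (i, p.2)) (by fun_prop) fun _ _ => hi,
    (h2.mono hy).comp (g := fun p : Unit × ℕ × ℕ => (i, p.2)) (by fun_prop) fun _ _ => hi,
    (h3.mono hy).comp (g := fun p : Unit × ℕ => (i, p.2)) (by fun_prop) fun _ _ => hi,
    (h4.mono hy).comp (g := fun p : Unit × ℕ => (i, p.2)) (by fun_prop) fun _ _ => hi,
    (h5.mono hy).comp (g := fun _ : Unit => i) (by fun_prop) fun _ _ => hi,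
    (h6.mono hy).comp (g := fun _ : Unit => i) (by fun_prop) fun _ _ => hi⟩

end

namespace ClassDescription

/-! ### Approximating the values of another name -/

/-- The string, the child and the bound that are considered at step `i`. -/
def candidate (i : ℕ) : List ℕ × ℕ × Option ℕ :=
  (decode (α := List ℕ × ℕ × Option ℕ) i.unpair.1).getD ([], 0, none)

/-- The component `t` is arbitrary, so each triple is considered again at arbitrarily late steps,
after its certificate has appeared. -/
theorem candidate_pair (a : List ℕ × ℕ × Option ℕ) (t : ℕ) :
    candidate (Nat.pair (encode a) t) = a := by
  rw [candidate, Nat.unpair_pair, encodek]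
  rfl

section Approximation

variable (Γ : ClassDescription) {y : Baire} (Z G : Functional y) (c : Nat.Partrec.Code)
  (Φ : List ℕ × List ℕ × List ℕ × ℕ × Option ℕ → Prop)

/-- At step `i` the candidate is certified along the string `υ`, and `Φ` confirms its values. -/
def Accepts (s : List ℕ) (υ : Str) (i : ℕ) : Prop :=
  s ∈ nonLeaves Γ.T ∧
  (∃ j < i + 1, rel y (Γ.level s) none (.fin (υ.take j)) υ ∧
    Cert Γ.level Z G c s none (υ.take j) (candidate i).1) ∧
  (∃ k < i + 1, Φ (υ.take k, s, candidate i)) ∧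
  s ++ [(candidate i).2.1] ∈ Γ.T ∧
  ((candidate i).2.2 = none ∨ s ∈ nonLeaves Γ.T ∧ (candidate i).2.2.getD 0 ∈ (Γ.η s).field)

/-- The child and the bound after step `i`. -/
noncomputable def approx (s : List ℕ) (υ : Str) (i : ℕ) : ℕ × Option ℕ :=
  run (fun v v' => boundLT (Γ.η s) v.2 v'.2) (Γ.Accepts Z G c Φ s υ) (fun i => (candidate i).2)
    (Γ.leftmost s, none) i

variable {Γ Z G c Φ}

/-- Step `i` inspects only prefixes of length at most `i`, and for these being a true stage of `σ`
and of `υ` is the same. Consequently the approximations at the true stages of `w` are pieces of one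
and the same run along `w`. -/
theorem accepts_congr {s σ : List ℕ} {υ : Str} (h : rel y (Γ.level s) none (.fin σ) υ) {i : ℕ}
    (hi : i < σ.length) : Γ.Accepts Z G c Φ s (.fin σ) i ↔ Γ.Accepts Z G c Φ s υ i := by
  have hR := treeLike_rel y (Γ.level s) none
  have ht : ∀ j < i + 1, υ.take j = (Str.fin σ).take j := fun j hj =>
    take_of_isPrefix (hR.isPrefix h) (by omega)
  unfold Accepts
  refine and_congr_right fun _ => and_congr ?_ (and_congr_left fun _ => ?_)
  · refine exists_congr fun j => and_congr_right fun hj => ?_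
    rw [ht j hj]
    refine and_congr_left fun _ => ⟨fun h' => hR.trans h' h, fun h' => hR.conv h' h ?_⟩
    simp [Str.take]
  · exact exists_congr fun k => and_congr_right fun hk => by rw [ht k hk]

theorem approx_congr {s σ : List ℕ} {υ : Str} (h : rel y (Γ.level s) none (.fin σ) υ) {i : ℕ}
    (hi : i ≤ σ.length) : Γ.approx Z G c Φ s (.fin σ) i = Γ.approx Z G c Φ s υ i :=
  run_congr fun _ hj => accepts_congr h (hj.trans_le hi)

theorem approx_anti (s : List ℕ) (υ : Str) {i j : ℕ} (hij : i ≤ j) :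
    Γ.approx Z G c Φ s υ j = Γ.approx Z G c Φ s υ i ∨
      boundLT (Γ.η s) (Γ.approx Z G c Φ s υ j).2 (Γ.approx Z G c Φ s υ i).2 :=
  run_anti (lt := fun v v' : ℕ × Option ℕ => boundLT (Γ.η s) v.2 v'.2)
    (fun _ _ _ => boundLT_trans _ _ _) hij

theorem approx_cases (s : List ℕ) (υ : Str) (i : ℕ) :
    Γ.approx Z G c Φ s υ i = (Γ.leftmost s, none) ∨ ∃ j < i, Γ.Accepts Z G c Φ s υ j ∧
      Γ.approx Z G c Φ s υ i = (candidate j).2 ∧ ∃ u, boundLT (Γ.η s) (candidate j).2.2 u := by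
  rcases run_cases (lt := fun v v' : ℕ × Option ℕ => boundLT (Γ.η s) v.2 v'.2)
    (ok := Γ.Accepts Z G c Φ s υ) (v := fun i => (candidate i).2)
    (v₀ := (Γ.leftmost s, none)) i with h | ⟨j, h1, h2, h3, u, h4⟩
  · exact Or.inl h
  · exact Or.inr ⟨j, h1, h2, h3, u.2, h4⟩

theorem exists_approx_stable (s : List ℕ) (υ : Str) :
    ∃ I, ∀ i, I ≤ i → Γ.approx Z G c Φ s υ i = Γ.approx Z G c Φ s υ I :=
  exists_run_stable (InvImage.wf Prod.snd (boundLT_wf _)) (fun _ _ _ => boundLT_trans _ _ _) _ _ _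

theorem Cmp.candidate {α : Type} [Primcodable α] {f : α → ℕ} (hf : Cmp y f) :
    Cmp y fun a => ClassDescription.candidate (f a) := by
  unfold ClassDescription.candidate
  fun_prop

theorem dec_accepts (hy : TuringLE Γ.y y) (hΦ : Dec y Φ) :
    Dec y fun p : (List ℕ × List ℕ) × ℕ => Γ.Accepts Z G c Φ p.1.1 (.fin p.1.2) p.2 := by
  have hc : Cmp y fun p : (List ℕ × List ℕ) × ℕ => candidate p.2 := Cmp.candidate (by fun_prop)
  have hs : Dec y fun p : (List ℕ × List ℕ) × ℕ => p.1.1 ∈ nonLeaves Γ.T :=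
    (dec_nonLeaves hy).comp (f := fun p : (List ℕ × List ℕ) × ℕ => p.1.1) (by fun_prop)
  have hc' : Cmp y fun p : ((List ℕ × List ℕ) × ℕ) × ℕ => candidate p.1.2 :=
    Cmp.candidate (by fun_prop)
  have hp : Cmp y fun p : ((List ℕ × List ℕ) × ℕ) × ℕ => pre y p.1.1.2.length :=
    (TuringLE.refl y).cmp_pre.comp (by fun_prop)
  refine hs.and (Dec.and ?_ (Dec.and ?_ (Dec.and ?_ (Dec.or (by fun_prop) ?_))))
  · refine Dec.bex (P := fun (p : (List ℕ × List ℕ) × ℕ) j =>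
      rel y (Γ.level p.1.1) none (.fin (p.1.2.take j)) (.fin p.1.2) ∧
        Cert Γ.level Z G c p.1.1 none (p.1.2.take j) (candidate p.2).1) ?_ (by fun_prop)
    refine Dec.and ?_ (Dec.cert Z G (dec_below_level hy) (by fun_prop) (by fun_prop)
      (by fun_prop) (by fun_prop) (by fun_prop))
    refine (Dec.rel (dec_below_level hy) hp (s := fun p : ((List ℕ × List ℕ) × ℕ) × ℕ => p.1.1.1)
      (o := fun _ => none) (σ := fun p => p.1.1.2.take p.2) (τ := fun p => p.1.1.2)
      (by fun_prop) (by fun_prop) (by fun_prop) (by fun_prop)).of_eq fun p => ?_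
    exact rel_congr _ _ fun i hi => ext_of_prefix (by simp) i (by simpa using hi)
  · refine Dec.bex (P := fun (p : (List ℕ × List ℕ) × ℕ) k =>
      Φ (p.1.2.take k, p.1.1, candidate p.2)) ?_ (by fun_prop)
    exact hΦ.comp (f := fun p : ((List ℕ × List ℕ) × ℕ) × ℕ =>
      (p.1.1.2.take p.2, p.1.1.1, candidate p.1.2)) (by fun_prop)
  · exact (dec_tree hy).comp (f := fun p : (List ℕ × List ℕ) × ℕ =>
      p.1.1 ++ [(candidate p.2).2.1]) (by fun_prop)
  · exact (dec_mem_η hy).comp (f := fun p : (List ℕ × List ℕ) × ℕ =>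
      (p.1.1, (candidate p.2).2.2.getD 0)) (by fun_prop)

theorem cmp_approx (hy : TuringLE Γ.y y) (hΦ : Dec y Φ) :
    Cmp y fun p : List ℕ × List ℕ => Γ.approx Z G c Φ p.1 (.fin p.2) p.2.length := by
  classical
  have hb : Dec y fun p : (List ℕ × List ℕ) × ℕ × ℕ × Option ℕ =>
      Γ.Accepts Z G c Φ p.1.1 (.fin p.1.2) p.2.1 ∧ p.1.1 ∈ nonLeaves Γ.T ∧
        boundLT (Γ.η p.1.1) (candidate p.2.1).2.2 p.2.2.2 := by
    refine Dec.and ((dec_accepts hy hΦ).comp (f := fun p : (List ℕ × List ℕ) × ℕ × ℕ × Option ℕ =>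
      (p.1, p.2.1)) (by fun_prop)) ?_
    have hc : Cmp y fun p : (List ℕ × List ℕ) × ℕ × ℕ × Option ℕ => candidate p.2.1 :=
      Cmp.candidate (by fun_prop)
    exact (dec_boundLT hy).comp (f := fun p : (List ℕ × List ℕ) × ℕ × ℕ × Option ℕ =>
      (p.1.1, (candidate p.2.1).2.2, p.2.2.2)) (by fun_prop)
  have hc : Cmp y fun p : (List ℕ × List ℕ) × ℕ × ℕ × Option ℕ => (candidate p.2.1).2 :=
    (Cmp.candidate (by fun_prop)).snd
  have hl : Cmp y fun p : List ℕ × List ℕ => Γ.leftmost p.1 :=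
    (cmp_leftmost hy).comp (by fun_prop)
  have h := Cmp.natRec (f := fun p : List ℕ × List ℕ => ((Γ.leftmost p.1, none) : ℕ × Option ℕ))
    (n := fun p => p.2.length) (by fun_prop) (Cmp.ite hb hc (g := fun p => p.2.2) (by fun_prop))
    (by fun_prop)
  convert h using 2 with p
  generalize p.2.length = n
  induction n with
  | zero => rfl
  | succ n ih =>
    rw [approx, run]
    rw [approx] at ih
    rw [ih]
    -- The decidable version of the test asks in addition that the node is not a leaf, so that the
    -- order on bounds is computable; acceptance already includes this.
    by_cases h1 : Γ.Accepts Z G c Φ p.1 (.fin p.2) n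
    · simp only [h1, h1.1, true_and]
    · simp only [h1, false_and, if_false]

theorem child_mem_approx {s : List ℕ} (hs : s ∈ nonLeaves Γ.T) (υ : Str) (i : ℕ) :
    s ++ [(Γ.approx Z G c Φ s υ i).1] ∈ Γ.T := by
  rcases approx_cases (Z := Z) (G := G) (c := c) (Φ := Φ) s υ i with h | ⟨j, _, h1, h2, _⟩
  · rw [h]
    exact Γ.leftmost_mem hs
  · rw [h2]
    exact h1.2.2.2.1

variable (Γ Z G c Φ)

/-- The total name whose functions are the approximations. -/
noncomputable def approxName (hy : TuringLE Γ.y y) (hΦ : Dec y Φ) (h0 : [] ∈ nonLeaves Γ.T) :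
    Name Γ where
  z := y
  level := Γ.ξ []
  S := Set.univ
  f s σ := (Γ.approx Z G c Φ s (.fin σ) σ.length).1
  β s σ := (Γ.approx Z G c Φ s (.fin σ) σ.length).2
  -- The limit is the child held by the infinite run along `w` once it has stabilized.
  lim s w := (Γ.approx Z G c Φ s (.inf w)
    (exists_approx_stable (Γ := Γ) (Z := Z) (G := G) (c := c) (Φ := Φ) s (.inf w)).choose).1
  le_z := hy
  level_eq _ := rfl
  level_computed := Γ.computable_ξ.computed hy h0
  isForest _ _ _ _ _ _ _ := trivial
  decidable_S := (Dec.of_eq (P := fun _ : List ℕ => (0 : ℕ) = 0) (by fun_prop)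
    fun _ => iff_of_true rfl trivial).decidableOn _
  computable_f := (cmp_approx hy hΦ).fst.computableOn _
  computable_β := (cmp_approx hy hΦ).snd.computableOn _
  approximates s hs w _ := by
    have hI := (exists_approx_stable (Γ := Γ) (Z := Z) (G := G) (c := c) (Φ := Φ) s
      (.inf w)).choose_spec
    generalize (exists_approx_stable (Γ := Γ) (Z := Z) (G := G) (c := c) (Φ := Φ) s
      (.inf w)).choose = I at hI ⊢
    refine ((Set.finite_lt_nat I).image (pre w)).subset ?_
    rintro σ ⟨h1, h2⟩
    have h3 := isPrefix_inf.1 h1.1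
    refine ⟨σ.length, Set.mem_ofPred.2 (not_le.1 fun hle => h2 ⟨trivial, ?_⟩), h3.symm⟩
    rw [← Γ.level_eq hs] at h1
    rw [approx_congr h1 le_rfl, hI _ hle]
  β_mem s hs σ _ b hb := by
    rcases approx_cases (Γ := Γ) (Z := Z) (G := G) (c := c) (Φ := Φ) s (.fin σ) σ.length with
      h | ⟨j, _, h1, h2, _⟩
    · rw [h] at hb
      cases hb
    · rw [h2] at hb
      have := h1.2.2.2.2
      simpa [hb, hs] using this
  β_anti s hs σ _ τ _ h := by
    rw [← Γ.level_eq hs] at h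
    rw [approx_congr h le_rfl]
    rcases approx_anti (Γ := Γ) (Z := Z) (G := G) (c := c) (Φ := Φ) s (.fin τ)
      (isPrefix_fin.1 h.1).length_le with h' | h'
    · exact Or.inl (congrArg Prod.snd h')
    · exact Or.inr h'
  β_lt s hs σ _ τ _ h hne := by
    rw [← Γ.level_eq hs] at h
    rw [approx_congr h le_rfl] at hne ⊢
    rcases approx_anti (Γ := Γ) (Z := Z) (G := G) (c := c) (Φ := Φ) s (.fin τ)
      (isPrefix_fin.1 h.1).length_le with h' | h'
    · exact absurd (congrArg Prod.fst h').symm hne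
    · exact h'
  child_mem s hs σ _ := child_mem_approx hs _ _
  default s hs σ _ hn n hlt := by
    rcases approx_cases (Γ := Γ) (Z := Z) (G := G) (c := c) (Φ := Φ) s (.fin σ) σ.length with
      h | ⟨j, _, h1, h2, u, h3⟩
    · rw [h] at hlt
      exact Γ.leftmost_min hlt
    · rw [h2] at hn
      rw [hn] at h3
      exact h3.elim

variable {Γ Z G c Φ}

theorem mem_paths_univ (z : Baire) (δ : NOrdinal) (w : Baire) : w ∈ paths z δ Set.univ := by
  have h := ((treeLike_rel z δ none).infinite w).image (f := pre w) fun i _ j _ hij => by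
    simpa using congrArg List.length hij
  refine h.mono ?_
  rintro _ ⟨k, hk, rfl⟩
  exact ⟨trivial, hk⟩

/-- The stable bound is not undercut by the bound of any true stage of `G w` in `S`. If the stable
child differed from the limit value, a longer true stage carrying the limit value would have a
strictly smaller bound. -/
theorem lim_approx_eq
    (hc : ∀ V k, Nat.pair (encode c) k ∈ jump y (.inf V) ↔
      ∃ i, CertBody Γ.level Z G (c, pre V i, k))
    {w : Baire} {N : Name Γ} (hN : N.z = Z.lim w) (hx : G.lim w ∈ paths N.z N.level N.S)
    {s : List ℕ} (hs : s ∈ nonLeaves Γ.T)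
    (hΦN : ∀ σ n b, (∃ k, Φ (pre w k, s, σ, n, b)) ↔ σ ∈ N.S ∧ n = N.f s σ ∧ b = N.β s σ)
    {I : ℕ} (hI : ∀ i, I ≤ i → Γ.approx Z G c Φ s (.inf w) i = Γ.approx Z G c Φ s (.inf w) I) :
    (Γ.approx Z G c Φ s (.inf w) I).1 = N.lim s (G.lim w) := by
  have hcert := cert_spec hc w s none
  rw [← hN] at hcert
  have hR := treeLike_rel N.z (Γ.ξ s) none
  obtain ⟨B, hB⟩ := ((N.approximates s hs _ hx).image List.length).bddAbove
  -- The approximation fails at only finitely many true stages, whose lengths are bounded by `B`;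
  -- longer true stages are in `S` and show the limit value.
  have hlong : ∀ L, ∃ σ : List ℕ, L ≤ σ.length ∧ rel N.z (Γ.ξ s) none (.fin σ) (.inf (G.lim w)) ∧
      σ ∈ N.S ∧ N.f s σ = N.lim s (G.lim w) := by
    intro L
    obtain ⟨k, hk, hkL⟩ := (hR.infinite (G.lim w)).exists_gt (max B L)
    refine ⟨pre (G.lim w) k, by simp; omega, hk, not_not.1 fun h => ?_⟩
    have := hB ⟨_, ⟨hk, h⟩, rfl⟩
    simp only [length_pre] at this
    omega
  -- By completeness of certificates, such a `σ` is accepted at some step after stabilization, so a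
  -- smaller bound would make the run move again.
  have hmin : ∀ σ : List ℕ, rel N.z (Γ.ξ s) none (.fin σ) (.inf (G.lim w)) → σ ∈ N.S →
      ¬ boundLT (Γ.η s) (N.β s σ) (Γ.approx Z G c Φ s (.inf w) I).2 := by
    intro σ h1 h2
    obtain ⟨k, hk⟩ := (hΦN σ _ _).2 ⟨h2, rfl, rfl⟩
    rw [Γ.level_eq hs] at hcert
    obtain ⟨j, -, h3, h4⟩ := hcert.2 σ h1 0
    have hle := Nat.right_le_pair (encode (σ, N.f s σ, N.β s σ)) (max I (max j k))
    have h := not_lt_of_run_stable (lt := fun v v' : ℕ × Option ℕ => boundLT (Γ.η s) v.2 v'.2)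
      (InvImage.wf Prod.snd (boundLT_wf _)) hI
      (i := Nat.pair (encode (σ, N.f s σ, N.β s σ)) (max I (max j k))) (by omega)
    simp only [candidate_pair] at h
    refine h ⟨hs, ⟨j, by omega, ?_, ?_⟩, ⟨k, by omega, ?_⟩, ?_, ?_⟩
    · rw [Γ.level_eq hs]
      exact h3
    · rw [candidate_pair]
      exact h4
    · rw [candidate_pair]
      exact hk
    · rw [candidate_pair]
      exact N.child_mem s hs σ h2
    · rw [candidate_pair]
      cases hb : N.β s σ with
      | none => exact Or.inl rfl
      | some b => exact Or.inr ⟨hs, N.β_mem s hs σ h2 b hb⟩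
  rcases approx_cases (Γ := Γ) (Z := Z) (G := G) (c := c) (Φ := Φ) s (.inf w) I with
    h | ⟨j, _, h1, h2, _⟩
  · obtain ⟨σ, -, h1, h2, h3⟩ := hlong 0
    have := hmin σ h1 h2
    rw [h] at this ⊢
    -- If the run never moved, no true stage in `S` has a bound in `η`, since any such bound is
    -- below the top. The default condition then forces the leftmost child.
    have hb : N.β s σ = none := by
      cases hb : N.β s σ with
      | none => rfl
      | some b => exact absurd (by rw [hb]; trivial) this
    rw [← h3]
    exact (Γ.eq_leftmost (N.child_mem s hs σ h2) (N.default s hs σ h2 hb)).symm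
  · obtain ⟨-, ⟨i, -, h3, h4⟩, ⟨k, -, h5⟩, -⟩ := h1
    have h6 := hcert.1 _ _ h3 h4
    rw [Γ.level_eq hs] at h6
    obtain ⟨h7, h8, h9⟩ := (hΦN (candidate j).1 (candidate j).2.1 (candidate j).2.2).1
      ⟨k, h5⟩
    obtain ⟨σ, hl, h10, h11, h12⟩ := hlong (candidate j).1.length
    have h13 := hR.conv h6 h10 hl
    have := hmin σ h10 h11
    rw [h2] at this ⊢
    rw [h9] at this
    rw [h8, ← h12]
    by_contra hne
    exact this (N.β_lt s hs _ h7 σ h11 h13 hne)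

end Approximation

theorem leaf_eq_of_lim_eq {Γ : ClassDescription} {M N : Name Γ} {w x : Baire}
    (h : ∀ s ∈ nonLeaves Γ.T, M.lim s w = N.lim s x) : M.leaf w = N.leaf x := by
  have : M.IsLeafAt w = N.IsLeafAt x := by
    funext s
    refine propext (and_congr_right fun hs => forall_congr' fun t => forall_congr' fun n =>
      forall_congr' fun ht => ?_)
    rw [h t (Γ.mem_nonLeaves_iff.2 ⟨n, Γ.mem_of_prefix ht hs.1⟩)]
  rw [Name.leaf, this]
  rfl

/-- There is a total name whose value at `w` is the value at `G w` of any name with the oracle `Z w`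
whose functions are enumerated by `Φ` along `w`. -/
theorem exists_name (Γ : ClassDescription) (h0 : [] ∈ nonLeaves Γ.T) {y : Baire}
    (hy : TuringLE Γ.y y) (Z G : Functional y)
    {Φ : List ℕ × List ℕ × List ℕ × ℕ × Option ℕ → Prop} (hΦ : Dec y Φ) :
    ∃ M : Name Γ, M.z = y ∧ M.IsTotal ∧ ∀ w (N : Name Γ), N.z = Z.lim w →
      G.lim w ∈ paths N.z N.level N.S →
      (∀ s ∈ nonLeaves Γ.T, ∀ σ n b, (∃ k, Φ (pre w k, s, σ, n, b)) ↔
        σ ∈ N.S ∧ n = N.f s σ ∧ b = N.β s σ) →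
      M.leaf w = N.leaf (G.lim w) := by
  obtain ⟨c, hc⟩ := exists_cert_code Z G (dec_below_level hy)
  refine ⟨Γ.approxName Z G c Φ hy hΦ h0, rfl, rfl, fun w N hN hx h => ?_⟩
  exact leaf_eq_of_lim_eq fun s hs => lim_approx_eq hc hN hx hs (h s hs)
    (exists_approx_stable s (.inf w)).choose_spec

end ClassDescription

/-! ### Functionals -/

section

variable {y z : Baire}

theorem pairing_even (z x : Baire) (n : ℕ) : pairing z x (n + n) = z n := by
  rw [pairing, if_pos (by omega)]
  congr 1
  omega

theorem pairing_odd (z x : Baire) (n : ℕ) : pairing z x (n + n + 1) = x n := by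
  rw [pairing, if_neg (by omega)]
  congr 1
  omega

theorem continuous_pairing {f g : Baire → Baire} (hf : Continuous f) (hg : Continuous g) :
    Continuous fun x => pairing (f x) (g x) := by
  refine continuous_pi fun n => ?_
  by_cases hn : n % 2 = 0
  · simp only [pairing, hn, if_true]
    exact (continuous_apply _).comp hf
  · simp only [pairing, hn, if_false]
    exact (continuous_apply _).comp hg

theorem turingLE_pairing_left (z x : Baire) : TuringLE z (pairing z x) := by
  refine TuringLE.of_cmp ?_
  have h : Cmp (pairing z x) fun n => pairing z x (n + n) := Cmp.oracle.comp (by fun_prop)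
  simpa only [pairing_even] using h

theorem turingLE_pairing_right (z x : Baire) : TuringLE x (pairing z x) := by
  refine TuringLE.of_cmp ?_
  have h : Cmp (pairing z x) fun n => pairing z x (n + n + 1) := Cmp.oracle.comp (by fun_prop)
  simpa only [pairing_odd] using h

theorem TuringLE.trans {x : Baire} (h : TuringLE x y) (h' : TuringLE y z) : TuringLE x z :=
  TuringLE.of_cmp (CE.mono h' h.cmp)

/-- A constant functional. -/
def Functional.const (hz : TuringLE z y) : Functional y where
  fn ρ := pre z ρ.length
  lim _ := z
  cmp := hz.cmp_pre.comp (by fun_prop)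
  eq_pre w k := by simp
  unbounded w n := ⟨n, fun k hk => by simpa using hk⟩

/-- Every second entry, from the entry `a` on. -/
def Functional.alternate (y : Baire) (a : ℕ) : Functional y where
  fn ρ := (List.range ((ρ.length - a) / 2)).map fun n => ρ.getD (n + n + a) 0
  lim w n := w (n + n + a)
  cmp := by
    refine Primrec.cmp (Primrec.list_map (Primrec.list_range.comp (Primrec.nat_div.comp
      (Primrec.nat_sub.comp Primrec.list_length (Primrec.const a)) (Primrec.const 2))) ?_)
    exact (Primrec.list_getD 0).comp Primrec.fst (Primrec.nat_add.comp
      (Primrec.nat_add.comp Primrec.snd Primrec.snd) (Primrec.const a))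
  eq_pre w k := by
    simp only [length_pre, List.length_map, List.length_range]
    refine List.map_congr_left fun n hn => ?_
    rw [List.getD_eq_getElem?_getD, getElem?_pre w _ k]
    · rfl
    · have := List.mem_range.1 hn
      omega
  unbounded w n := ⟨n + n + a, fun k hk => by
    simp only [length_pre, List.length_map, List.length_range]
    omega⟩

theorem exists_modulus {g : Baire → Baire} (hg : Continuous g) (w : Baire) (n : ℕ) :
    ∃ K, ∀ w', pre w' K = pre w K → pre (g w') n = pre (g w) n := by
  have h : ∀ i : ℕ, ∃ K, ∀ w', pre w' K = pre w K → g w' i = g w i := by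
    intro i
    have hopen : IsOpen {w' | g w' i = g w i} :=
      (isOpen_discrete {g w i}).preimage ((continuous_apply i).comp hg)
    obtain ⟨I, u, hu, hsub⟩ := isOpen_pi_iff.1 hopen w rfl
    refine ⟨I.sup id + 1, fun w' hw => hsub fun j hj => ?_⟩
    have hj' : j < I.sup id + 1 := Nat.lt_succ_of_le (Finset.le_sup (f := id) hj)
    have h1 := getElem?_pre w' j _ hj'
    rw [hw, getElem?_pre w j _ hj', Option.some.injEq] at h1
    rw [← h1]
    exact (hu j hj).2
  choose K hK using h
  refine ⟨(Finset.range n).sup K, fun w' hw => List.map_congr_left fun i hi => hK i w' ?_⟩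
  have hle : K i ≤ (Finset.range n).sup K := Finset.le_sup (Finset.mem_range.2 (List.mem_range.1 hi))
  have := congrArg (List.take (K i)) hw
  rwa [take_pre, take_pre, min_eq_left hle] at this

open Classical in
/-- The longest initial segment that the values of `g` on the neighbourhood given by `ρ` have in
common, restricted to the length of `ρ`. -/
noncomputable def commonPrefix (g : Baire → Baire) (ρ : List ℕ) : List ℕ :=
  pre (g (ext ρ)) (Nat.findGreatest (fun j => ∀ w, pre w ρ.length = ρ →
    pre (g w) j = pre (g (ext ρ)) j) ρ.length)

/-- A continuous function as a functional. -/
noncomputable def Functional.ofContinuous {g : Baire → Baire} (hg : Continuous g)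
    (h : Cmp y (commonPrefix g)) : Functional y where
  fn := commonPrefix g
  lim := g
  cmp := h
  eq_pre w k := by
    classical
    have := Nat.findGreatest_spec (P := fun j => ∀ w', pre w' (pre w k).length = pre w k →
      pre (g w') j = pre (g (ext (pre w k))) j) (Nat.zero_le (pre w k).length) (fun _ _ => rfl)
    rw [commonPrefix, length_pre (g (ext (pre w k)))]
    exact (this w (by simp)).symm
  unbounded w n := by
    classical
    obtain ⟨K, hK⟩ := exists_modulus hg w n
    refine ⟨max K n, fun k hk => ?_⟩
    rw [commonPrefix, length_pre]
    have key : ∀ w', pre w' k = pre w k → pre (g w') n = pre (g w) n := fun w' hw => by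
      refine hK w' ?_
      have := congrArg (List.take K) hw
      rwa [take_pre, take_pre, min_eq_left ((le_max_left _ _).trans hk)] at this
    have hext : pre (ext (pre w k)) k = pre w k :=
      List.map_congr_left fun i hi => ext_of_prefix (by simp) i (by simpa using hi)
    refine Nat.le_findGreatest (by simpa using (le_max_right _ _).trans hk) fun w' hw => ?_
    rw [length_pre] at hw
    rw [key _ hw, key _ hext]

/-- Every continuous function is a functional in some oracle. -/
theorem exists_functional {g : Baire → Baire} (hg : Continuous g) (z : Baire) :
    ∃ y, TuringLE z y ∧ ∃ G : Functional y, G.lim = g := by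
  -- The modulus of a continuous function need not be computable, so the whole table of common
  -- prefixes is joined to the oracle.
  let m : Baire := fun n => encode (commonPrefix g (Denumerable.ofNat (List ℕ) n))
  refine ⟨pairing z m, turingLE_pairing_left z m, Functional.ofContinuous hg ?_, rfl⟩
  have h : Cmp (pairing z m) fun ρ : List ℕ => Denumerable.ofNat (List ℕ) (m (encode ρ)) :=
    Cmp.ofNat ((turingLE_pairing_right z m).cmp.comp (by fun_prop))
  simpa [m] using h

end

/-- Enumerability by a single program, with the oracle as a finite string. -/
theorem CE.exists_code {α : Type} [Primcodable α] {z : Baire} {P : α → Prop} (h : CE z P) :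
    ∃ c : Nat.Partrec.Code, ∀ a, P a ↔ ∃ j t, (c.evaln t (encode (pre z j, a))).isSome := by
  classical
  obtain ⟨Q, hQ, hP⟩ := h
  have hF : Primrec fun n => (decode (α := List ℕ × α) n).bind fun p =>
      if Q p then some 0 else none := by
    refine Primrec.option_bind Primrec.decode ?_
    exact Primrec.ite (hQ.comp Primrec.snd) (Primrec.const (some 0)) (Primrec.const none)
  obtain ⟨c, hc⟩ := Nat.Partrec.Code.exists_code.1 (Partrec.nat_iff.1 (Computable.ofOption hF.to_comp))
  refine ⟨c, fun a => (hP a).trans (exists_congr fun j => ?_)⟩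
  have h1 : Q (pre z j, a) ↔ (c.eval (encode (pre z j, a))).Dom := by
    rw [hc]
    simp only [encodek, Option.bind_some]
    split_ifs with h <;> simp [h]
  rw [h1, Part.dom_iff_mem]
  simp only [Option.isSome_iff_exists, Nat.Partrec.Code.evaln_complete]
  rw [exists_comm]
  rfl

theorem NOrdinal.computed_empty (z : Baire) : NOrdinal.empty.Computed z := by
  have hF : ∀ {α : Type} [Primcodable α], Dec z fun _ : α => False := fun {α} _ =>
    Dec.of_eq (P := fun _ : α => (0 : ℕ) = 1) (by fun_prop) fun _ => by simp
  have hs : ∀ a, NOrdinal.empty.succ a = none := fun a => dif_neg fun ⟨_, h, _⟩ => h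
  have hl : ∀ a, ¬ NOrdinal.empty.IsLimitPoint a := fun a h => h.1
  have hn : NOrdinal.empty.least NOrdinal.empty.field = none := dif_neg fun ⟨_, h, _⟩ => h
  have hg : NOrdinal.empty.greatest NOrdinal.empty.field = none := dif_neg fun ⟨_, h, _⟩ => h
  refine ⟨hF.decidableOn _, hF.decidableOn _, ?_, ?_, ?_, ?_⟩
  · simp only [hs]
    exact (Cmp.const none).computableOn _
  · simp only [hl]
    exact hF.decidableOn _
  · simp only [hn]
    exact (Cmp.const none).computableOn _
  · simp only [hg]
    exact (Cmp.const none).computableOn _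

namespace ClassDescription

variable (Γ : ClassDescription)

theorem toFun_eq_coe {Γ : ClassDescription} {N : Name Γ} {F : Baire → Bool} :
    N.toFun = (F : Baire →. Bool) ↔
      (∀ x, x ∈ paths N.z N.level N.S) ∧ ∀ x, Γ.label (N.leaf x) = F x := by
  refine (funext_iff (β := fun _ => Part Bool)).trans ?_
  rw [← forall_and]
  refine forall_congr' fun x => ?_
  rw [PFun.coe_val, Part.eq_some_iff]
  exact ⟨fun ⟨h, h'⟩ => ⟨h, h'⟩, fun ⟨h, h'⟩ => ⟨h, h'⟩⟩

/-- The functions of a name are given by an enumerable relation. -/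
theorem Name.ce_graph {Γ : ClassDescription} (N : Name Γ) :
    CE N.z fun p : List ℕ × List ℕ × ℕ × Option ℕ => p.1 ∈ nonLeaves Γ.T ∧ p.2.1 ∈ N.S ∧
      p.2.2.1 = N.f p.1 p.2.1 ∧ p.2.2.2 = N.β p.1 p.2.1 := by
  obtain ⟨P, hP, HP⟩ := N.computable_f.exists_ce
  obtain ⟨Q, hQ, HQ⟩ := N.computable_β.exists_ce
  have h1 := (dec_nonLeaves N.le_z).1.comp
    (f := fun p : List ℕ × List ℕ × ℕ × Option ℕ => p.1) (by fun_prop)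
  have h2 := N.decidable_S.dec.1.comp
    (f := fun p : List ℕ × List ℕ × ℕ × Option ℕ => p.2.1) (by fun_prop)
  have h3 := hP.comp (f := fun p : List ℕ × List ℕ × ℕ × Option ℕ => ((p.1, p.2.1), p.2.2.1))
    (by fun_prop)
  have h4 := hQ.comp (f := fun p : List ℕ × List ℕ × ℕ × Option ℕ => ((p.1, p.2.1), p.2.2.2))
    (by fun_prop)
  refine (h1.and (h2.and (h3.and h4))).of_eq fun p => ?_
  refine and_congr_right fun hs => and_congr_right fun hσ => ?_
  rw [HP _ ⟨hs, hσ⟩, HQ _ ⟨hs, hσ⟩, eq_comm, @eq_comm _ (N.β p.1 p.2.1)]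

/-! ### Class descriptions whose root is not a leaf -/

section NonLeafRoot

variable {Γ}

/-- The simulation with constant oracle map `N.z`. Its result is total although `N` need only have
all of Baire space as its domain. -/
theorem comp_mem_totalBoldface (h0 : [] ∈ nonLeaves Γ.T) (N : Name Γ)
    (hN : ∀ x, x ∈ paths N.z N.level N.S) {g : Baire → Baire} (hg : Continuous g) :
    (fun w => Γ.label (N.leaf (g w))) ∈ Γ.totalBoldface := by
  obtain ⟨y, hy, G, rfl⟩ := exists_functional hg N.z
  obtain ⟨Q, hQ, H⟩ := CE.mono hy N.ce_graph
  have hp : Cmp y fun p : List ℕ × List ℕ × List ℕ × ℕ × Option ℕ => pre y p.1.length :=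
    (TuringLE.refl y).cmp_pre.comp (by fun_prop)
  obtain ⟨M, -, hM, h⟩ := exists_name Γ h0 (N.le_z.trans hy) (Functional.const hy) G
    (Φ := fun p => Q (pre y p.1.length, p.2))
    ((PrimrecPred.dec hQ).comp (f := fun p : List ℕ × List ℕ × List ℕ × ℕ × Option ℕ =>
      (pre y p.1.length, p.2)) (by fun_prop))
  refine ⟨M, hM, toFun_eq_coe.2 ⟨fun x => ?_, fun w => ?_⟩⟩
  · rw [show M.S = Set.univ from hM]
    exact mem_paths_univ _ _ _
  · refine congrArg Γ.label (h w N rfl (hN _) fun s hs σ n b => ?_)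
    simp only [length_pre]
    rw [← H]
    simp only [hs, true_and]

/-- A name enters the simulation only through its oracle and a program enumerating the graph of its
functions. Both fit into one element of Baire space, which becomes the index of the section. -/
theorem exists_sections_eq (h0 : [] ∈ nonLeaves Γ.T) :
    ∃ U ∈ Γ.totalLightface Γ.y, ∀ F ∈ Γ.totalBoldface, ∃ z, F = fun x => U (pairing z x) := by
  -- In `w = ⟨z, x⟩` the entry `0` is the program, the even entries from `2` on are the oracle, and
  -- the odd entries are the argument.
  let Z := Functional.alternate Γ.y 2
  let G := Functional.alternate Γ.y 1
  obtain ⟨M, hMz, hM, h⟩ := exists_name Γ h0 (TuringLE.refl Γ.y) Z G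
    -- The program `w 0` is run for fewer steps than the length of the prefix, on pieces of the
    -- oracle found in that prefix. The default `0` never matters, as the empty prefix allows no
    -- `t`.
    (Φ := fun p => ∃ t < p.1.length, ∃ j < p.1.length,
      (Nat.Partrec.Code.evaln t (Denumerable.ofNat Nat.Partrec.Code (p.1[0]?.getD 0))
        (encode ((Z.fn p.1).take j, p.2))).isSome) (by
      refine Dec.bex (Dec.bex ?_ (by fun_prop)) (by fun_prop)
      have hZ : Cmp Γ.y fun p : ((List ℕ × List ℕ × List ℕ × ℕ × Option ℕ) × ℕ) × ℕ =>
        Z.fn p.1.1.1 := Z.cmp.comp (by fun_prop)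
      exact Dec.isSome (Cmp.evaln (by fun_prop) (by fun_prop) (by fun_prop)))
  refine ⟨fun w => Γ.label (M.leaf w), ⟨M, hMz, hM, toFun_eq_coe.2 ⟨fun x => ?_, fun _ => rfl⟩⟩, ?_⟩
  · rw [show M.S = Set.univ from hM]
    exact mem_paths_univ _ _ _
  rintro F ⟨N, -, hNF⟩
  obtain ⟨hN, hF⟩ := toFun_eq_coe.1 hNF
  obtain ⟨c, hc⟩ := N.ce_graph.exists_code
  refine ⟨fun n => n.casesOn (encode c) N.z, funext fun x => ?_⟩
  set w := pairing (fun n => n.casesOn (encode c) N.z) x with hw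
  have hZw : Z.lim w = N.z := funext fun n => by
    show w (n + n + 2) = _
    rw [show n + n + 2 = (n + 1) + (n + 1) by omega, hw, pairing_even]
  have hGw : G.lim w = x := funext fun n => pairing_odd _ x n
  have hw0 : w 0 = encode c := pairing_even _ x 0
  rw [← hF x]
  refine congrArg Γ.label ?_
  rw [h w N hZw.symm (hN _) fun s hs σ n b => ?_, hGw]
  have hc := hc (s, σ, n, b)
  simp only [hs, true_and] at hc
  rw [hc]
  have hpre : ∀ k j, j ≤ (Z.fn (pre w k)).length → (Z.fn (pre w k)).take j = pre N.z j := by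
    intro k j hj
    rw [Z.eq_pre, take_pre, min_eq_left hj, hZw]
  have hcode : ∀ k, 0 < k → Denumerable.ofNat Nat.Partrec.Code ((pre w k)[0]?.getD 0) = c := by
    intro k hk
    rw [getElem?_pre w 0 k hk, hw0]
    exact Denumerable.ofNat_encode c
  constructor
  · rintro ⟨k, t, ht, j, hj, he⟩
    rw [length_pre] at ht hj
    simp only [hcode k (by omega)] at he
    -- If `j` exceeds the known part of the oracle, truncation returns that whole part, which is
    -- still a prefix of the oracle.
    rcases le_total j (Z.fn (pre w k)).length with hl | hl
    · rw [hpre k j hl] at he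
      exact ⟨_, _, he⟩
    · rw [List.take_of_length_le hl, Z.eq_pre, hZw] at he
      exact ⟨_, _, he⟩
  · rintro ⟨j, t, he⟩
    obtain ⟨K, hK⟩ := Z.unbounded w j
    refine ⟨max K (max j t) + 1, t, by rw [length_pre]; omega, j, by rw [length_pre]; omega, ?_⟩
    simp only [hcode _ (Nat.succ_pos _)]
    rwa [hpre _ j (hK _ (by omega))]

end NonLeafRoot

/-! ### Class descriptions whose root is a leaf: constant functions -/

section LeafRoot

variable {Γ}

theorem nonLeaves_eq_empty (h0 : [] ∉ nonLeaves Γ.T) {s : List ℕ} : s ∉ nonLeaves Γ.T := by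
  intro hs
  cases s with
  | nil => exact h0 hs
  | cons a s => exact h0 (Γ.mem_nonLeaves_iff.2 ⟨a, Γ.mem_of_prefix (s := a :: s) (by simp) hs.1⟩)

theorem leaf_eq_nil (h0 : [] ∉ nonLeaves Γ.T) (N : Name Γ) (x : Baire) : N.leaf x = [] := by
  have h : N.IsLeafAt x [] := by
    refine ⟨⟨Γ.root_mem, fun n hn => h0 (Γ.mem_nonLeaves_iff.2 ⟨n, hn⟩)⟩, fun t n h => ?_⟩
    simp at h
  have h' : N.IsLeafAt x (N.leaf x) := Classical.epsilon_spec ⟨_, h⟩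
  rcases List.eq_nil_or_concat (N.leaf x) with hl | ⟨t, n, hl⟩
  · exact hl
  · rw [hl] at h'
    exact absurd (Γ.mem_nonLeaves_iff.2 ⟨n, by simpa using h'.1.1⟩) (nonLeaves_eq_empty h0)

theorem exists_total_name (h0 : [] ∉ nonLeaves Γ.T) : ∃ N : Name Γ, N.z = Γ.y ∧ N.IsTotal :=
  ⟨{  z := Γ.y
      level := NOrdinal.empty
      S := Set.univ
      f := fun _ _ => 0
      β := fun _ _ => none
      lim := fun _ _ => 0
      le_z := TuringLE.refl _
      level_eq := fun h => absurd h h0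
      level_computed := NOrdinal.computed_empty _
      isForest := fun _ _ _ _ _ _ _ => trivial
      decidable_S := (Dec.of_eq (P := fun _ : List ℕ => (0 : ℕ) = 0) (by fun_prop)
        fun _ => iff_of_true rfl trivial).decidableOn _
      computable_f := (Cmp.const 0).computableOn _
      computable_β := (Cmp.const none).computableOn _
      approximates := fun _ hs => absurd hs (nonLeaves_eq_empty h0)
      β_mem := fun _ hs => absurd hs (nonLeaves_eq_empty h0)
      β_anti := fun _ hs => absurd hs (nonLeaves_eq_empty h0)
      β_lt := fun _ hs => absurd hs (nonLeaves_eq_empty h0)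
      child_mem := fun _ hs => absurd hs (nonLeaves_eq_empty h0)
      default := fun _ hs => absurd hs (nonLeaves_eq_empty h0) }, rfl, rfl⟩

theorem mem_totalLightface_of_leaf (h0 : [] ∉ nonLeaves Γ.T) :
    (fun _ => Γ.label []) ∈ Γ.totalLightface Γ.y := by
  obtain ⟨N, hz, hN⟩ := exists_total_name h0
  refine ⟨N, hz, hN, toFun_eq_coe.2 ⟨fun x => ?_, fun x => by rw [leaf_eq_nil h0]⟩⟩
  rw [show N.S = Set.univ from hN]
  exact mem_paths_univ _ _ _

end LeafRoot

/-! ### Closure under continuous preimages, universality and diagonalization -/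

theorem totalLightface_subset (z : Baire) : Γ.totalLightface z ⊆ Γ.totalBoldface :=
  fun _ ⟨N, _, hN⟩ => ⟨N, hN⟩

/-- Total functions named by (not necessarily total) names are closed under composition with
continuous functions. -/
theorem totalBoldface_comp {N : Name Γ} {F : Baire → Bool} (hF : N.toFun = (F : Baire →. Bool))
    {g : Baire → Baire} (hg : Continuous g) : (fun w => F (g w)) ∈ Γ.totalBoldface := by
  obtain ⟨hN, hF⟩ := toFun_eq_coe.1 hF
  simp only [← hF]
  by_cases h0 : [] ∈ nonLeaves Γ.T
  · exact comp_mem_totalBoldface h0 N hN hg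
  · simp only [leaf_eq_nil h0]
    exact Γ.totalLightface_subset _ (mem_totalLightface_of_leaf h0)

theorem exists_universal : ∃ U ∈ Γ.totalLightface Γ.y, IsUniversalFor U Γ.totalBoldface := by
  obtain ⟨U, hU, H⟩ : ∃ U ∈ Γ.totalLightface Γ.y,
      ∀ F ∈ Γ.totalBoldface, ∃ z, F = fun x => U (pairing z x) := by
    by_cases h0 : [] ∈ nonLeaves Γ.T
    · exact exists_sections_eq h0
    · refine ⟨_, mem_totalLightface_of_leaf h0, fun F ⟨N, _, hF⟩ => ⟨0, funext fun x => ?_⟩⟩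
      rw [← (toFun_eq_coe.1 hF).2, leaf_eq_nil h0]
  refine ⟨U, hU, Set.Subset.antisymm ?_ H⟩
  rintro F ⟨z, rfl⟩
  obtain ⟨N, _, _, hN⟩ := hU
  exact Γ.totalBoldface_comp hN (continuous_pairing continuous_const continuous_id)

/-- Cantor's diagonal: `x ↦ 1 - U ⟨x, x⟩` would be the section of `U` at some `z`, and the two sides
differ at `z`. The name of `1 - U` need not be total, because closure under composition does not ask
for that. -/
theorem not_mem_boldface {U : Baire → Bool} (hU : IsUniversalFor U Γ.totalBoldface) :
    ((fun x => !(U x) : Baire → Bool) : Baire →. Bool) ∉ Γ.boldface := by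
  intro h
  obtain ⟨_, _, N, _, hN⟩ := Set.mem_iUnion₂.1 h
  obtain ⟨z, hz⟩ := hU.symm.subset (Γ.totalBoldface_comp hN
    (continuous_pairing continuous_id continuous_id))
  simpa using congrFun hz z

end ClassDescription

end Wadge

theorem mainTheorem7 (Γ : Wadge.ClassDescription) :
    (∃ U : Wadge.Baire → Bool,
      U ∈ Γ.totalLightface Γ.y ∧
      Wadge.IsUniversalFor U Γ.totalBoldface ∧
      ((fun x => !(U x) : Wadge.Baire → Bool) : Wadge.Baire →. Bool) ∉ Γ.boldface) ∧
    Wadge.IsWadgeClass Γ.pointclass ∧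
    Wadge.IsNonSelfDual Γ.pointclass := by
  obtain ⟨U, hU, hUniv⟩ := Γ.exists_universal
  have hnot := Γ.not_mem_boldface hUniv
  refine ⟨⟨U, hU, hUniv, hnot⟩, ⟨{x | U x = true}, ?_⟩,
    {x | U x = true}, ⟨U, Γ.totalLightface_subset _ hU, rfl⟩, ?_⟩
  · obtain ⟨N, _, _, hN⟩ := hU
    ext A
    constructor
    · rintro ⟨F, hF, rfl⟩
      obtain ⟨z, rfl⟩ := hUniv.symm.subset hF
      exact ⟨Wadge.pairing z, Wadge.continuous_pairing continuous_const continuous_id, rfl⟩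
    · rintro ⟨g, hg, rfl⟩
      exact ⟨_, Γ.totalBoldface_comp hN hg, rfl⟩
  · rintro ⟨F, ⟨N, _, hN⟩, hA⟩
    -- A characteristic function of the complement of `{x | U x = true}` can only be `1 - U`, so its
    -- name would be a name of `1 - U`.
    refine hnot (Set.mem_iUnion₂.2 ⟨N.z, N.le_z, N, rfl, hN.trans ?_⟩)
    congr 1
    funext x
    have : ¬ U x = true ↔ F x = true := Set.ext_iff.1 hA x
    cases hF : F x <;> cases hx : U x <;> simp_all
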